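/- **Setting.** There are $M\ge1$ messages, $K\ge1$ contexts and $T\ge 1$ timeslots. In each timeslot $N\ge1$ users arrive; user $n$ has context $x_t(n)\in[1:K]$. The timeslots are independent and the context vectors $x_t$ are identically distributed. The users of a timeslot are divided uniformly at random, independently of the contexts, into $\tau$ groups $\mathcal N_1,\dots,\mathcal N_\tau$ of size $N/\tau$ (with $\tau\mid N$), and the server, which sees the contexts, sends one message to each group; $a_t(n)$ is the message that user $n$ receives. After the timeslot it observes the payoffs $r_t(n)\in[0,1]$. These are independent across users and timeslots, and the payoff of message $m$ in context $k$ has a fixed unknown law with mean $\mu(k,m)$. For some $\Delta\ge\underline\Delta>0$ all means lie in $\{\Delta,2\Delta,3\Delta,\dots\}$. The messages are partitioned into $L$ nonempty, unknown content types, and in every context two messages have the same mean payoff if and only if they have the same type. The learning regret is $$R(T)=\mathbb E\sum_{t=1}^{T}\sum_{n=1}^{N}\bigl[\mu(x_t(n),a^*(n,x_t))-r_t(n)\bigr],$$ where, for $n\in\mathcal N_s$, $a^*(n,x_t)$ maximizes $m\mapsto\sum_{n'\in\mathcal N_s}\mu(x_t(n'),m)$. At any time, $\bar r(k,m)$ is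 the average payoff observed so far for message $m$ from users with context $k$ ($0$ if there are none), and $Z(k,m)$ is the number of these observations. All logarithms are natural. Ties and other arbitrary choices below are resolved by any fixed rule. The algorithms know neither $L$ nor the means nor the types. **Clustering routine** (input: a distance $\bar d(m_1,m_2)$ on messages). Start from singletons. As long as the smallest value of $\max_{m_1\in\mathcal M',m_2\in\mathcal M''}\bar d(m_1,m_2)$ over pairs of distinct clusters $\mathcal M',\mathcal M''$ is less than $\underline\Delta/2$, unite a pair attaining it. One representative is chosen from each resulting cluster, by a fixed rule. **Algorithm A** (one transmission per user, $\tau=N$). Let $s$ be the smallest integer such that there are $K$ sets $\mathcal S_1,\dots,\mathcal S_K$ of $s$ messages each (not necessarily distinct) such that every pair of distinct messages is contained in some $\mathcal S_k$. Fix such sets, and for every pair a context $x_{m_1,m_2}=k$ with $m_1,m_2\in\mathcal S_k$. In timeslot $t$, with $D(t)=\frac{32}{\underline\Delta^2}\log t$, each user, with context $k$ say, receives the following, determined from the data of timeslots $1,\dots,t-1$. If some $m\in\mathcal S_k$ has $Z(k,m)<D(t)$, then such an $m$. Otherwise the messages are clustered with $\bar d(m_1,m_2)=|\bar r(x_{m_1,m_2},m_1)-\bar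 r(x_{m_1,m_2},m_2)|$; if some representative $m$ has $Z(k,m)<D(t)$, then such an $m$; otherwise a representative maximizing $\bar r(k,\cdot)$. **Algorithm B** ($1\le\tau\le N$, $\tau\mid N$). For the first $\lceil\frac{32KM}{\tau\underline\Delta^2}\log(NTM)\rceil$ timeslots, the consecutive transmissions ($\tau$ per timeslot) go round robin through all messages. Then the messages are clustered, once, with $\bar d(m_1,m_2)=|\bar r(k_0,m_1)-\bar r(k_0,m_2)|$ for a fixed context $k_0$; let $\hat L$ be the number of representatives. For the next $\lceil\frac{16NK\hat L}{\tau^2\underline\Delta^2}\log(\hat LNKT)\rceil$ timeslots the transmissions go round robin through the representatives. In every later timeslot each group $\mathcal N_s$ receives a representative maximizing $\sum_{n\in\mathcal N_s}\bar r(x_t(n),\cdot)$. **Proposition.** In each case the sum in the definition of $R(T)$ is integrable, and the following hold. 1. ($\tau=1$.) For every $\underline\Delta>0$ there is a constant $C$, depending only on $\underline\Delta$, such that, if all contexts have the same arrival rate (the mean number of users with context $k$ per timeslot is $N/K$ for every $k$; the users of one timeslot may be dependent), Algorithm B with $\tau=1$ satisfies, for all $T\ge1$, $$R(T)\le C\,(NKM+LN^2K)\log(NMKT).$$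 2. ($\tau=N$.) For every $\underline\Delta>0$ there is a constant $C$, depending only on $\underline\Delta$, such that, if the contexts of the users of a timeslot are independent and uniform on $[1:K]$, Algorithm A satisfies, for all $T\ge2^N$, $$R(T)\le C\left(KM\sqrt{\frac{\log(MK)}{K}}+KL\right)\log T .$$ 3. (General $\tau$.) There is an absolute constant $C$ such that, if the contexts of the users of a timeslot are independent and uniform on $[1:K]$, then for every $\tau\mid N$ Algorithm B satisfies $$R(T)\le C\left(\frac{NKM}{\tau\underline\Delta^2}\log(NTM)+\frac{LN^2K}{\tau^2\underline\Delta^2}\log(LNKT)\right)$$ for all $T\ge1$ with $\tau\le\frac{KM}{\underline\Delta^2}\log(NTM)$, in particular for all $T\ge e^\tau$. -/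

import Mathlib

open MeasureTheory ProbabilityTheory

namespace LatentBandit

/-! ### Interaction between the server and the users

There are `N` users per timeslot, `K` contexts, `M` messages and `τ` transmissions per timeslot.
Timeslots are numbered `0, 1, 2, …`; slot number `t` is the `(t + 1)`-st timeslot. -/

/-- What the server has seen in one finished timeslot: the context of every user, the message that
every user received, and the payoff of every user. -/
structure Slot (N K M : ℕ) where
  ctx : Fin N → Fin K
  msg : Fin N → Fin M
  pay : Fin N → ℝ

/-- A recommendation strategy. From the finished timeslots (most recent first), the contexts of the
present users and their division into `τ` groups it determines the message for every user. -/
abbrev Policy (N K M τ : ℕ) : Type :=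
  List (Slot N K M) → (Fin N → Fin K) → (Fin N → Fin τ) → Fin N → Fin M

/-- The first `t` timeslots when the policy `π` is run. `X t ω n` is the context of user `n` in slot
`t`, `G t ω n` is the group of this user, and `R t ω n k m` is the payoff that this user would give
to message `m` in context `k`; payoffs are revealed only after the slot is finished, and only for
the context and the message that occurred. -/
def history {N K M τ : ℕ} {Ω : Type*} (π : Policy N K M τ) (X : ℕ → Ω → Fin N → Fin K)
    (G : ℕ → Ω → Fin N → Fin τ) (R : ℕ → Ω → Fin N → Fin K → Fin M → ℝ) :
    ℕ → Ω → List (Slot N K M)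
  | 0, _ => []
  | t + 1, ω =>
    let h := history π X G R t ω
    let a := π h (X t ω) (G t ω)
    ⟨X t ω, a, fun n => R t ω n (X t ω n) (a n)⟩ :: h

/-- The message that user `n` receives in slot `t`. -/
def action {N K M τ : ℕ} {Ω : Type*} (π : Policy N K M τ) (X : ℕ → Ω → Fin N → Fin K)
    (G : ℕ → Ω → Fin N → Fin τ) (R : ℕ → Ω → Fin N → Fin K → Fin M → ℝ) (t : ℕ) (ω : Ω) :
    Fin N → Fin M :=
  π (history π X G R t ω) (X t ω) (G t ω)

/-- A message that maximizes the sum of the mean payoffs over the users of group `s`. -/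
noncomputable def bestMsg {N K M τ : ℕ} [NeZero M] (μ : Fin K → Fin M → ℝ) (x : Fin N → Fin K)
    (g : Fin N → Fin τ) (s : Fin τ) : Fin M :=
  (Finite.exists_max fun m : Fin M => ∑ n with g n = s, μ (x n) m).choose

/-- The payoff lost in the first `T` timeslots with respect to the best strategy that transmits one
message to each group. -/
noncomputable def regretSum {N K M τ : ℕ} [NeZero M] {Ω : Type*} (π : Policy N K M τ)
    (μ : Fin K → Fin M → ℝ) (X : ℕ → Ω → Fin N → Fin K) (G : ℕ → Ω → Fin N → Fin τ)
    (R : ℕ → Ω → Fin N → Fin K → Fin M → ℝ) (T : ℕ) (ω : Ω) : ℝ :=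
  ∑ t ∈ Finset.range T, ∑ n : Fin N,
    (μ (X t ω n) (bestMsg μ (X t ω) (G t ω) (G t ω n))
      - R t ω n (X t ω n) (action π X G R t ω n))

/-- The learning regret `R(T)`. -/
noncomputable def regret {N K M τ : ℕ} [NeZero M] {Ω : Type*} [MeasurableSpace Ω] (P : Measure Ω)
    (π : Policy N K M τ) (μ : Fin K → Fin M → ℝ) (X : ℕ → Ω → Fin N → Fin K)
    (G : ℕ → Ω → Fin N → Fin τ) (R : ℕ → Ω → Fin N → Fin K → Fin M → ℝ) (T : ℕ) : ℝ :=
  ∫ ω, regretSum π μ X G R T ω ∂P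

/-! ### The stochastic model -/

/-- The mean payoff of message `m` in context `k`. -/
noncomputable def meanPayoff {K M : ℕ} (D : Fin K → Fin M → Measure ℝ) (k : Fin K) (m : Fin M) :
    ℝ :=
  ∫ r, r ∂(D k m)

/-- The payoff distributions `D k m`: payoffs in `[0, 1]`, means in `{Δ, 2Δ, 3Δ, …}` for some
`Δ ≥ δ`, and `L` content types (the fibres of `typ`) such that two messages have the same mean
payoff in a context if and only if they have the same content type. -/
structure IsLatentPayoff {K M L : ℕ} (δ : ℝ) (D : Fin K → Fin M → Measure ℝ)
    (typ : Fin M → Fin L) : Prop where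
  prob : ∀ k m, IsProbabilityMeasure (D k m)
  mem_Icc : ∀ k m, ∀ᵐ r ∂(D k m), r ∈ Set.Icc (0 : ℝ) 1
  discrete : ∃ Δ : ℝ, δ ≤ Δ ∧ ∀ k m, ∃ j : ℕ, 1 ≤ j ∧ meanPayoff D k m = j * Δ
  typ_surjective : Function.Surjective typ
  typ_eq_iff : ∀ k a b, typ a = typ b ↔ meanPayoff D k a = meanPayoff D k b

/-- The arrival and payoff processes: the timeslots are independent; the context vectors are
identically distributed; the users are divided uniformly at random into `τ` groups of equal size,
independently of the contexts; the payoffs are independent across users and independent of contexts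
and groups, and the payoff of message `m` in context `k` has law `D k m`. -/
structure IsBroadcastModel {N K M τ : ℕ} {Ω : Type*} [MeasurableSpace Ω] (P : Measure Ω)
    (D : Fin K → Fin M → Measure ℝ) (X : ℕ → Ω → Fin N → Fin K) (G : ℕ → Ω → Fin N → Fin τ)
    (R : ℕ → Ω → Fin N → Fin K → Fin M → ℝ) : Prop where
  prob : IsProbabilityMeasure P
  measurable_ctx : ∀ t, Measurable (X t)
  measurable_grp : ∀ t, Measurable (G t)
  measurable_pay : ∀ t, Measurable (R t)
  indep_slots : iIndepFun (fun (t : ℕ) (ω : Ω) => (X t ω, G t ω, R t ω)) P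
  ctx_identDistrib : ∀ t, P.map (X t) = P.map (X 0)
  grp_law : ∀ t, P.map (G t) =
    uniformOn {g : Fin N → Fin τ | ∀ s, (Finset.univ.filter fun n => g n = s).card * τ = N}
  indep_ctx_grp : ∀ t, IndepFun (X t) (G t) P
  indep_pay : ∀ t, IndepFun (fun ω => (X t ω, G t ω)) (R t) P
  indep_users : ∀ t, iIndepFun (fun (n : Fin N) (ω : Ω) => R t ω n) P
  pay_law : ∀ t n k m, P.map (fun ω => R t ω n k m) = D k m

/-- All contexts have the same arrival rate: the mean number of users per timeslot with context `k`
is `N / K`. The contexts of the users within one timeslot may depend on each other. -/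
def UniformRates {N K : ℕ} {Ω : Type*} [MeasurableSpace Ω] (P : Measure Ω)
    (X : ℕ → Ω → Fin N → Fin K) : Prop :=
  ∀ t k, ∑ n : Fin N, P.real {ω | X t ω n = k} = (N : ℝ) / K

/-- The contexts of the users within one timeslot are independent and uniformly distributed. -/
def UniformUsers {N K : ℕ} {Ω : Type*} [MeasurableSpace Ω] (P : Measure Ω)
    (X : ℕ → Ω → Fin N → Fin K) : Prop :=
  ∀ t, iIndepFun (fun (n : Fin N) (ω : Ω) => X t ω n) P ∧
    ∀ n k, P.real {ω | X t ω n = k} = 1 / (K : ℝ)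

/-! ### Statistics and arbitrary choices -/

/-- The number of users with context `k` that have received message `m`. -/
def count {N K M : ℕ} (h : List (Slot N K M)) (k : Fin K) (m : Fin M) : ℕ :=
  (h.map fun o => (Finset.univ.filter fun n => o.ctx n = k ∧ o.msg n = m).card).sum

/-- The average payoff of message `m` over the users with context `k` (`0` without samples). -/
noncomputable def avg {N K M : ℕ} (h : List (Slot N K M)) (k : Fin K) (m : Fin M) : ℝ :=
  (h.map fun o => ∑ n with o.ctx n = k ∧ o.msg n = m, o.pay n).sum / count h k m

/-- The arbitrary choices of the algorithms: a message from a set of candidate messages, a pair of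
clusters from a set of candidate pairs, and a representative message of a cluster. -/
structure Choices (M : ℕ) where
  msg : Finset (Fin M) → Fin M
  msg_mem : ∀ S, S.Nonempty → msg S ∈ S
  pair : Finset (Finset (Fin M) × Finset (Fin M)) → Finset (Fin M) × Finset (Fin M)
  pair_mem : ∀ S, S.Nonempty → pair S ∈ S
  rep : Finset (Fin M) → Fin M
  rep_mem : ∀ S, S.Nonempty → rep S ∈ S

open Classical in
/-- A message among `S` with the largest score. -/
noncomputable def argmax {M : ℕ} (c : Choices M) (S : Finset (Fin M)) (score : Fin M → ℝ) :
    Fin M :=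
  c.msg (S.filter fun m => ∀ m' ∈ S, score m' ≤ score m)

/-! ### Clustering the messages into content types -/

/-- The distance of two clusters: the largest distance between their messages. -/
noncomputable def clusterDist {M : ℕ} (d : Fin M → Fin M → ℝ)
    (p : Finset (Fin M) × Finset (Fin M)) : ℝ :=
  ⨆ q : ↥(p.1 ×ˢ p.2), d q.1.1 q.1.2

open Classical in
/-- Unite two closest clusters, if their distance is less than `θ`. -/
noncomputable def mergeStep {M : ℕ} (c : Choices M) (θ : ℝ) (d : Fin M → Fin M → ℝ)
    (𝒞 : Finset (Finset (Fin M))) : Finset (Finset (Fin M)) :=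
  let cand := 𝒞.offDiag.filter fun p =>
    clusterDist d p < θ ∧ ∀ q ∈ 𝒞.offDiag, clusterDist d p ≤ clusterDist d q
  if cand.Nonempty then
    insert ((c.pair cand).1 ∪ (c.pair cand).2) ((𝒞.erase (c.pair cand).1).erase (c.pair cand).2)
  else 𝒞

/-- The final clustering. It starts from singletons; every effective step decreases the number of
clusters by one, so that nothing changes any more after `M` steps. -/
noncomputable def cluster {M : ℕ} (c : Choices M) (θ : ℝ) (d : Fin M → Fin M → ℝ) :
    Finset (Finset (Fin M)) :=
  (mergeStep c θ d)^[M] (Finset.univ.image fun m => {m})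

/-- The representatives of the clusters. -/
def reps {M : ℕ} (c : Choices M) (𝒞 : Finset (Finset (Fin M))) : Finset (Fin M) :=
  𝒞.image c.rep

/-! ### The algorithm without broadcasting -/

/-- Every pair of messages is contained in one of the sets `S k`. -/
def CoversPairs {K M : ℕ} (S : Fin K → Finset (Fin M)) : Prop :=
  ∀ a b : Fin M, a ≠ b → ∃ k, a ∈ S k ∧ b ∈ S k

/-- An allocation of the pairs of messages to the contexts: one set of `s` messages for every
context, such that all pairs are covered and `s` is as small as possible, together with a context
`pc s(a, b)` that the pair `{a, b}` is assigned to. -/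
structure IsAllocation {K M : ℕ} (S : Fin K → Finset (Fin M)) (pc : Sym2 (Fin M) → Fin K) :
    Prop where
  covers : CoversPairs S
  minimal : ∃ s : ℕ, (∀ k, (S k).card = s) ∧
    ∀ (s' : ℕ) (S' : Fin K → Finset (Fin M)),
      (∀ k, (S' k).card = s') → CoversPairs S' → s ≤ s'
  pc_mem : ∀ a b : Fin M, a ≠ b → a ∈ S (pc s(a, b)) ∧ b ∈ S (pc s(a, b))

open Classical in
/-- The algorithm that learns the content types across contexts, with one transmission per user.
With `δ` the known lower bound on `Δ` and `thr = (32 / δ ^ 2) * log t` in the `t`-th timeslot, a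
user with context `k` receives: a message of `S k` with fewer than `thr` samples in context `k`, if
there is one; otherwise a representative of the present clusters with fewer than `thr` samples in
context `k`, if there is one; otherwise the representative with the best average in context `k`. -/
noncomputable def latentPolicy (N K M τ : ℕ) (δ : ℝ) (c : Choices M) (S : Fin K → Finset (Fin M))
    (pc : Sym2 (Fin M) → Fin K) : Policy N K M τ := fun h x _ n =>
  let k := x n
  let thr : ℝ := 32 / δ ^ 2 * Real.log (h.length + 1)
  let few₁ := (S k).filter fun m => (count h k m : ℝ) < thr
  let 𝒞 := cluster c (δ / 2) fun a b => |avg h (pc s(a, b)) a - avg h (pc s(a, b)) b|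
  let few₂ := (reps c 𝒞).filter fun m => (count h k m : ℝ) < thr
  if few₁.Nonempty then c.msg few₁
  else if few₂.Nonempty then c.msg few₂
  else argmax c (reps c 𝒞) (avg h k)

/-! ### The algorithm with broadcasting -/

/-- The number of timeslots of the first exploration phase. -/
noncomputable def phase₁ (N K M τ T : ℕ) (δ : ℝ) : ℕ :=
  ⌈32 * K * M / (τ * δ ^ 2) * Real.log (N * T * M)⌉₊

/-- The number of timeslots of the second exploration phase, for `L` clusters. -/
noncomputable def phase₂ (N K L τ T : ℕ) (δ : ℝ) : ℕ :=
  ⌈16 * N * K * L / (τ ^ 2 * δ ^ 2) * Real.log (L * N * K * T)⌉₊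

/-- The algorithm with `τ` transmissions per timeslot, one for each group. In the first exploration
phase the transmissions go round robin through all messages. Then the messages are clustered by
their averages in context `k₀`. In the second exploration phase the transmissions go round robin
through the representatives of the clusters. Afterwards every group receives the representative
with the largest sum of averages over the users of the group. -/
noncomputable def broadcastPolicy (N K M τ : ℕ) [NeZero M] (T : ℕ) (δ : ℝ) (c : Choices M)
    (k₀ : Fin K) : Policy N K M τ := fun h x g n =>
  let t := h.length
  let T₁ := phase₁ N K M τ T δ
  if t < T₁ then Fin.ofNat M (t * τ + g n)
  else
    -- the part of the history that belongs to the first exploration phase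
    let h₁ := h.drop (t - T₁)
    let A := reps c (cluster c (δ / 2) fun a b => |avg h₁ k₀ a - avg h₁ k₀ b|)
    if t < T₁ + phase₂ N K A.card τ T δ then
      (A.sort (· ≤ ·)).getD (((t - T₁) * τ + g n) % A.card) 0
    else argmax c A fun m => ∑ n' with g n' = g n, avg h (x n') m

end LatentBandit

/-!
Both algorithms act correctly as soon as the averages are accurate. If all averages that enter the
distance between messages are within `δ / 4` of the means, then this distance is below `δ / 2` for
messages of the same type and above `δ / 2` for messages of different types, so that the clusters
are the types and some representative is optimal for every group. Since the total mean payoffs of a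
group are multiples of `Δ`, a representative of maximal total average is then optimal if, for every
user of the group, the averages are off by less than `δ τ / (2 N)`.

The samples are chosen adaptively, but exponentials survive this: if `y` is the total deviation of
the payoffs from their mean after `z` samples, then `exp (θ y - θ ^ 2 z / 8)` has mean at most `1`.
A deviation of the average is therefore as unlikely as `exp (-c z)` is small, and the mean of
`exp (-c z)` decays exponentially in the number of transmissions of the message, because every
transmission reaches its share of the users of each context. Hence the broadcasting algorithm has
bounded expected regret beyond its two exploration phases.

Without broadcasting, all pairs of messages lie in sets `S k` of about `M / √K` messages. The loss
of a user who receives an undersampled message is charged to that message and the user's context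
`k`. Every pair is charged at most `O(log T) + N` times, and the message of a charged pair belongs
to `S k` or represents a type. In context `k` every arrival is spent on `S k` while that set is
undersampled, so that the averages over `S k` become reliable after a logarithmic number of slots.
-/

namespace LatentBandit

open ENNReal (ofReal ofReal_mul ofReal_ne_top ofReal_le_ofReal)
open Real (exp exp_le_exp exp_pos exp_add log)
open Finset (univ)
open scoped ENNReal

/-! ### Exponential moments and independence -/

section Moments

variable {Ω : Type*} [MeasurableSpace Ω] {P : Measure Ω}

lemma lintegral_comp_prodMk_of_indepFun {α β : Type*} [MeasurableSpace α] [MeasurableSpace β]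
    [IsFiniteMeasure P] {f : Ω → α} {g : Ω → β} (hf : Measurable f) (hg : Measurable g)
    (hfg : IndepFun f g P) {F : α × β → ℝ≥0∞} (hF : Measurable F) :
    ∫⁻ ω, F (f ω, g ω) ∂P = ∫⁻ ω, ∫⁻ ω', F (f ω, g ω') ∂P ∂P := by
  rw [← lintegral_map hF (hf.prodMk hg),
    (indepFun_iff_map_prod_eq_prod_map_map hf.aemeasurable hg.aemeasurable).mp hfg,
    lintegral_prod _ hF.aemeasurable, lintegral_map hF.lintegral_prod_right' hf]
  exact lintegral_congr fun ω => lintegral_map (hF.comp measurable_prodMk_left) hg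

lemma integral_comp_prodMk_of_indepFun {α β : Type*} [MeasurableSpace α] [MeasurableSpace β]
    [IsFiniteMeasure P] {f : Ω → α} {g : Ω → β} (hf : Measurable f) (hg : Measurable g)
    (hfg : IndepFun f g P) {F : α × β → ℝ} (hF : Measurable F)
    (hint : Integrable (fun ω => F (f ω, g ω)) P) :
    ∫ ω, F (f ω, g ω) ∂P = ∫ ω, ∫ ω', F (f ω, g ω') ∂P ∂P := by
  have hmap := (indepFun_iff_map_prod_eq_prod_map_map hf.aemeasurable hg.aemeasurable).mp hfg
  have hint' : Integrable F ((P.map f).prod (P.map g)) := by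
    rwa [← hmap, integrable_map_measure hF.aestronglyMeasurable (hf.prodMk hg).aemeasurable]
  rw [← integral_map (hf.prodMk hg).aemeasurable hF.aestronglyMeasurable, hmap,
    integral_prod _ hint',
    integral_map hf.aemeasurable hint'.aestronglyMeasurable.integral_prod_right']
  exact integral_congr_ae (.of_forall fun ω => integral_map hg.aemeasurable
    (hF.comp measurable_prodMk_left).aestronglyMeasurable)

lemma lintegral_exp_sum_sub_integral_le {ι : Type*} {Y : ι → Ω → ℝ} (hindep : iIndepFun Y P)
    (hY : ∀ i, AEMeasurable (Y i) P) (h01 : ∀ i, ∀ᵐ ω ∂P, Y i ω ∈ Set.Icc (0 : ℝ) 1) (θ : ℝ)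
    (B : Finset ι) :
    ∫⁻ ω, ofReal (exp (θ * ∑ i ∈ B, (Y i ω - ∫ ω', Y i ω' ∂P))) ∂P ≤
      ofReal (exp (θ ^ 2 / 8 * B.card)) := by
  have := hindep.isProbabilityMeasure
  have hcentered : iIndepFun (fun i ω => Y i ω - ∫ ω', Y i ω' ∂P) P :=
    hindep.comp (fun i y => y - ∫ ω', Y i ω' ∂P) fun _ => measurable_id.sub_const _
  have hsum : HasSubgaussianMGF (fun ω => ∑ i ∈ B, (Y i ω - ∫ ω', Y i ω' ∂P)) _ P :=
    HasSubgaussianMGF.sum_of_iIndepFun hcentered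
      fun i _ => hasSubgaussianMGF_of_mem_Icc (hY i) (h01 i)
  rw [← ofReal_integral_eq_lintegral_ofReal (hsum.integrable_exp_mul θ)
    (.of_forall fun _ => (exp_pos _).le)]
  refine ofReal_le_ofReal ((hsum.mgf_le θ).trans (exp_le_exp.mpr (le_of_eq ?_)))
  simp only [sub_zero, nnnorm_one, one_div, inv_pow, Finset.sum_const, nsmul_eq_mul,
    NNReal.coe_mul, NNReal.coe_natCast, NNReal.coe_inv, NNReal.coe_pow, NNReal.coe_ofNat]
  ring

lemma half_le_one_sub_exp_neg {u : ℝ} (h0 : 0 ≤ u) (h1 : u ≤ 1) : u / 2 ≤ 1 - exp (-u) := by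
  have h : exp (-u) ≤ 1 / (u + 1) := by
    rw [Real.exp_neg, ← one_div]
    exact one_div_le_one_div_of_le (by linarith) (Real.add_one_le_exp u)
  have : 1 / (u + 1) ≤ 1 - u / 2 := by rw [div_le_iff₀ (by linarith)]; nlinarith
  linarith

/-- The chord of `z ↦ exp (-c z)` over `[0, b]` lies below the line with slope `-u / (2 b)`. -/
lemma exp_neg_mul_le_one_sub {b c u z : ℝ} (hu : 0 ≤ u) (hu1 : u ≤ 1) (hb : 0 < b)
    (huc : u ≤ c * b) (hz : z ∈ Set.Icc 0 b) : exp (-c * z) ≤ 1 - u / (2 * b) * z := by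
  have hzb : 0 ≤ z / b := div_nonneg hz.1 hb.le
  have hchord := convexOn_exp.2 (Set.mem_univ (0 : ℝ)) (Set.mem_univ (-(c * b)))
    (sub_nonneg.mpr ((div_le_one hb).mpr hz.2)) hzb (sub_add_cancel 1 (z / b))
  have hend : exp (-(c * b)) ≤ 1 - u / 2 := by
    have := half_le_one_sub_exp_neg hu hu1
    have := exp_le_exp.mpr (neg_le_neg huc)
    linarith
  calc exp (-c * z) = exp ((1 - z / b) • 0 + (z / b) • -(c * b)) := by
        congr 1; simp only [smul_eq_mul]; field_simp; ring
    _ ≤ (1 - z / b) • exp 0 + (z / b) • exp (-(c * b)) := hchord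
    _ ≤ (1 - z / b) • exp 0 + (z / b) • (1 - u / 2) := by
        simp only [smul_eq_mul]; gcongr
    _ = 1 - u / (2 * b) * z := by simp only [smul_eq_mul, Real.exp_zero]; field_simp; ring

lemma lintegral_exp_neg_le [IsProbabilityMeasure P] {Z : Ω → ℝ} {b c u : ℝ} (hu : 0 ≤ u)
    (hu1 : u ≤ 1) (hb : 0 < b) (huc : u ≤ c * b) (hZ : AEMeasurable Z P)
    (hZb : ∀ ω, Z ω ∈ Set.Icc 0 b) :
    ∫⁻ ω, ofReal (exp (-c * Z ω)) ∂P ≤ ofReal (exp (-(u / (2 * b) * ∫ ω, Z ω ∂P))) := by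
  have hle := fun ω => exp_neg_mul_le_one_sub hu hu1 hb huc (hZb ω)
  have hint : Integrable Z P := .of_mem_Icc 0 b hZ (.of_forall hZb)
  calc ∫⁻ ω, ofReal (exp (-c * Z ω)) ∂P
      ≤ ∫⁻ ω, ofReal (1 - u / (2 * b) * Z ω) ∂P :=
        lintegral_mono fun ω => ofReal_le_ofReal (hle ω)
    _ = ofReal (∫ ω, (1 - u / (2 * b) * Z ω) ∂P) :=
        (ofReal_integral_eq_lintegral_ofReal ((integrable_const 1).sub (hint.const_mul _))
          (.of_forall fun ω => (exp_pos _).le.trans (hle ω))).symm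
    _ = ofReal (1 - u / (2 * b) * ∫ ω, Z ω ∂P) := by
        rw [integral_sub (integrable_const 1) (hint.const_mul _), integral_const_mul]; simp
    _ ≤ _ := ofReal_le_ofReal (Real.one_sub_le_exp_neg _)

lemma lintegral_exp_sum_le {ι : Type*} {Z : ι → Ω → ℝ} {b : ι → ℝ} {S : Finset ι}
    (hindep : iIndepFun Z P) (hZ : ∀ i, Measurable (Z i))
    (hb : ∀ i ∈ S, ∫⁻ ω, ofReal (exp (Z i ω)) ∂P ≤ ofReal (exp (b i))) :
    ∫⁻ ω, ofReal (exp (∑ i ∈ S, Z i ω)) ∂P ≤ ofReal (exp (∑ i ∈ S, b i)) := by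
  have hexp : Measurable fun y : ℝ => ofReal (exp y) := by fun_prop
  have hprod (z : ι → ℝ) : ofReal (exp (∑ i ∈ S, z i)) = ∏ i ∈ S, ofReal (exp (z i)) := by
    rw [Real.exp_sum, ENNReal.ofReal_prod_of_nonneg fun _ _ => (exp_pos _).le]
  calc ∫⁻ ω, ofReal (exp (∑ i ∈ S, Z i ω)) ∂P
      = ∫⁻ ω, ∏ i ∈ S, ofReal (exp (Z i ω)) ∂P := lintegral_congr fun ω => hprod _
    _ = ∏ i ∈ S, ∫⁻ ω, ofReal (exp (Z i ω)) ∂P :=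
        lintegral_prod_eq_prod_lintegral_of_indepFun S _
          (hindep.comp (fun _ y => ofReal (exp y)) fun _ => hexp) fun i => hexp.comp (hZ i)
    _ ≤ ∏ i ∈ S, ofReal (exp (b i)) := Finset.prod_le_prod' hb
    _ = _ := (hprod b).symm

lemma lintegral_exp_neg_le_one [IsProbabilityMeasure P] {c : ℝ} (hc : 0 ≤ c) (f : Ω → ℕ) :
    ∫⁻ ω, ofReal (exp (-c * f ω)) ∂P ≤ 1 := by
  refine (lintegral_mono (g := 1) fun ω => ?_).trans_eq (by simp)
  rw [Pi.one_apply, ← ENNReal.ofReal_one]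
  refine ofReal_le_ofReal (Real.exp_le_one_iff.mpr ?_)
  exact mul_nonpos_of_nonpos_of_nonneg (neg_nonpos.mpr hc) (Nat.cast_nonneg _)

end Moments

/-! ### Statistics of the history -/

section Statistics

variable {N K M τ : ℕ}

/-- The users with context `k` who receive message `m`, when `x` lists the contexts and `a` the
messages of the users. -/
def recipients (x : Fin N → Fin K) (a : Fin N → Fin M) (k : Fin K) (m : Fin M) : Finset (Fin N) :=
  {n | x n = k ∧ a n = m}

/-- The total payoff of message `m` over the users with context `k`: the numerator of `avg`. -/
def paySum (h : List (Slot N K M)) (k : Fin K) (m : Fin M) : ℝ :=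
  (h.map fun o => ∑ n ∈ recipients o.ctx o.msg k m, o.pay n).sum

/-- The statistics through which the algorithms depend on the history: its length, and the numbers
and total payoffs of the samples in all its initial parts (the most recent slots come first). -/
def statistics (h : List (Slot N K M)) : ℕ × (ℕ → Fin K → Fin M → ℕ × ℝ) :=
  (h.length, fun j k m => (count (h.drop j) k m, paySum (h.drop j) k m))

/-- The σ-algebra generated by the statistics: a policy is measurable if it depends on the history
measurably through them. -/
instance : MeasurableSpace (List (Slot N K M)) := .comap statistics inferInstance

lemma measurable_statistics : Measurable (statistics : List (Slot N K M) → _) :=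
  comap_measurable _

lemma measurable_length : Measurable (List.length : List (Slot N K M) → ℕ) :=
  measurable_statistics.fst

lemma measurable_count (k : Fin K) (m : Fin M) :
    Measurable fun h : List (Slot N K M) => count h k m :=
  (measurable_pi_apply m |>.comp <| measurable_pi_apply k |>.comp <| measurable_pi_apply 0 |>.comp
    measurable_statistics.snd).fst

lemma measurable_paySum (k : Fin K) (m : Fin M) :
    Measurable fun h : List (Slot N K M) => paySum h k m :=
  (measurable_pi_apply m |>.comp <| measurable_pi_apply k |>.comp <| measurable_pi_apply 0 |>.comp
    measurable_statistics.snd).snd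

lemma measurable_avg (k : Fin K) (m : Fin M) :
    Measurable fun h : List (Slot N K M) => avg h k m :=
  (measurable_paySum k m).div (measurable_from_top.comp (measurable_count k m))

lemma measurable_drop (j : ℕ) : Measurable fun h : List (Slot N K M) => h.drop j := by
  refine measurable_comap_iff.mpr (Measurable.prodMk ?_ ?_)
  · simp only [List.length_drop]
    exact (measurable_from_top (f := fun i : ℕ => i - j)).comp measurable_length
  · refine measurable_pi_lambda _ fun i => ?_
    simp only [List.drop_drop]
    exact (measurable_pi_apply (j + i)).comp measurable_statistics.snd

lemma count_cons (o : Slot N K M) (h : List (Slot N K M)) (k : Fin K) (m : Fin M) :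
    count (o :: h) k m = (recipients o.ctx o.msg k m).card + count h k m := by
  simp only [count, List.map_cons, List.sum_cons, recipients]

lemma paySum_cons (o : Slot N K M) (h : List (Slot N K M)) (k : Fin K) (m : Fin M) :
    paySum (o :: h) k m = ∑ n ∈ recipients o.ctx o.msg k m, o.pay n + paySum h k m := by
  simp only [paySum, List.map_cons, List.sum_cons]

lemma measurable_cons {Ω : Type*} [MeasurableSpace Ω] {x : Ω → Fin N → Fin K}
    {a : Ω → Fin N → Fin M} {p : Ω → Fin N → ℝ} {h : Ω → List (Slot N K M)} (hx : Measurable x)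
    (ha : Measurable a) (hp : Measurable p) (hh : Measurable h) :
    Measurable fun ω => (⟨x ω, a ω, p ω⟩ : Slot N K M) :: h ω := by
  have hsum (k : Fin K) (m : Fin M) :
      Measurable fun q : ((Fin N → Fin K) × (Fin N → Fin M)) × (Fin N → ℝ) =>
        ∑ n ∈ recipients q.1.1 q.1.2 k m, q.2 n :=
    measurable_from_prod_countable_right fun q =>
      Finset.measurable_sum (recipients q.1 q.2 k m) fun n _ => measurable_pi_apply n
  have hcard (k : Fin K) (m : Fin M) :
      Measurable fun q : (Fin N → Fin K) × (Fin N → Fin M) => (recipients q.1 q.2 k m).card :=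
    .of_discrete
  refine measurable_comap_iff.mpr (Measurable.prodMk ?_ (measurable_pi_lambda _ fun j =>
    measurable_pi_lambda _ fun k => measurable_pi_lambda _ fun m => ?_))
  · exact (measurable_length.comp hh).add_const 1
  · cases j with
    | zero =>
      simp only [List.drop_zero, count_cons, paySum_cons]
      exact (((hcard k m).comp (hx.prodMk ha)).add ((measurable_count k m).comp hh)).prodMk
        (((hsum k m).comp ((hx.prodMk ha).prodMk hp)).add ((measurable_paySum k m).comp hh))
    | succ j =>
      simp only [List.drop_succ_cons]
      exact ((measurable_count k m).comp ((measurable_drop j).comp hh)).prodMk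
        ((measurable_paySum k m).comp ((measurable_drop j).comp hh))

end Statistics

/-! ### The history of a policy -/

section History

variable {N K M τ : ℕ} {Ω : Type*} (π : Policy N K M τ) (X : ℕ → Ω → Fin N → Fin K)
  (G : ℕ → Ω → Fin N → Fin τ) (R : ℕ → Ω → Fin N → Fin K → Fin M → ℝ)

lemma history_length (t : ℕ) (ω : Ω) : (history π X G R t ω).length = t := by
  induction t with
  | zero => rfl
  | succ t ih => rw [history, List.length_cons, ih]

lemma history_drop (s j : ℕ) (ω : Ω) :
    (history π X G R (s + j) ω).drop j = history π X G R s ω := by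
  induction j with
  | zero => rfl
  | succ j ih => rw [← add_assoc, history, List.drop_succ_cons, ih]

lemma count_history_succ (t : ℕ) (ω : Ω) (k : Fin K) (m : Fin M) :
    count (history π X G R (t + 1) ω) k m =
      (recipients (X t ω) (action π X G R t ω) k m).card + count (history π X G R t ω) k m :=
  count_cons _ _ _ _

lemma paySum_history_succ (t : ℕ) (ω : Ω) (k : Fin K) (m : Fin M) :
    paySum (history π X G R (t + 1) ω) k m =
      ∑ n ∈ recipients (X t ω) (action π X G R t ω) k m, R t ω n k m
        + paySum (history π X G R t ω) k m := by
  refine (paySum_cons _ _ _ _).trans (congrArg (· + _) (Finset.sum_congr rfl fun n hn => ?_))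
  obtain ⟨hk, hm⟩ : X t ω n = k ∧ action π X G R t ω n = m := by simpa [recipients] using hn
  rw [← hk, ← hm]; rfl

lemma count_history_mono {s t : ℕ} (hst : s ≤ t) (ω : Ω) (k : Fin K) (m : Fin M) :
    count (history π X G R s ω) k m ≤ count (history π X G R t ω) k m := by
  induction t, hst using Nat.le_induction with
  | base => rfl
  | succ t _ ih => rw [count_history_succ]; exact le_add_left ih

/-- The information from the timeslots before slot `t`. -/
@[reducible] def past (t : ℕ) : MeasurableSpace Ω :=
  ⨆ s ∈ Set.Iio t, MeasurableSpace.comap (fun ω => (X s ω, G s ω, R s ω)) inferInstance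

lemma past_mono {s t : ℕ} (hst : s ≤ t) : past X G R s ≤ past X G R t :=
  biSup_mono fun _ hi => hi.trans_le hst

variable {π X G R}

lemma measurable_slot_past {s t : ℕ} (hst : s < t) :
    Measurable[past X G R t] fun ω => (X s ω, G s ω, R s ω) :=
  (comap_measurable _).mono (le_biSup (fun s => MeasurableSpace.comap
    (fun ω => (X s ω, G s ω, R s ω)) inferInstance) (Set.mem_Iio.mpr hst)) le_rfl

lemma measurable_policy_uncurry (hπ : Measurable π) :
    Measurable fun p : List (Slot N K M) × (Fin N → Fin K) × (Fin N → Fin τ) =>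
      π p.1 p.2.1 p.2.2 :=
  measurable_from_prod_countable_left fun q =>
    (measurable_pi_apply q.2).comp ((measurable_pi_apply q.1).comp hπ)

lemma measurable_history (hπ : Measurable π) (t : ℕ) :
    Measurable[past X G R t] (history π X G R t) := by
  induction t with
  | zero => exact measurable_const
  | succ t ih =>
    let _ : MeasurableSpace Ω := past X G R (t + 1)
    have hhist : Measurable (history π X G R t) := ih.mono (past_mono X G R t.le_succ) le_rfl
    have hslot : Measurable fun ω => (X t ω, G t ω, R t ω) := measurable_slot_past t.lt_succ_self
    have hact : Measurable (action π X G R t) :=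
      (measurable_policy_uncurry hπ).comp (hhist.prodMk (hslot.fst.prodMk hslot.snd.fst))
    have hpay : Measurable fun p : ((Fin N → Fin K) × (Fin N → Fin M)) ×
        (Fin N → Fin K → Fin M → ℝ) => fun n => p.2 n (p.1.1 n) (p.1.2 n) :=
      measurable_from_prod_countable_right fun q => measurable_pi_lambda _ fun n =>
        (measurable_pi_apply (q.2 n)).comp
          ((measurable_pi_apply (q.1 n)).comp (measurable_pi_apply n))
    exact measurable_cons hslot.fst hact
      (hpay.comp ((hslot.fst.prodMk hact).prodMk hslot.snd.snd)) hhist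

end History

/-! ### Independence of a slot from the past -/

section Model

variable {N K M τ L : ℕ} {Ω : Type*} [mΩ : MeasurableSpace Ω] {P : Measure Ω}
  {D : Fin K → Fin M → Measure ℝ} {X : ℕ → Ω → Fin N → Fin K} {G : ℕ → Ω → Fin N → Fin τ}
  {R : ℕ → Ω → Fin N → Fin K → Fin M → ℝ}

lemma IsBroadcastModel.measurable_slot (hB : IsBroadcastModel P D X G R) (t : ℕ) :
    Measurable fun ω => (X t ω, G t ω, R t ω) :=
  (hB.measurable_ctx t).prodMk ((hB.measurable_grp t).prodMk (hB.measurable_pay t))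

lemma IsBroadcastModel.past_le (hB : IsBroadcastModel P D X G R) (t : ℕ) : past X G R t ≤ mΩ :=
  iSup₂_le fun s _ => (hB.measurable_slot s).comap_le

lemma IsBroadcastModel.indep_past (hB : IsBroadcastModel P D X G R) (t : ℕ) :
    Indep (past X G R t)
      (MeasurableSpace.comap (fun ω => (X t ω, G t ω, R t ω)) inferInstance) P := by
  have h := indep_iSup_of_disjoint (μ := P)
    (m := fun s => MeasurableSpace.comap (fun ω => (X s ω, G s ω, R s ω)) inferInstance)
    (fun s => (hB.measurable_slot s).comap_le) hB.indep_slots (S := Set.Iio t) (T := {t})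
    (by simp)
  rwa [iSup_singleton] at h

lemma IsBroadcastModel.lintegral_past_slot (hB : IsBroadcastModel P D X G R) {α : Type*}
    [MeasurableSpace α] {t : ℕ} {V : Ω → α} (hV : Measurable[past X G R t] V)
    {F : α × (Fin N → Fin K) × (Fin N → Fin τ) × (Fin N → Fin K → Fin M → ℝ) → ℝ≥0∞}
    (hF : Measurable F) :
    ∫⁻ ω, F (V ω, X t ω, G t ω, R t ω) ∂P =
      ∫⁻ ω, ∫⁻ ω', F (V ω, X t ω', G t ω', R t ω') ∂P ∂P :=
  have := hB.prob
  lintegral_comp_prodMk_of_indepFun (hV.mono (hB.past_le t) le_rfl) (hB.measurable_slot t)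
    (indep_of_indep_of_le_left (hB.indep_past t) hV.comap_le) hF

lemma IsBroadcastModel.lintegral_mul_slot_le (hB : IsBroadcastModel P D X G R) {α : Type*}
    [MeasurableSpace α] {t : ℕ} {V : Ω → ℝ≥0∞} (hV : Measurable[past X G R t] V) {W : Ω → α}
    (hW : Measurable[past X G R t] W)
    {F : α × (Fin N → Fin K) × (Fin N → Fin τ) × (Fin N → Fin K → Fin M → ℝ) → ℝ≥0∞}
    (hF : Measurable F) {b : ℝ≥0∞}
    (hb : ∀ ω, V ω ≠ 0 → ∫⁻ ω', F (W ω, X t ω', G t ω', R t ω') ∂P ≤ b) :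
    ∫⁻ ω, V ω * F (W ω, X t ω, G t ω, R t ω) ∂P ≤ b * ∫⁻ ω, V ω ∂P := by
  calc ∫⁻ ω, V ω * F (W ω, X t ω, G t ω, R t ω) ∂P
      = ∫⁻ ω, ∫⁻ ω', V ω * F (W ω, X t ω', G t ω', R t ω') ∂P ∂P :=
        hB.lintegral_past_slot (V := fun ω => (V ω, W ω)) (hV.prodMk hW)
          (F := fun q => q.1.1 * F (q.1.2, q.2))
          (measurable_fst.fst.mul (hF.comp (measurable_fst.snd.prodMk measurable_snd)))
    _ = ∫⁻ ω, V ω * ∫⁻ ω', F (W ω, X t ω', G t ω', R t ω') ∂P ∂P :=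
        lintegral_congr fun ω => lintegral_const_mul _
          ((hF.comp measurable_prodMk_left).comp (hB.measurable_slot t))
    _ ≤ ∫⁻ ω, b * V ω ∂P := by
        refine lintegral_mono fun ω => ?_
        rcases eq_or_ne (V ω) 0 with h0 | h0
        · simp [h0]
        · rw [mul_comm b]
          gcongr
          exact hb ω h0
    _ = b * ∫⁻ ω, V ω ∂P := lintegral_const_mul _ (hV.mono (hB.past_le t) le_rfl)

lemma IsBroadcastModel.lintegral_pay (hB : IsBroadcastModel P D X G R) (t : ℕ)
    {F : ((Fin N → Fin K) × (Fin N → Fin τ)) → (Fin N → Fin K → Fin M → ℝ) → ℝ≥0∞}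
    (hF : ∀ p, Measurable (F p)) :
    ∫⁻ ω, F (X t ω, G t ω) (R t ω) ∂P = ∫⁻ ω, ∫⁻ ω', F (X t ω, G t ω) (R t ω') ∂P ∂P :=
  have := hB.prob
  lintegral_comp_prodMk_of_indepFun ((hB.measurable_ctx t).prodMk (hB.measurable_grp t))
    (hB.measurable_pay t) (hB.indep_pay t) (F := Function.uncurry F)
    (measurable_from_prod_countable_right hF)

lemma IsBroadcastModel.measurable_pay_apply (hB : IsBroadcastModel P D X G R) (t : ℕ) (n : Fin N)
    (k : Fin K) (m : Fin M) : Measurable fun ω => R t ω n k m :=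
  measurable_pi_iff.mp (measurable_pi_iff.mp (measurable_pi_iff.mp (hB.measurable_pay t) n) k) m

lemma IsBroadcastModel.pay_mem_Icc (hB : IsBroadcastModel P D X G R) {k : Fin K} {m : Fin M}
    (h01 : ∀ᵐ r ∂D k m, r ∈ Set.Icc (0 : ℝ) 1) (t : ℕ) (n : Fin N) :
    ∀ᵐ ω ∂P, R t ω n k m ∈ Set.Icc (0 : ℝ) 1 :=
  ae_of_ae_map (hB.measurable_pay_apply t n k m).aemeasurable (by rwa [hB.pay_law])

lemma IsBroadcastModel.integral_pay (hB : IsBroadcastModel P D X G R) (t : ℕ) (n : Fin N)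
    (k : Fin K) (m : Fin M) : ∫ ω, R t ω n k m ∂P = meanPayoff D k m := by
  rw [meanPayoff, ← hB.pay_law t n k m]
  exact (integral_map (hB.measurable_pay_apply t n k m).aemeasurable aestronglyMeasurable_id).symm

lemma IsBroadcastModel.lintegral_exp_pay_le (hB : IsBroadcastModel P D X G R) {k : Fin K}
    {m : Fin M} (h01 : ∀ᵐ r ∂D k m, r ∈ Set.Icc (0 : ℝ) 1) (t : ℕ) (θ : ℝ) (B : Finset (Fin N)) :
    ∫⁻ ω, ofReal (exp (θ * ∑ n ∈ B, (R t ω n k m - meanPayoff D k m))) ∂P ≤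
      ofReal (exp (θ ^ 2 / 8 * B.card)) := by
  have hindep : iIndepFun (fun (n : Fin N) ω => R t ω n k m) P :=
    (hB.indep_users t).comp (fun _ ρ => ρ k m) fun _ =>
      (measurable_pi_apply m).comp (measurable_pi_apply k)
  simpa only [hB.integral_pay] using lintegral_exp_sum_sub_integral_le hindep
    (fun n => (hB.measurable_pay_apply t n k m).aemeasurable) (hB.pay_mem_Icc h01 t) θ B

end Model

/-! ### An adaptive Hoeffding inequality -/

section ExpStat

variable {N K M τ : ℕ}

/-- The exponential of `θ` times the deviation of the payoffs of message `m` in context `k` from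
their mean `ν`, compensated by `θ ^ 2 / 8 + c` per sample: for `c = 0` it is the supermartingale
behind Hoeffding's inequality, and `c > 0` penalizes samples that have been received. -/
noncomputable def expStat (ν θ c : ℝ) (k : Fin K) (m : Fin M) (h : List (Slot N K M)) : ℝ≥0∞ :=
  ofReal (exp (θ * (paySum h k m - ν * count h k m) - (θ ^ 2 / 8 + c) * count h k m))

/-- The factor that the samples of the users in `B`, with payoffs `r`, contribute to `expStat`. -/
noncomputable def expFactor (ν θ c : ℝ) (k : Fin K) (m : Fin M) (B : Finset (Fin N))
    (r : Fin N → Fin K → Fin M → ℝ) : ℝ≥0∞ :=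
  ofReal (exp (θ * ∑ n ∈ B, (r n k m - ν) - (θ ^ 2 / 8 + c) * B.card))

lemma measurable_expStat (ν θ c : ℝ) (k : Fin K) (m : Fin M) :
    Measurable fun h : List (Slot N K M) => expStat ν θ c k m h := by
  have hpay := measurable_paySum (N := N) k m
  have hcount : Measurable fun h : List (Slot N K M) => (count h k m : ℝ) :=
    measurable_from_top.comp (measurable_count k m)
  unfold expStat
  fun_prop

lemma measurable_expFactor (ν θ c : ℝ) (k : Fin K) (m : Fin M) (B : Finset (Fin N)) :
    Measurable (expFactor ν θ c k m B) := by
  unfold expFactor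
  fun_prop

lemma expStat_nil (ν θ c : ℝ) (k : Fin K) (m : Fin M) :
    expStat ν θ c k m ([] : List (Slot N K M)) = 1 := by
  simp [expStat, count, paySum]

lemma mul_count_le_abs_paySum_sub {h : List (Slot N K M)} {k : Fin K} {m : Fin M} {ε ν : ℝ}
    (hε : ε ≤ |avg h k m - ν|) : ε * count h k m ≤ |paySum h k m - ν * count h k m| := by
  have havg : avg h k m = paySum h k m / count h k m := rfl
  rcases Nat.eq_zero_or_pos (count h k m) with h0 | hpos
  · simp [h0]
  · have hpos' : (0 : ℝ) < count h k m := by exact_mod_cast hpos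
    calc ε * count h k m ≤ |avg h k m - ν| * |(count h k m : ℝ)| := by
          rw [abs_of_pos hpos']; gcongr
      _ = |paySum h k m - ν * count h k m| := by rw [← abs_mul, havg]; congr 1; field_simp

lemma ofReal_exp_le_expStat_add {h : List (Slot N K M)} {k : Fin K} {m : Fin M} {ν ε c q : ℝ}
    (hε : 0 ≤ ε) (havg : ε ≤ |avg h k m - ν|) (hq : q ≤ (2 * ε ^ 2 - c) * count h k m) :
    ofReal (exp q) ≤ expStat ν (4 * ε) c k m h + expStat ν (-(4 * ε)) c k m h := by
  have hdev : 4 * ε * (ε * count h k m) ≤ 4 * ε * |paySum h k m - ν * count h k m| := by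
    gcongr; exact mul_count_le_abs_paySum_sub havg
  rcases abs_cases (paySum h k m - ν * count h k m) with ⟨habs, _⟩ | ⟨habs, _⟩ <;>
    rw [habs] at hdev
  · exact le_add_right (ofReal_le_ofReal (exp_le_exp.mpr (by nlinarith)))
  · exact le_add_left (ofReal_le_ofReal (exp_le_exp.mpr (by nlinarith)))

variable {Ω : Type*} {π : Policy N K M τ} {X : ℕ → Ω → Fin N → Fin K}
  {G : ℕ → Ω → Fin N → Fin τ} {R : ℕ → Ω → Fin N → Fin K → Fin M → ℝ}

lemma expStat_history_succ (ν θ c : ℝ) (k : Fin K) (m : Fin M) (t : ℕ) (ω : Ω) :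
    expStat ν θ c k m (history π X G R (t + 1) ω) = expStat ν θ c k m (history π X G R t ω) *
      expFactor ν θ c k m (recipients (X t ω) (action π X G R t ω) k m) (R t ω) := by
  rw [expStat, expStat, expFactor, ← ofReal_mul (exp_pos _).le, ← exp_add, count_history_succ,
    paySum_history_succ, Finset.sum_sub_distrib, Finset.sum_const, nsmul_eq_mul]
  push_cast
  ring_nf

lemma measurable_expFactor_recipients (hπ : Measurable π) (ν θ c : ℝ) (k : Fin K) (m : Fin M) :
    Measurable fun q : List (Slot N K M) × (Fin N → Fin K) × (Fin N → Fin τ) ×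
      (Fin N → Fin K → Fin M → ℝ) =>
        expFactor ν θ c k m (recipients q.2.1 (π q.1 q.2.1 q.2.2.1) k m) q.2.2.2 := by
  have hfac : Measurable fun q : ((Fin N → Fin K) × (Fin N → Fin M)) ×
      (Fin N → Fin K → Fin M → ℝ) => expFactor ν θ c k m (recipients q.1.1 q.1.2 k m) q.2 :=
    measurable_from_prod_countable_right fun q =>
      measurable_expFactor ν θ c k m (recipients q.1 q.2 k m)
  have hplay : Measurable fun q : List (Slot N K M) × (Fin N → Fin K) × (Fin N → Fin τ) ×
      (Fin N → Fin K → Fin M → ℝ) => ((q.2.1, π q.1 q.2.1 q.2.2.1), q.2.2.2) :=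
    (measurable_snd.fst.prodMk ((measurable_policy_uncurry hπ).comp
      (measurable_fst.prodMk (measurable_snd.fst.prodMk measurable_snd.snd.fst)))).prodMk
        measurable_snd.snd.snd
  exact (hfac.comp hplay :)

variable [MeasurableSpace Ω] {P : Measure Ω} {D : Fin K → Fin M → Measure ℝ}

lemma IsBroadcastModel.lintegral_expFactor_le (hB : IsBroadcastModel P D X G R) {k : Fin K}
    {m : Fin M} (h01 : ∀ᵐ r ∂D k m, r ∈ Set.Icc (0 : ℝ) 1) (θ c : ℝ) (t : ℕ)
    (B : (Fin N → Fin K) × (Fin N → Fin τ) → Finset (Fin N)) :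
    ∫⁻ ω, expFactor (meanPayoff D k m) θ c k m (B (X t ω, G t ω)) (R t ω) ∂P ≤
      ∫⁻ ω, ofReal (exp (-c * (B (X t ω, G t ω)).card)) ∂P := by
  rw [hB.lintegral_pay t (F := fun p => expFactor (meanPayoff D k m) θ c k m (B p))
    fun p => measurable_expFactor _ _ _ _ _ _]
  refine lintegral_mono fun ω => ?_
  simp only [expFactor, sub_eq_add_neg _ (_ * (_ : ℝ)), exp_add, ofReal_mul (exp_pos _).le]
  rw [lintegral_mul_const' _ _ ofReal_ne_top]
  refine (mul_le_mul_left (hB.lintegral_exp_pay_le h01 t θ _) _).trans_eq ?_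
  rw [← ofReal_mul (exp_pos _).le, ← exp_add]
  ring_nf

lemma IsBroadcastModel.lintegral_expStat_succ_le (hB : IsBroadcastModel P D X G R)
    (hπ : Measurable π) {k : Fin K} {m : Fin M} (h01 : ∀ᵐ r ∂D k m, r ∈ Set.Icc (0 : ℝ) 1)
    (θ c : ℝ) {t : ℕ} {V : Ω → ℝ≥0∞} (hV : Measurable[past X G R t] V) {b : ℝ≥0∞}
    (hb : ∀ ω, V ω ≠ 0 → ∫⁻ ω', ofReal (exp (-c * (recipients (X t ω')
      (π (history π X G R t ω) (X t ω') (G t ω')) k m).card)) ∂P ≤ b) :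
    ∫⁻ ω, V ω * expStat (meanPayoff D k m) θ c k m (history π X G R (t + 1) ω) ∂P ≤
      b * ∫⁻ ω, V ω * expStat (meanPayoff D k m) θ c k m (history π X G R t ω) ∂P := by
  have hhist := measurable_history hπ (X := X) (G := G) (R := R) t
  simp only [expStat_history_succ, ← mul_assoc]
  refine hB.lintegral_mul_slot_le (hV.mul ((measurable_expStat _ θ c k m).comp hhist)) hhist
    (measurable_expFactor_recipients hπ _ θ c k m) fun ω hω => ?_
  exact (hB.lintegral_expFactor_le h01 θ c t fun p =>
    recipients p.1 (π (history π X G R t ω) p.1 p.2) k m).trans (hb ω (left_ne_zero_of_mul hω))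

lemma IsBroadcastModel.lintegral_expStat_antitone (hB : IsBroadcastModel P D X G R)
    (hπ : Measurable π) {k : Fin K} {m : Fin M} (h01 : ∀ᵐ r ∂D k m, r ∈ Set.Icc (0 : ℝ) 1)
    (θ : ℝ) {c : ℝ} (hc : 0 ≤ c) {s t : ℕ} (hst : s ≤ t) {V : Ω → ℝ≥0∞}
    (hV : Measurable[past X G R s] V) :
    ∫⁻ ω, V ω * expStat (meanPayoff D k m) θ c k m (history π X G R t ω) ∂P ≤
      ∫⁻ ω, V ω * expStat (meanPayoff D k m) θ c k m (history π X G R s ω) ∂P := by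
  have := hB.prob
  induction t, hst using Nat.le_induction with
  | base => rfl
  | succ t hst ih =>
    refine (hB.lintegral_expStat_succ_le hπ h01 θ c (hV.mono (past_mono X G R hst) le_rfl)
      fun ω _ => lintegral_exp_neg_le_one hc _).trans ?_
    rwa [one_mul]

lemma IsBroadcastModel.lintegral_expStat_le_one (hB : IsBroadcastModel P D X G R)
    (hπ : Measurable π) {k : Fin K} {m : Fin M} (h01 : ∀ᵐ r ∂D k m, r ∈ Set.Icc (0 : ℝ) 1)
    (θ : ℝ) {c : ℝ} (hc : 0 ≤ c) (t : ℕ) :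
    ∫⁻ ω, expStat (meanPayoff D k m) θ c k m (history π X G R t ω) ∂P ≤ 1 := by
  have := hB.prob
  simpa [history, expStat_nil] using
    hB.lintegral_expStat_antitone hπ h01 θ hc t.zero_le (V := fun _ => 1) measurable_const

lemma IsBroadcastModel.measure_deviation_le (hB : IsBroadcastModel P D X G R)
    (hπ : Measurable π) {k : Fin K} {m : Fin M} (h01 : ∀ᵐ r ∂D k m, r ∈ Set.Icc (0 : ℝ) 1)
    (t : ℕ) {ε : ℝ} (hε : 0 ≤ ε) (q : ℝ) :
    P {ω | q ≤ count (history π X G R t ω) k m ∧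
      ε ≤ |avg (history π X G R t ω) k m - meanPayoff D k m|} ≤
      ofReal (2 * exp (-(2 * ε ^ 2 * q))) := by
  set ν := meanPayoff D k m
  let E (θ : ℝ) (ω : Ω) : ℝ≥0∞ := expStat ν θ 0 k m (history π X G R t ω)
  have hE (θ : ℝ) : Measurable (E θ) := (measurable_expStat ν θ 0 k m).comp
    ((measurable_history hπ t).mono (hB.past_le t) le_rfl)
  calc _ ≤ P {ω | ofReal (exp (2 * ε ^ 2 * q)) ≤ E (4 * ε) ω + E (-(4 * ε)) ω} := by
        refine measure_mono fun ω hω => ofReal_exp_le_expStat_add hε hω.2 ?_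
        rw [sub_zero]
        exact mul_le_mul_of_nonneg_left hω.1 (by positivity)
    _ ≤ (∫⁻ ω, (E (4 * ε) ω + E (-(4 * ε)) ω) ∂P) / ofReal (exp (2 * ε ^ 2 * q)) :=
        meas_ge_le_lintegral_div ((hE _).add (hE _)).aemeasurable (by simp [exp_pos])
          ofReal_ne_top
    _ ≤ (1 + 1) / ofReal (exp (2 * ε ^ 2 * q)) := by
        rw [lintegral_add_left (hE _)]
        gcongr <;> exact hB.lintegral_expStat_le_one hπ h01 _ le_rfl t
    _ = ofReal (2 * exp (-(2 * ε ^ 2 * q))) := by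
        rw [Real.exp_neg, ← div_eq_mul_inv, ENNReal.ofReal_div_of_pos (exp_pos _),
          one_add_one_eq_two, ENNReal.ofReal_ofNat]

end ExpStat

/-! ### Sampling rates -/

section SampleRate

variable {N K M τ : ℕ} {Ω : Type*} [MeasurableSpace Ω] {P : Measure Ω}
  {D : Fin K → Fin M → Measure ℝ} {X : ℕ → Ω → Fin N → Fin K} {G : ℕ → Ω → Fin N → Fin τ}
  {R : ℕ → Ω → Fin N → Fin K → Fin M → ℝ}

lemma IsBroadcastModel.ae_group_card (hB : IsBroadcastModel P D X G R) (t : ℕ) :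
    ∀ᵐ ω ∂P, ∀ s, (univ.filter fun n => G t ω n = s).card * τ = N := by
  have := hB.prob
  refine ae_of_ae_map (hB.measurable_grp t).aemeasurable
    (p := fun g => ∀ s, (univ.filter fun n => g n = s).card * τ = N) ?_
  have hlaw := Measure.isProbabilityMeasure_map (μ := P) (hB.measurable_grp t).aemeasurable
  rw [hB.grp_law] at hlaw ⊢
  exact ae_cond_mem (Set.to_countable _).measurableSet

lemma card_filter_mem_mul_eq {g : Fin N → Fin τ}
    (hg : ∀ s, (univ.filter fun n => g n = s).card * τ = N) (B : Finset (Fin τ)) :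
    (univ.filter fun n => g n ∈ B).card * τ = B.card * N := by
  rw [Finset.card_eq_sum_card_fiberwise (f := g) (t := B) fun n hn => by simpa using hn,
    Finset.sum_mul, ← smul_eq_mul, ← Finset.sum_const]
  refine Finset.sum_congr rfl fun s hs => ?_
  rw [Finset.filter_filter]
  refine Eq.trans ?_ (hg s)
  congr 2
  ext n
  simp only [Finset.mem_filter, Finset.mem_univ, true_and]
  exact ⟨fun h => h.2, fun h => ⟨h ▸ hs, h⟩⟩

/-- Sampling at rate `β`: a slot in which a message is sent to the groups in `B` multiplies the
exponential moment `E exp (-c Z)` of the number `Z` of its samples in any context by at most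
`exp (-β |B|)`. -/
def SampleRate (P : Measure Ω) (X : ℕ → Ω → Fin N → Fin K) (G : ℕ → Ω → Fin N → Fin τ)
    (c β : ℝ) : Prop :=
  ∀ t k (B : Finset (Fin τ)), ∫⁻ ω, ofReal (exp (-c * (univ.filter fun n =>
    X t ω n = k ∧ G t ω n ∈ B).card)) ∂P ≤ ofReal (exp (-(β * B.card)))

lemma integral_card_ctx (hB : IsBroadcastModel P D X G R) (S : Finset (Fin N)) (t : ℕ)
    (k : Fin K) :
    ∫ ω, ((S.filter fun n => X t ω n = k).card : ℝ) ∂P = ∑ n ∈ S, P.real {ω | X t ω n = k} := by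
  have := hB.prob
  have hset (n : Fin N) : MeasurableSet {ω | X t ω n = k} :=
    ((measurable_pi_apply n).comp (hB.measurable_ctx t)) (measurableSet_singleton k)
  have hcard (ω : Ω) : ((S.filter fun n => X t ω n = k).card : ℝ) =
      ∑ n ∈ S, {ω | X t ω n = k}.indicator (1 : Ω → ℝ) ω := by
    simp [Set.indicator_apply]
  have hint (n : Fin N) : Integrable ({ω | X t ω n = k}.indicator (1 : Ω → ℝ)) P :=
    (integrable_const (1 : ℝ)).indicator (hset n)
  simp only [hcard]
  rw [integral_finsetSum _ fun n _ => hint n]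
  exact Finset.sum_congr rfl fun n _ => integral_indicator_one (hset n)

lemma measurable_card_ctx (hB : IsBroadcastModel P D X G R) (S : Finset (Fin N)) (t : ℕ)
    (k : Fin K) : Measurable fun ω => ((S.filter fun n => X t ω n = k).card : ℝ) :=
  (Measurable.of_discrete (f := fun x : Fin N → Fin K =>
    ((S.filter fun n => x n = k).card : ℝ))).comp (hB.measurable_ctx t)

lemma sampleRate_of_uniformRates {G : ℕ → Ω → Fin N → Fin 1}
    (hB : IsBroadcastModel P D X G R) (hX : UniformRates P X) (hN : 1 ≤ N) {c u : ℝ} (h0 : 0 ≤ u)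
    (h1 : u ≤ 1) (hc : u ≤ c * N) : SampleRate P X G c (u / (2 * K)) := by
  have := hB.prob
  intro t k B
  have hN' : (0 : ℝ) < N := by exact_mod_cast hN
  obtain rfl | rfl : B = ∅ ∨ B = univ := B.eq_empty_or_nonempty.imp_right fun ⟨b, hb⟩ =>
    Finset.eq_univ_iff_forall.mpr fun a => Subsingleton.elim b a ▸ hb
  · simp
  · simp only [Finset.mem_univ, and_true]
    refine (lintegral_exp_neg_le h0 h1 hN' hc (measurable_card_ctx hB univ t k).aemeasurable
      fun ω => ⟨by positivity, ?_⟩).trans_eq ?_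
    · exact_mod_cast (Finset.card_le_univ _).trans_eq (Fintype.card_fin N)
    · rw [integral_card_ctx hB, hX t k]
      congr 3
      simp only [Finset.card_univ, Fintype.card_fin, Nat.cast_one, mul_one]
      field_simp

lemma lintegral_exp_neg_card_ctx_le (hB : IsBroadcastModel P D X G R) (hX : UniformUsers P X)
    (S : Finset (Fin N)) (t : ℕ) (k : Fin K) {c u : ℝ} (h0 : 0 ≤ u) (h1 : u ≤ 1) (hc : u ≤ c) :
    ∫⁻ ω, ofReal (exp (-c * (S.filter fun n => X t ω n = k).card)) ∂P ≤
      ofReal (exp (-(u / (2 * K) * S.card))) := by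
  have := hB.prob
  let arrives (x : Fin K) : ℝ := -c * if x = k then 1 else 0
  have hindep : iIndepFun (fun n ω => arrives (X t ω n)) P :=
    (hX t).1.comp (fun _ => arrives) fun _ => .of_discrete
  have hone (n : Fin N) :
      ∫⁻ ω, ofReal (exp (arrives (X t ω n))) ∂P ≤ ofReal (exp (-(u / (2 * K)))) := by
    have hsingle (ω : Ω) :
        ((({n} : Finset (Fin N)).filter fun n => X t ω n = k).card : ℝ) =
          if X t ω n = k then 1 else 0 := by
      simp [Finset.filter_singleton, apply_ite]
    have hle := lintegral_exp_neg_le (P := P) (c := c) h0 h1 one_pos (by rwa [mul_one])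
      (measurable_card_ctx hB {n} t k).aemeasurable
      fun ω => ⟨by positivity, by exact_mod_cast Finset.card_filter_le {n} _⟩
    rw [integral_card_ctx hB, Finset.sum_singleton, (hX t).2 n k] at hle
    simp only [hsingle] at hle
    refine hle.trans_eq ?_
    ring_nf
  have hsum := lintegral_exp_sum_le hindep (S := S)
    (fun n => (Measurable.of_discrete (f := arrives)).comp
      ((measurable_pi_apply n).comp (hB.measurable_ctx t))) fun n _ => hone n
  simp only [arrives, ← Finset.mul_sum, Finset.sum_boole, Finset.sum_const, nsmul_eq_mul] at hsum
  refine hsum.trans_eq ?_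
  ring_nf

lemma sampleRate_of_uniformUsers (hB : IsBroadcastModel P D X G R) (hX : UniformUsers P X)
    (hτ : 0 < τ) {c u : ℝ} (h0 : 0 ≤ u) (h1 : u ≤ 1) (hc : u ≤ c) :
    SampleRate P X G c (u / (2 * K) * (N / τ)) := by
  have := hB.prob
  intro t k B
  have : (τ : ℝ) ≠ 0 := by exact_mod_cast hτ.ne'
  rw [lintegral_comp_prodMk_of_indepFun (hB.measurable_grp t) (hB.measurable_ctx t)
    (hB.indep_ctx_grp t).symm (F := fun q => ofReal (exp (-c * (univ.filter fun n =>
      q.2 n = k ∧ q.1 n ∈ B).card))) .of_discrete]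
  calc _ ≤ ∫⁻ _, ofReal (exp (-(u / (2 * K) * (N / τ) * B.card))) ∂P := by
        refine lintegral_mono_ae ?_
        filter_upwards [hB.ae_group_card t] with ω hω
        have hcard : ((univ.filter fun n => G t ω n ∈ B).card : ℝ) = N / τ * B.card := by
          have h : ((univ.filter fun n => G t ω n ∈ B).card : ℝ) * τ = B.card * N := by
            exact_mod_cast card_filter_mem_mul_eq hω B
          field_simp
          linarith
        have hle := lintegral_exp_neg_card_ctx_le hB hX (univ.filter fun n => G t ω n ∈ B) t k
          h0 h1 hc
        simpa only [hcard, Finset.filter_filter, and_comm, mul_assoc] using hle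
    _ = _ := by simp

end SampleRate

/-! ### Exploration with prescribed transmissions -/

section RoundRobin

lemma sum_card_mod_eq_count (τ r i J : ℕ) :
    ∑ u ∈ Finset.range J, (univ.filter fun s : Fin τ => (u * τ + s) % r = i).card =
      Nat.count (fun x => x % r = i) (J * τ) := by
  induction J with
  | zero => simp
  | succ J ih =>
    rw [Finset.sum_range_succ, ih, add_mul, one_mul, Nat.count_add, Finset.card_filter,
      Fin.sum_univ_eq_sum_range (fun s => if (J * τ + s) % r = i then 1 else 0),
      Nat.count_eq_card_filter_range, Nat.count_eq_card_filter_range, Finset.card_filter,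
      Finset.card_filter]

lemma div_le_sum_card_mod {τ r i : ℕ} (hi : i < r) (J : ℕ) :
    J * τ / r ≤
      ∑ u ∈ Finset.range J, (univ.filter fun s : Fin τ => (u * τ + s) % r = i).card := by
  have hcount := Nat.count_modEq_card (J * τ) (Nat.zero_lt_of_lt hi) i
  simp only [Nat.ModEq, Nat.mod_eq_of_lt hi] at hcount
  rw [sum_card_mod_eq_count]
  omega

lemma half_le_natDiv {a r : ℕ} {z : ℝ} (hz : z ≤ a / r) (h : z = 0 ∨ 1 ≤ z) :
    z / 2 ≤ ((a / r : ℕ) : ℝ) := by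
  rcases h with rfl | h
  · simp
  · have hfloor := Nat.lt_floor_add_one ((a : ℝ) / r)
    rw [Nat.floor_div_eq_div] at hfloor
    have hone : (1 : ℝ) ≤ ((a / r : ℕ) : ℝ) := by
      have : (0 : ℝ) < ((a / r : ℕ) : ℝ) := by linarith
      exact_mod_cast this
    linarith

end RoundRobin

section Phase

variable {N K M τ : ℕ} {Ω : Type*} [MeasurableSpace Ω] {P : Measure Ω} {π : Policy N K M τ}
  {D : Fin K → Fin M → Measure ℝ} {X : ℕ → Ω → Fin N → Fin K} {G : ℕ → Ω → Fin N → Fin τ}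
  {R : ℕ → Ω → Fin N → Fin K → Fin M → ℝ} {k : Fin K} {m : Fin M} {s : ℕ}

lemma IsBroadcastModel.lintegral_expStat_phase_le (hB : IsBroadcastModel P D X G R)
    (hπ : Measurable π) (h01 : ∀ᵐ r ∂D k m, r ∈ Set.Icc (0 : ℝ) 1) {c β : ℝ}
    (hβ : SampleRate P X G c β) (hc : 0 ≤ c) (θ : ℝ) {V : Ω → ℝ≥0∞}
    (hV : Measurable[past X G R s] V) (B : ℕ → Finset (Fin τ)) (J : ℕ)
    (hrule : ∀ ω, V ω ≠ 0 → ∀ u < J, ∀ x g n, g n ∈ B u →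
      π (history π X G R (s + u) ω) x g n = m) :
    ∫⁻ ω, V ω * expStat (meanPayoff D k m) θ c k m (history π X G R (s + J) ω) ∂P ≤
      ofReal (exp (-(β * ∑ u ∈ Finset.range J, ((B u).card : ℝ)))) *
        ∫⁻ ω, V ω * expStat (meanPayoff D k m) θ c k m (history π X G R s ω) ∂P := by
  induction J with
  | zero => simp
  | succ J ih =>
    have hslot := hB.lintegral_expStat_succ_le hπ h01 θ c (t := s + J)
      (hV.mono (past_mono X G R (Nat.le_add_right s J)) le_rfl)
      (b := ofReal (exp (-(β * (B J).card)))) fun ω hω => by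
        refine (lintegral_mono fun ω' => ofReal_le_ofReal (exp_le_exp.mpr ?_)).trans
          (hβ (s + J) k (B J))
        refine mul_le_mul_of_nonpos_left (Nat.cast_le.mpr (Finset.card_le_card fun n hn => ?_))
          (neg_nonpos.mpr hc)
        simp only [recipients, Finset.mem_filter, Finset.mem_univ, true_and] at hn ⊢
        exact ⟨hn.1, hrule ω hω J J.lt_succ_self _ _ n hn.2⟩
    refine hslot.trans ((mul_le_mul_right (ih fun ω hω u hu =>
      hrule ω hω u (hu.trans J.lt_succ_self)) _).trans_eq ?_)
    rw [← mul_assoc, ← ofReal_mul (exp_pos _).le, ← exp_add, Finset.sum_range_succ]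
    ring_nf

lemma IsBroadcastModel.measure_phase_deviation_le (hB : IsBroadcastModel P D X G R)
    (hπ : Measurable π) (h01 : ∀ᵐ r ∂D k m, r ∈ Set.Icc (0 : ℝ) 1) {ε β : ℝ} (hε : 0 ≤ ε)
    (hβ : SampleRate P X G (2 * ε ^ 2) β) {F : Set Ω} (hF : MeasurableSet[past X G R s] F)
    (B : ℕ → Finset (Fin τ)) (J : ℕ) {t : ℕ} (ht : s + J ≤ t)
    (hrule : ∀ ω ∈ F, ∀ u < J, ∀ x g n, g n ∈ B u → π (history π X G R (s + u) ω) x g n = m) :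
    P (F ∩ {ω | ε ≤ |avg (history π X G R t ω) k m - meanPayoff D k m|}) ≤
      ofReal (exp (-(β * ∑ u ∈ Finset.range J, ((B u).card : ℝ)))) *
        ((∫⁻ ω in F, expStat (meanPayoff D k m) (4 * ε) (2 * ε ^ 2) k m
            (history π X G R s ω) ∂P) +
          ∫⁻ ω in F, expStat (meanPayoff D k m) (-(4 * ε)) (2 * ε ^ 2) k m
            (history π X G R s ω) ∂P) := by
  set c := 2 * ε ^ 2 with hcdef
  have hc : 0 ≤ c := by positivity
  let V : Ω → ℝ≥0∞ := F.indicator 1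
  have hV : Measurable[past X G R s] V := by
    let _ : MeasurableSpace Ω := past X G R s
    exact measurable_one.indicator hF
  have hVF (ω : Ω) (h : V ω ≠ 0) : ω ∈ F := Set.mem_of_indicator_ne_zero h
  let E (θ : ℝ) (t : ℕ) (ω : Ω) : ℝ≥0∞ :=
    expStat (meanPayoff D k m) θ c k m (history π X G R t ω)
  have hVE (θ : ℝ) (t : ℕ) : Measurable fun ω => V ω * E θ t ω :=
    (hV.mono (hB.past_le s) le_rfl).mul ((measurable_expStat _ θ c k m).comp
      ((measurable_history hπ t).mono (hB.past_le t) le_rfl))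
  have hdecay (θ : ℝ) : ∫⁻ ω, V ω * E θ t ω ∂P ≤
      ofReal (exp (-(β * ∑ u ∈ Finset.range J, ((B u).card : ℝ)))) * ∫⁻ ω in F, E θ s ω ∂P := by
    have hrestrict : ∫⁻ ω in F, E θ s ω ∂P = ∫⁻ ω, V ω * E θ s ω ∂P := by
      rw [← lintegral_indicator (hB.past_le s F hF)]
      refine lintegral_congr fun ω => ?_
      by_cases hω : ω ∈ F <;> simp [V, hω]
    rw [hrestrict]
    exact (hB.lintegral_expStat_antitone hπ h01 θ hc ht
      (hV.mono (past_mono X G R (Nat.le_add_right s J)) le_rfl)).trans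
        (hB.lintegral_expStat_phase_le hπ h01 hβ hc θ hV B J fun ω hω => hrule ω (hVF ω hω))
  calc _ ≤ P {ω | 1 ≤ V ω * E (4 * ε) t ω + V ω * E (-(4 * ε)) t ω} := by
        refine measure_mono fun ω hω => ?_
        have hone := ofReal_exp_le_expStat_add (q := 0) (c := c) hε hω.2 (by simp [hcdef])
        simpa [V, E, hω.1] using hone
    _ ≤ (∫⁻ ω, (V ω * E (4 * ε) t ω + V ω * E (-(4 * ε)) t ω) ∂P) / 1 :=
        meas_ge_le_lintegral_div ((hVE (4 * ε) t).add (hVE (-(4 * ε)) t)).aemeasurable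
          one_ne_zero ENNReal.one_ne_top
    _ = ∫⁻ ω, V ω * E (4 * ε) t ω ∂P + ∫⁻ ω, V ω * E (-(4 * ε)) t ω ∂P := by
        rw [div_one, lintegral_add_left (hVE _ t)]
    _ ≤ _ := (add_le_add (hdecay _) (hdecay _)).trans_eq (mul_add _ _ _).symm

end Phase

/-! ### Clustering by a distance that separates the content types -/

section Clustering

variable {M L : ℕ} {typ : Fin M → Fin L} {c : Choices M} {θ : ℝ} {d : Fin M → Fin M → ℝ}
  {𝒞 : Finset (Finset (Fin M))}

lemma clusterDist_lt_iff {p : Finset (Fin M) × Finset (Fin M)} (h1 : p.1.Nonempty)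
    (h2 : p.2.Nonempty) : clusterDist d p < θ ↔ ∀ a ∈ p.1, ∀ b ∈ p.2, d a b < θ := by
  have : Nonempty ↥(p.1 ×ˢ p.2) := (h1.product h2).to_subtype
  rw [clusterDist, ← Finset.sup'_univ_eq_ciSup, Finset.sup'_lt_iff]
  simp only [Finset.mem_univ, true_implies, Subtype.forall, Finset.mem_product, and_imp,
    Prod.forall]
  exact ⟨fun h a ha b hb => h a b ha hb, fun h a b ha hb => h a ha b hb⟩

open Classical in
/-- The pairs of clusters that `mergeStep` may unite: the closest ones, if closer than `θ`. -/
noncomputable def mergeCand (θ : ℝ) (d : Fin M → Fin M → ℝ) (𝒞 : Finset (Finset (Fin M))) :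
    Finset (Finset (Fin M) × Finset (Fin M)) :=
  𝒞.offDiag.filter fun p =>
    clusterDist d p < θ ∧ ∀ q ∈ 𝒞.offDiag, clusterDist d p ≤ clusterDist d q

open Classical in
lemma mergeStep_eq (c : Choices M) (θ : ℝ) (d : Fin M → Fin M → ℝ) (𝒞 : Finset (Finset (Fin M))) :
    mergeStep c θ d 𝒞 = if (mergeCand θ d 𝒞).Nonempty then
      insert ((c.pair (mergeCand θ d 𝒞)).1 ∪ (c.pair (mergeCand θ d 𝒞)).2)
        ((𝒞.erase (c.pair (mergeCand θ d 𝒞)).1).erase (c.pair (mergeCand θ d 𝒞)).2)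
      else 𝒞 :=
  rfl

lemma mergeStep_eq_self_or (c : Choices M) (θ : ℝ) (d : Fin M → Fin M → ℝ)
    (𝒞 : Finset (Finset (Fin M))) :
    (¬(mergeCand θ d 𝒞).Nonempty ∧ mergeStep c θ d 𝒞 = 𝒞) ∨ ∃ A ∈ 𝒞, ∃ B ∈ 𝒞, A ≠ B ∧
      clusterDist d (A, B) < θ ∧ mergeStep c θ d 𝒞 = insert (A ∪ B) ((𝒞.erase A).erase B) := by
  rw [mergeStep_eq]
  split_ifs with h
  · have hpair := c.pair_mem _ h
    generalize c.pair (mergeCand θ d 𝒞) = p at hpair ⊢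
    obtain ⟨hmem, hlt, -⟩ := Finset.mem_filter.mp hpair
    obtain ⟨hA, hB, hAB⟩ := Finset.mem_offDiag.mp hmem
    exact .inr ⟨_, hA, _, hB, hAB, hlt, by convert rfl⟩
  · exact .inl ⟨h, rfl⟩

lemma card_mergeStep_lt (h : (mergeCand θ d 𝒞).Nonempty) :
    (mergeStep c θ d 𝒞).card < 𝒞.card := by
  obtain ⟨h', -⟩ | ⟨A, hA, B, hB, hAB, -, heq⟩ := mergeStep_eq_self_or c θ d 𝒞
  · exact absurd h h'
  · rw [heq]
    have hA' := Finset.card_erase_add_one hA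
    have hB' := Finset.card_erase_add_one (Finset.mem_erase.mpr ⟨hAB.symm, hB⟩)
    have hinsert := Finset.card_insert_le (A ∪ B) ((𝒞.erase A).erase B)
    omega

lemma card_iterate_mergeStep_le {j : ℕ}
    (h : (mergeCand θ d ((mergeStep c θ d)^[j] 𝒞)).Nonempty) :
    ((mergeStep c θ d)^[j] 𝒞).card + j ≤ 𝒞.card := by
  induction j with
  | zero => rfl
  | succ j ih =>
    rw [Function.iterate_succ_apply'] at h ⊢
    by_cases hj : (mergeCand θ d ((mergeStep c θ d)^[j] 𝒞)).Nonempty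
    · have := ih hj
      have := card_mergeStep_lt (c := c) hj
      omega
    · rw [mergeStep_eq, if_neg hj] at h
      exact absurd h hj

lemma not_nonempty_mergeCand_cluster (c : Choices M) (θ : ℝ) (d : Fin M → Fin M → ℝ) :
    ¬(mergeCand θ d (cluster c θ d)).Nonempty := by
  intro h
  have hcard := card_iterate_mergeStep_le h
  have hM : (univ.image fun m : Fin M => ({m} : Finset (Fin M))).card ≤ M :=
    Finset.card_image_le.trans_eq (Finset.card_fin M)
  have hzero : ((mergeStep c θ d)^[M] (univ.image fun m => {m})).card = 0 := by omega
  rw [cluster, Finset.card_eq_zero.mp hzero] at h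
  simp [mergeCand] at h

/-- A partition of the messages into sets of messages of the same content type. -/
structure IsTypePartition (typ : Fin M → Fin L) (𝒞 : Finset (Finset (Fin M))) : Prop where
  nonempty : ∀ C ∈ 𝒞, C.Nonempty
  typ_eq : ∀ C ∈ 𝒞, ∀ a ∈ C, ∀ b ∈ C, typ a = typ b
  disjoint : (𝒞 : Set (Finset (Fin M))).PairwiseDisjoint id
  cover : ∀ a, ∃ C ∈ 𝒞, a ∈ C

lemma isTypePartition_singletons (typ : Fin M → Fin L) :
    IsTypePartition typ (univ.image fun m => {m}) where
  nonempty := by simp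
  typ_eq := by simp
  disjoint := by
    rw [Finset.coe_image, Finset.coe_univ, Set.image_univ]
    rintro _ ⟨a, rfl⟩ _ ⟨b, rfl⟩ hab
    exact Finset.disjoint_singleton.mpr fun h => hab (h ▸ rfl)
  cover := by simp

lemma IsTypePartition.insert_union (h : IsTypePartition typ 𝒞) {A B : Finset (Fin M)}
    (hA : A ∈ 𝒞) (hB : B ∈ 𝒞) (hAB : ∀ a ∈ A, ∀ b ∈ B, typ a = typ b) :
    IsTypePartition typ (insert (A ∪ B) ((𝒞.erase A).erase B)) where
  nonempty := (Finset.forall_mem_insert _ _ _).mpr ⟨(h.nonempty A hA).mono Finset.subset_union_left,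
    fun C hC => h.nonempty C (Finset.mem_of_mem_erase (Finset.mem_of_mem_erase hC))⟩
  typ_eq := by
    refine (Finset.forall_mem_insert _ _ _).mpr ⟨fun a ha b hb => ?_, fun C hC =>
      h.typ_eq C (Finset.mem_of_mem_erase (Finset.mem_of_mem_erase hC))⟩
    rcases Finset.mem_union.mp ha with ha | ha <;> rcases Finset.mem_union.mp hb with hb | hb
    · exact h.typ_eq A hA a ha b hb
    · exact hAB a ha b hb
    · exact (hAB b hb a ha).symm
    · exact h.typ_eq B hB a ha b hb
  disjoint := by
    rw [Finset.coe_insert]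
    refine (h.disjoint.subset fun C hC =>
      Finset.mem_of_mem_erase (Finset.mem_of_mem_erase hC)).insert fun C hC _ => ?_
    obtain ⟨⟨hC, hCA⟩, hCB⟩ : (C ∈ 𝒞 ∧ C ≠ A) ∧ C ≠ B := by simpa using hC
    exact Finset.disjoint_union_left.mpr
      ⟨h.disjoint hA hC hCA.symm, h.disjoint hB hC hCB.symm⟩
  cover := by
    intro a
    obtain ⟨C, hC, ha⟩ := h.cover a
    by_cases hCAB : C = A ∨ C = B
    · refine ⟨A ∪ B, Finset.mem_insert_self _ _, Finset.mem_union.mpr ?_⟩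
      rcases hCAB with rfl | rfl
      · exact .inl ha
      · exact .inr ha
    · push Not at hCAB
      exact ⟨C, Finset.mem_insert_of_mem
        (Finset.mem_erase.mpr ⟨hCAB.2, Finset.mem_erase.mpr ⟨hCAB.1, hC⟩⟩), ha⟩

lemma IsTypePartition.mergeStep (h : IsTypePartition typ 𝒞)
    (hd : ∀ a b, a ≠ b → (d a b < θ ↔ typ a = typ b)) :
    IsTypePartition typ (mergeStep c θ d 𝒞) := by
  obtain ⟨-, heq⟩ | ⟨A, hA, B, hB, hAB, hlt, heq⟩ := mergeStep_eq_self_or c θ d 𝒞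
  · rwa [heq]
  · rw [clusterDist_lt_iff (h.nonempty A hA) (h.nonempty B hB)] at hlt
    rw [heq]
    exact h.insert_union hA hB fun a ha b hb =>
      (hd a b (Finset.disjoint_iff_ne.mp (h.disjoint hA hB hAB) a ha b hb)).mp (hlt a ha b hb)

lemma isTypePartition_cluster (c : Choices M) (hd : ∀ a b, a ≠ b → (d a b < θ ↔ typ a = typ b)) :
    IsTypePartition typ (cluster c θ d) :=
  Function.Iterate.rec (IsTypePartition typ) (isTypePartition_singletons typ)
    (fun _ h => h.mergeStep hd) M

/-- The partition of the messages into content types. -/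
def typeClasses (typ : Fin M → Fin L) : Finset (Finset (Fin M)) :=
  univ.image fun a => univ.filter fun b => typ b = typ a

lemma IsTypePartition.eq_typeClasses (h : IsTypePartition typ 𝒞)
    (hd : ∀ a b, a ≠ b → (d a b < θ ↔ typ a = typ b)) (hfinal : ¬(mergeCand θ d 𝒞).Nonempty) :
    𝒞 = typeClasses typ := by
  have hclass : ∀ C ∈ 𝒞, ∀ a ∈ C, C = univ.filter fun b => typ b = typ a := by
    intro C hC a ha
    ext b
    simp only [Finset.mem_filter, Finset.mem_univ, true_and]
    refine ⟨fun hb => h.typ_eq C hC b hb a ha, fun hb => ?_⟩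
    obtain ⟨C', hC', hb'⟩ := h.cover b
    by_contra hbC
    have hne : C ≠ C' := by rintro rfl; exact hbC hb'
    have hlt : clusterDist d (C, C') < θ := by
      rw [clusterDist_lt_iff ⟨a, ha⟩ ⟨b, hb'⟩]
      intro x hx y hy
      rw [hd x y (Finset.disjoint_iff_ne.mp (h.disjoint hC hC' hne) x hx y hy),
        h.typ_eq C hC x hx a ha, ← hb, h.typ_eq C' hC' b hb' y hy]
    have hmem : (C, C') ∈ 𝒞.offDiag := Finset.mem_offDiag.mpr ⟨hC, hC', hne⟩
    obtain ⟨p, hp, hmin⟩ := Finset.exists_min_image 𝒞.offDiag (clusterDist d) ⟨_, hmem⟩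
    exact hfinal ⟨p, Finset.mem_filter.mpr ⟨hp, (hmin _ hmem).trans_lt hlt, hmin⟩⟩
  ext C
  simp only [typeClasses, Finset.mem_image, Finset.mem_univ, true_and]
  constructor
  · intro hC
    obtain ⟨a, ha⟩ := h.nonempty C hC
    exact ⟨a, (hclass C hC a ha).symm⟩
  · rintro ⟨a, rfl⟩
    obtain ⟨C, hC, ha⟩ := h.cover a
    rwa [← hclass C hC a ha]

lemma cluster_eq_typeClasses (c : Choices M) (hd : ∀ a b, a ≠ b → (d a b < θ ↔ typ a = typ b)) :
    cluster c θ d = typeClasses typ :=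
  (isTypePartition_cluster c hd).eq_typeClasses hd (not_nonempty_mergeCand_cluster c θ d)

lemma typ_rep (c : Choices M) (typ : Fin M → Fin L) (a : Fin M) :
    typ (c.rep (univ.filter fun b => typ b = typ a)) = typ a :=
  (Finset.mem_filter.mp (c.rep_mem (univ.filter fun b => typ b = typ a) ⟨a, by simp⟩)).2

lemma exists_mem_reps_typeClasses (c : Choices M) (typ : Fin M → Fin L) (a : Fin M) :
    ∃ m ∈ reps c (typeClasses typ), typ m = typ a :=
  ⟨_, Finset.mem_image_of_mem _ (Finset.mem_image_of_mem _ (Finset.mem_univ a)), typ_rep c typ a⟩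

lemma card_reps_typeClasses (c : Choices M) (hsurj : Function.Surjective typ) :
    (reps c (typeClasses typ)).card = L := by
  have hinj : Set.InjOn typ (reps c (typeClasses typ)) := by
    rw [reps, typeClasses, Finset.image_image]
    intro a ha b hb hab
    obtain ⟨a', -, rfl⟩ := Finset.mem_image.mp ha
    obtain ⟨b', -, rfl⟩ := Finset.mem_image.mp hb
    simp only [Function.comp_apply, typ_rep] at hab ⊢
    rw [hab]
  have himage : (reps c (typeClasses typ)).image typ = univ := by
    refine Finset.eq_univ_iff_forall.mpr fun l => ?_
    obtain ⟨a, rfl⟩ := hsurj l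
    exact Finset.mem_image.mpr (exists_mem_reps_typeClasses c typ a)
  rw [← Finset.card_image_of_injOn hinj, himage, Finset.card_fin]

lemma argmax_mem_and_le (c : Choices M) {S : Finset (Fin M)} (hS : S.Nonempty) (f : Fin M → ℝ) :
    argmax c S f ∈ S ∧ ∀ m ∈ S, f m ≤ f (argmax c S f) := by
  classical
  obtain ⟨a, ha, hmax⟩ := Finset.exists_max_image S f hS
  have hmem := c.msg_mem (S.filter fun m => ∀ m' ∈ S, f m' ≤ f m)
    ⟨a, Finset.mem_filter.mpr ⟨ha, hmax⟩⟩
  rw [argmax]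
  convert Finset.mem_filter.mp hmem

end Clustering

/-! ### Measurability of the algorithms -/

section MeasurablePolicies

instance {ι : Type*} : MeasurableSpace (Finset ι) := ⊤

instance {ι : Type*} : DiscreteMeasurableSpace (Finset ι) := ⟨fun _ => trivial⟩

variable {α : Type*} [MeasurableSpace α] {M : ℕ}

lemma measurable_filter {ι : Type*} [Finite ι] {S : α → Finset ι} (hS : Measurable S)
    {p : α → ι → Prop} [∀ a, DecidablePred (p a)] (hp : ∀ i, Measurable fun a => p a i) :
    Measurable fun a => (S a).filter (p a) := by
  classical
  convert (Measurable.of_discrete (f := fun q : Finset ι × (ι → Prop) => q.1.filter q.2)).comp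
    (hS.prodMk (measurable_pi_lambda p hp)) using 1
  ext
  simp

lemma measurable_argmax (c : Choices M) {S : α → Finset (Fin M)} (hS : Measurable S)
    {f : α → Fin M → ℝ} (hf : ∀ m, Measurable fun a => f a m) :
    Measurable fun a => argmax c (S a) (f a) := by
  classical
  refine Measurable.of_discrete.comp (measurable_filter hS fun m => .forall fun m' => .imp ?_ ?_)
  · exact (Measurable.of_discrete (f := fun A : Finset (Fin M) => m' ∈ A)).comp hS
  · exact measurableSet_setOfPred.mp (measurableSet_le (hf m') (hf m))

lemma measurable_mergeCand {d : α → Fin M → Fin M → ℝ} (hd : ∀ a b, Measurable fun ω => d ω a b)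
    (θ : ℝ) (𝒞 : Finset (Finset (Fin M))) : Measurable fun ω => mergeCand θ (d ω) 𝒞 := by
  have hdist (p : Finset (Fin M) × Finset (Fin M)) : Measurable fun ω => clusterDist (d ω) p :=
    Measurable.iSup fun q => hd _ _
  refine measurable_filter measurable_const fun p => .and ?_ (.forall fun q => .imp ?_ ?_)
  · exact measurableSet_setOfPred.mp (measurableSet_lt (hdist p) measurable_const)
  · exact measurable_const
  · exact measurableSet_setOfPred.mp (measurableSet_le (hdist p) (hdist q))

lemma measurable_cluster (c : Choices M) (θ : ℝ) {d : α → Fin M → Fin M → ℝ}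
    (hd : ∀ a b, Measurable fun ω => d ω a b) : Measurable fun ω => cluster c θ (d ω) := by
  classical
  have hstep (𝒞 : Finset (Finset (Fin M))) : Measurable fun ω => mergeStep c θ (d ω) 𝒞 := by
    simp only [mergeStep_eq]
    exact (Measurable.of_discrete (f := fun cand => if cand.Nonempty then
      insert ((c.pair cand).1 ∪ (c.pair cand).2)
        ((𝒞.erase (c.pair cand).1).erase (c.pair cand).2) else 𝒞)).comp
      (measurable_mergeCand hd θ 𝒞)
  have hiter (j : ℕ) : Measurable fun ω =>
      (mergeStep c θ (d ω))^[j] (univ.image fun m => {m}) := by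
    induction j with
    | zero => exact measurable_const
    | succ j ih =>
      simp only [Function.iterate_succ_apply']
      have huncurry : Measurable fun q : Finset (Finset (Fin M)) × α =>
          mergeStep c θ (d q.2) q.1 := measurable_from_prod_countable_right hstep
      exact (huncurry.comp (ih.prodMk measurable_id) :)
  exact hiter M

variable {N K τ : ℕ}

lemma measurable_latentPolicy (δ : ℝ) (c : Choices M) (S : Fin K → Finset (Fin M))
    (pc : Sym2 (Fin M) → Fin K) : Measurable (latentPolicy N K M τ δ c S pc) := by
  classical
  refine measurable_pi_lambda _ fun x => measurable_pi_lambda _ fun _ =>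
    measurable_pi_lambda _ fun n => ?_
  have hfew (m : Fin M) : Measurable fun h : List (Slot N K M) =>
      (count h (x n) m : ℝ) < 32 / δ ^ 2 * log (h.length + 1) :=
    measurableSet_setOfPred.mp (measurableSet_lt
      (measurable_from_top.comp (measurable_count (x n) m)) (measurable_from_top (f := fun t : ℕ =>
        32 / δ ^ 2 * log (t + 1)) |>.comp measurable_length))
  have hreps : Measurable fun h : List (Slot N K M) => reps c (cluster c (δ / 2) fun a b =>
      |avg h (pc s(a, b)) a - avg h (pc s(a, b)) b|) :=
    Measurable.of_discrete.comp (measurable_cluster c (δ / 2) fun a b =>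
      measurable_norm.comp ((measurable_avg (pc s(a, b)) a).sub (measurable_avg (pc s(a, b)) b)))
  have hne : MeasurableSet {A : Finset (Fin M) | A.Nonempty} := .of_discrete
  have hfew₁ := measurable_filter (measurable_const (a := S (x n))) hfew
  have hfew₂ := measurable_filter hreps hfew
  exact .ite (hfew₁ hne) (Measurable.of_discrete.comp hfew₁) (.ite (hfew₂ hne)
    (Measurable.of_discrete.comp hfew₂) (measurable_argmax c hreps (measurable_avg (x n))))

lemma measurable_broadcastPolicy [NeZero M] (T : ℕ) (δ : ℝ) (c : Choices M) (k₀ : Fin K) :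
    Measurable (broadcastPolicy N K M τ T δ c k₀) := by
  refine measurable_pi_lambda _ fun x => measurable_pi_lambda _ fun g =>
    measurable_pi_lambda _ fun n => ?_
  set T₁ := phase₁ N K M τ T δ
  have hdrop : Measurable fun h : List (Slot N K M) => h.drop (h.length - T₁) :=
    (measurable_from_prod_countable_right
      (f := fun q : ℕ × List (Slot N K M) => q.2.drop (q.1 - T₁)) fun t =>
        measurable_drop (t - T₁)).comp (measurable_length.prodMk measurable_id)
  have hreps : Measurable fun h : List (Slot N K M) => reps c (cluster c (δ / 2) fun a b =>
      |avg (h.drop (h.length - T₁)) k₀ a - avg (h.drop (h.length - T₁)) k₀ b|) :=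
    Measurable.of_discrete.comp (measurable_cluster c (δ / 2) fun a b => measurable_norm.comp
      (((measurable_avg k₀ a).comp hdrop).sub ((measurable_avg k₀ b).comp hdrop)))
  have hphase := measurable_length.prodMk hreps
  refine .ite (measurable_length (.of_discrete (s := {t | t < T₁})))
    (measurable_from_top (f := fun t : ℕ => Fin.ofNat M (t * τ + g n)) |>.comp measurable_length)
    (.ite (hphase (.of_discrete
      (s := {q : ℕ × Finset (Fin M) | q.1 < T₁ + phase₂ N K q.2.card τ T δ})))
      ((Measurable.of_discrete (f := fun q : ℕ × Finset (Fin M) =>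
        (q.2.sort (· ≤ ·)).getD (((q.1 - T₁) * τ + g n) % q.2.card) 0)).comp hphase)
      (measurable_argmax c hreps fun m => Finset.measurable_sum _ fun n' _ =>
        measurable_avg (x n') m))

end MeasurablePolicies

/-! ### The regret in terms of the mean payoffs -/

section Regret

variable {N K M τ L : ℕ} {Ω : Type*} {π : Policy N K M τ} {X : ℕ → Ω → Fin N → Fin K}
  {G : ℕ → Ω → Fin N → Fin τ} {R : ℕ → Ω → Fin N → Fin K → Fin M → ℝ}
  {D : Fin K → Fin M → Measure ℝ} {δ : ℝ} {typ : Fin M → Fin L}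

lemma IsLatentPayoff.meanPayoff_mem_Icc (hD : IsLatentPayoff δ D typ) (k : Fin K) (m : Fin M) :
    meanPayoff D k m ∈ Set.Icc (0 : ℝ) 1 := by
  have := hD.prob k m
  have hint : Integrable id (D k m) := .of_mem_Icc 0 1 aemeasurable_id (hD.mem_Icc k m)
  refine ⟨integral_nonneg_of_ae ((hD.mem_Icc k m).mono fun r hr => hr.1), ?_⟩
  simpa [meanPayoff] using
    integral_mono_ae hint (integrable_const 1) ((hD.mem_Icc k m).mono fun r hr => hr.2)

variable (π X G R D) in
/-- The mean payoff that user `n` loses in slot `t` with respect to the best message for the group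
of this user. -/
noncomputable def gap [NeZero M] (t : ℕ) (n : Fin N) (ω : Ω) : ℝ :=
  meanPayoff D (X t ω n) (bestMsg (meanPayoff D) (X t ω) (G t ω) (G t ω n))
    - meanPayoff D (X t ω n) (action π X G R t ω n)

lemma gap_le_one [NeZero M] (hD : IsLatentPayoff δ D typ) (t : ℕ) (n : Fin N) (ω : Ω) :
    gap π X G R D t n ω ≤ 1 :=
  (sub_le_self _ (hD.meanPayoff_mem_Icc _ _).1).trans (hD.meanPayoff_mem_Icc _ _).2

lemma sum_gap_le [NeZero M] (hD : IsLatentPayoff δ D typ) (t : ℕ) (ω : Ω) :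
    ∑ n, gap π X G R D t n ω ≤ N :=
  (Finset.sum_le_sum fun n _ => gap_le_one hD t n ω).trans_eq (by simp)

variable [MeasurableSpace Ω] {P : Measure Ω}

lemma measurable_of_ctx_grp_action (hB : IsBroadcastModel P D X G R) (hπ : Measurable π) (t : ℕ)
    (f : (Fin N → Fin K) → (Fin N → Fin τ) → (Fin N → Fin M) → ℝ) :
    Measurable fun ω => f (X t ω) (G t ω) (action π X G R t ω) := by
  have hctx := (hB.measurable_ctx t).prodMk (hB.measurable_grp t)
  have hhist : Measurable (history π X G R t) :=
    (measurable_history hπ t).mono (hB.past_le t) le_rfl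
  have hact : Measurable (action π X G R t) :=
    ((measurable_policy_uncurry hπ).comp (hhist.prodMk hctx) :)
  exact ((Measurable.of_discrete (f := fun p : ((Fin N → Fin K) × (Fin N → Fin τ)) ×
    (Fin N → Fin M) => f p.1.1 p.1.2 p.2)).comp (hctx.prodMk hact) :)

lemma ae_payoff_mem_Icc (hB : IsBroadcastModel P D X G R) (hD : IsLatentPayoff δ D typ) (t : ℕ)
    (n : Fin N) : ∀ᵐ ω ∂P, ∀ k m, R t ω n k m ∈ Set.Icc (0 : ℝ) 1 :=
  ae_all_iff.mpr fun k => ae_all_iff.mpr fun m => hB.pay_mem_Icc (hD.mem_Icc k m) t n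

lemma integral_payoff_of_ctx_grp (hB : IsBroadcastModel P D X G R) (hD : IsLatentPayoff δ D typ)
    (t : ℕ) (n : Fin N) (k : (Fin N → Fin K) × (Fin N → Fin τ) → Fin K)
    (m : (Fin N → Fin K) × (Fin N → Fin τ) → Fin M) :
    ∫ ω, R t ω n (k (X t ω, G t ω)) (m (X t ω, G t ω)) ∂P =
      ∫ ω, meanPayoff D (k (X t ω, G t ω)) (m (X t ω, G t ω)) ∂P := by
  have := hB.prob
  have hctx := (hB.measurable_ctx t).prodMk (hB.measurable_grp t)
  have hF : Measurable fun p : ((Fin N → Fin K) × (Fin N → Fin τ)) ×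
      (Fin N → Fin K → Fin M → ℝ) => p.2 n (k p.1) (m p.1) :=
    measurable_from_prod_countable_right fun p =>
      (measurable_pi_apply (m p)).comp ((measurable_pi_apply (k p)).comp (measurable_pi_apply n))
  have hint : Integrable (fun ω => R t ω n (k (X t ω, G t ω)) (m (X t ω, G t ω))) P :=
    .of_mem_Icc 0 1 (hF.comp (hctx.prodMk (hB.measurable_pay t))).aemeasurable
      ((ae_payoff_mem_Icc hB hD t n).mono fun ω hω => hω _ _)
  refine (integral_comp_prodMk_of_indepFun hctx (hB.measurable_pay t) (hB.indep_pay t)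
    hF hint).trans ?_
  exact integral_congr_ae (.of_forall fun ω =>
    hB.integral_pay t n (k (X t ω, G t ω)) (m (X t ω, G t ω)))

lemma measurable_payoff_uncurry (hπ : Measurable π) (n : Fin N) :
    Measurable fun p : List (Slot N K M) × (Fin N → Fin K) × (Fin N → Fin τ) ×
      (Fin N → Fin K → Fin M → ℝ) => p.2.2.2 n (p.2.1 n) (π p.1 p.2.1 p.2.2.1 n) := by
  have hpay : Measurable fun q : (Fin K × Fin M) × (Fin N → Fin K → Fin M → ℝ) =>
      q.2 n q.1.1 q.1.2 := measurable_from_prod_countable_right fun q =>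
    (measurable_pi_apply q.2).comp ((measurable_pi_apply q.1).comp (measurable_pi_apply n))
  have hact : Measurable fun p : List (Slot N K M) × (Fin N → Fin K) × (Fin N → Fin τ) ×
      (Fin N → Fin K → Fin M → ℝ) => π p.1 p.2.1 p.2.2.1 n :=
    ((measurable_pi_apply n).comp ((measurable_policy_uncurry hπ).comp
      (measurable_fst.prodMk (measurable_snd.fst.prodMk measurable_snd.snd.fst))) :)
  exact hpay.comp ((((measurable_pi_apply n).comp measurable_snd.fst).prodMk hact).prodMk
    measurable_snd.snd.snd)

lemma integrable_payoff (hB : IsBroadcastModel P D X G R) (hD : IsLatentPayoff δ D typ)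
    (hπ : Measurable π) (t : ℕ) (n : Fin N) :
    Integrable (fun ω => R t ω n (X t ω n) (action π X G R t ω n)) P := by
  have := hB.prob
  have hhist : Measurable (history π X G R t) :=
    (measurable_history hπ t).mono (hB.past_le t) le_rfl
  exact .of_mem_Icc 0 1
    ((measurable_payoff_uncurry hπ n).comp (hhist.prodMk (hB.measurable_slot t))).aemeasurable
    ((ae_payoff_mem_Icc hB hD t n).mono fun ω hω => hω _ _)

lemma integrable_of_ctx_grp_action (hB : IsBroadcastModel P D X G R) (hπ : Measurable π) (t : ℕ)
    (f : (Fin N → Fin K) → (Fin N → Fin τ) → (Fin N → Fin M) → ℝ) :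
    Integrable (fun ω => f (X t ω) (G t ω) (action π X G R t ω)) P := by
  have := hB.prob
  obtain ⟨b, hb⟩ := (Set.finite_range fun p : (Fin N → Fin K) × (Fin N → Fin τ) ×
    (Fin N → Fin M) => ‖f p.1 p.2.1 p.2.2‖).bddAbove
  exact .of_bound (measurable_of_ctx_grp_action hB hπ t f).aestronglyMeasurable b
    (.of_forall fun ω => hb ⟨(X t ω, G t ω, action π X G R t ω), rfl⟩)

lemma integral_payoff (hB : IsBroadcastModel P D X G R) (hD : IsLatentPayoff δ D typ)
    (hπ : Measurable π) (t : ℕ) (n : Fin N) :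
    ∫ ω, R t ω n (X t ω n) (action π X G R t ω n) ∂P =
      ∫ ω, meanPayoff D (X t ω n) (action π X G R t ω n) ∂P := by
  have := hB.prob
  have hhist : Measurable (history π X G R t) :=
    (measurable_history hπ t).mono (hB.past_le t) le_rfl
  have hindep : IndepFun (history π X G R t) (fun ω => (X t ω, G t ω, R t ω)) P :=
    indep_of_indep_of_le_left (hB.indep_past t) (measurable_history hπ t).comap_le
  have hmean : Measurable fun p : List (Slot N K M) × (Fin N → Fin K) × (Fin N → Fin τ) ×
      (Fin N → Fin K → Fin M → ℝ) => meanPayoff D (p.2.1 n) (π p.1 p.2.1 p.2.2.1 n) :=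
    ((Measurable.of_discrete (f := fun q : (Fin N → Fin K) × (Fin N → Fin M) =>
      meanPayoff D (q.1 n) (q.2 n))).comp (measurable_snd.fst.prodMk
        ((measurable_policy_uncurry hπ).comp
          (measurable_fst.prodMk (measurable_snd.fst.prodMk measurable_snd.snd.fst)))) :)
  calc _ = ∫ ω, ∫ ω', R t ω' n (X t ω' n)
          (π (history π X G R t ω) (X t ω') (G t ω') n) ∂P ∂P :=
        integral_comp_prodMk_of_indepFun hhist (hB.measurable_slot t) hindep
          (measurable_payoff_uncurry hπ n) (integrable_payoff hB hD hπ t n)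
    _ = ∫ ω, ∫ ω', meanPayoff D (X t ω' n)
          (π (history π X G R t ω) (X t ω') (G t ω') n) ∂P ∂P :=
        integral_congr_ae (.of_forall fun ω => integral_payoff_of_ctx_grp hB hD t n
          (fun p => p.1 n) fun p => π (history π X G R t ω) p.1 p.2 n)
    _ = _ := (integral_comp_prodMk_of_indepFun hhist (hB.measurable_slot t) hindep hmean
        (integrable_of_ctx_grp_action hB hπ t fun x _ a => meanPayoff D (x n) (a n))).symm

variable [NeZero M]

lemma integrable_gap (hB : IsBroadcastModel P D X G R) (hπ : Measurable π) (t : ℕ) (n : Fin N) :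
    Integrable (gap π X G R D t n) P :=
  integrable_of_ctx_grp_action hB hπ t fun x g a =>
    meanPayoff D (x n) (bestMsg (meanPayoff D) x g (g n)) - meanPayoff D (x n) (a n)

lemma integrable_loss (hB : IsBroadcastModel P D X G R) (hD : IsLatentPayoff δ D typ)
    (hπ : Measurable π) (t : ℕ) (n : Fin N) :
    Integrable (fun ω =>
      meanPayoff D (X t ω n) (bestMsg (meanPayoff D) (X t ω) (G t ω) (G t ω n)) -
        R t ω n (X t ω n) (action π X G R t ω n)) P :=
  (integrable_of_ctx_grp_action hB hπ t fun x g _ =>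
    meanPayoff D (x n) (bestMsg (meanPayoff D) x g (g n))).sub (integrable_payoff hB hD hπ t n)

lemma integrable_regretSum (hB : IsBroadcastModel P D X G R) (hD : IsLatentPayoff δ D typ)
    (hπ : Measurable π) (T : ℕ) : Integrable (regretSum π (meanPayoff D) X G R T) P :=
  integrable_finsetSum _ fun t _ => integrable_finsetSum _ fun n _ => integrable_loss hB hD hπ t n

lemma regret_eq (hB : IsBroadcastModel P D X G R) (hD : IsLatentPayoff δ D typ)
    (hπ : Measurable π) (T : ℕ) :
    regret P π (meanPayoff D) X G R T =
      ∫ ω, ∑ t ∈ Finset.range T, ∑ n, gap π X G R D t n ω ∂P := by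
  unfold regret regretSum
  rw [integral_finsetSum _ fun t _ => integrable_finsetSum _ fun n _ =>
      integrable_loss hB hD hπ t n,
    integral_finsetSum _ fun t _ => integrable_finsetSum _ fun n _ => integrable_gap hB hπ t n]
  refine Finset.sum_congr rfl fun t _ => ?_
  rw [integral_finsetSum _ fun n _ => integrable_loss hB hD hπ t n,
    integral_finsetSum _ fun n _ => integrable_gap hB hπ t n]
  refine Finset.sum_congr rfl fun n _ => ?_
  have hbest := integrable_of_ctx_grp_action hB hπ t fun x g _ =>
    meanPayoff D (x n) (bestMsg (meanPayoff D) x g (g n))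
  have hmean := integrable_of_ctx_grp_action hB hπ t fun x _ a => meanPayoff D (x n) (a n)
  unfold gap
  rw [integral_sub hbest (integrable_payoff hB hD hπ t n), integral_sub hbest hmean,
    integral_payoff hB hD hπ]

lemma regret_le_of_ae (hB : IsBroadcastModel P D X G R) (hD : IsLatentPayoff δ D typ)
    (hπ : Measurable π) (T : ℕ) {ι : Type*} (s : Finset ι) (w : ι → ℝ) (E : ι → Set Ω)
    (hE : ∀ i, MeasurableSet (E i)) (a : ℝ)
    (h : ∀ᵐ ω ∂P, ∑ t ∈ Finset.range T, ∑ n, gap π X G R D t n ω ≤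
      a + ∑ i ∈ s, w i * (E i).indicator 1 ω) :
    regret P π (meanPayoff D) X G R T ≤ a + ∑ i ∈ s, w i * P.real (E i) := by
  have := hB.prob
  have hind (i : ι) : Integrable (fun ω => w i * (E i).indicator (1 : Ω → ℝ) ω) P :=
    ((integrable_const (1 : ℝ)).indicator (hE i)).const_mul _
  rw [regret_eq hB hD hπ]
  calc _ ≤ ∫ ω, (a + ∑ i ∈ s, w i * (E i).indicator (1 : Ω → ℝ) ω) ∂P :=
        integral_mono_ae
          (integrable_finsetSum _ fun t _ => integrable_finsetSum _ fun n _ =>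
            integrable_gap hB hπ t n)
          ((integrable_const a).add (integrable_finsetSum _ fun i _ => hind i)) h
    _ = _ := by
        rw [integral_add (integrable_const a) (integrable_finsetSum _ fun i _ => hind i),
          integral_finsetSum _ fun i _ => hind i]
        simp [integral_const_mul, integral_indicator_one (hE _)]

lemma regret_le_of_slots (hB : IsBroadcastModel P D X G R) (hD : IsLatentPayoff δ D typ)
    (hπ : Measurable π) (J T : ℕ) (F : ℕ → Set Ω) (hF : ∀ t, MeasurableSet (F t)) (b : ℕ → Ω → ℝ)
    (hb : ∀ t ω, 0 ≤ b t ω) {a : ℝ} (ha : ∀ ω, ∑ t ∈ Finset.range T, b t ω ≤ a)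
    (h : ∀ᵐ ω ∂P, ∀ t < T, J ≤ t → ω ∉ F t → ∑ n, gap π X G R D t n ω ≤ b t ω) :
    regret P π (meanPayoff D) X G R T ≤ N * J + a + N * ∑ t ∈ Finset.Ico J T, P.real (F t) := by
  rw [Finset.mul_sum]
  refine regret_le_of_ae hB hD hπ T (Finset.Ico J T) (fun _ => N) F hF _ ?_
  filter_upwards [h] with ω hω
  have hslot (t : ℕ) (ht : t ∈ Finset.range T) : ∑ n, gap π X G R D t n ω ≤
      (if t < J then (N : ℝ) else 0) + b t ω +
        if J ≤ t then N * (F t).indicator (1 : Ω → ℝ) ω else 0 := by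
    have hbt := hb t ω
    have hgap := sum_gap_le (π := π) (X := X) (G := G) (R := R) hD t ω
    rcases lt_or_ge t J with hJ | hJ
    · rw [if_pos hJ, if_neg hJ.not_ge]
      linarith
    · rw [if_neg hJ.not_gt, if_pos hJ]
      by_cases hmem : ω ∈ F t
      · rw [Set.indicator_of_mem hmem, Pi.one_apply]
        linarith
      · rw [Set.indicator_of_notMem hmem]
        linarith [hω t (Finset.mem_range.mp ht) hJ hmem]
  have hburn : ∑ t ∈ Finset.range T, (if t < J then (N : ℝ) else 0) ≤ N * J := by
    rw [← Finset.sum_filter, Finset.sum_const, nsmul_eq_mul, mul_comm]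
    gcongr
    refine (Finset.card_le_card fun t ht => ?_).trans_eq (Finset.card_range J)
    exact Finset.mem_range.mpr (Finset.mem_filter.mp ht).2
  refine (Finset.sum_le_sum hslot).trans ?_
  rw [Finset.sum_add_distrib, Finset.sum_add_distrib, ← Finset.sum_filter (J ≤ ·),
    Finset.range_eq_Ico, Finset.Ico_filter_le, Nat.zero_max, ← Finset.range_eq_Ico]
  linarith [ha ω]

end Regret

/-! ### Decisions with accurate averages -/

section Decisions

variable {N K M τ L : ℕ} {D : Fin K → Fin M → Measure ℝ} {δ : ℝ} {typ : Fin M → Fin L}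

lemma IsLatentPayoff.le_one (hD : IsLatentPayoff δ D typ) (k : Fin K) (m : Fin M) : δ ≤ 1 := by
  obtain ⟨Δ, hδΔ, hmul⟩ := hD.discrete
  obtain ⟨j, hj, hmean⟩ := hmul k m
  have hle := (hD.meanPayoff_mem_Icc k m).2
  have hj' : (1 : ℝ) ≤ j := by exact_mod_cast hj
  by_contra! h
  nlinarith

lemma IsLatentPayoff.sum_sub_nonpos (hD : IsLatentPayoff δ D typ) (hδ : 0 < δ) {ι : Type*}
    (s : Finset ι) (x : ι → Fin K) (a b : Fin M)
    (h : ∑ i ∈ s, meanPayoff D (x i) a - ∑ i ∈ s, meanPayoff D (x i) b < δ) :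
    ∑ i ∈ s, meanPayoff D (x i) a - ∑ i ∈ s, meanPayoff D (x i) b ≤ 0 := by
  obtain ⟨Δ, hδΔ, hmul⟩ := hD.discrete
  have hΔ : 0 < Δ := hδ.trans_le hδΔ
  choose j _ hj using hmul
  have hdiff : ∑ i ∈ s, meanPayoff D (x i) a - ∑ i ∈ s, meanPayoff D (x i) b =
      ((∑ i ∈ s, (j (x i) a : ℤ) - ∑ i ∈ s, (j (x i) b : ℤ) : ℤ) : ℝ) * Δ := by
    push_cast
    simp only [hj, ← Finset.sum_mul, ← sub_mul]
  rw [hdiff] at h ⊢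
  have hlt := (mul_lt_iff_lt_one_left hΔ).mp (h.trans_le hδΔ)
  exact mul_nonpos_of_nonpos_of_nonneg
    (Int.cast_nonpos.mpr (Int.lt_add_one_iff.mp (by exact_mod_cast hlt))) hΔ.le

lemma IsLatentPayoff.le_abs_sub (hD : IsLatentPayoff δ D typ) (hδ : 0 < δ) {k : Fin K}
    {a b : Fin M} (h : typ a ≠ typ b) : δ ≤ |meanPayoff D k a - meanPayoff D k b| := by
  by_contra! hlt
  rw [abs_sub_lt_iff] at hlt
  have hle := hD.sum_sub_nonpos hδ {()} (fun _ => k) a b (by simpa using hlt.1)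
  have hge := hD.sum_sub_nonpos hδ {()} (fun _ => k) b a (by simpa using hlt.2)
  simp only [Finset.sum_singleton, sub_nonpos] at hle hge
  exact h ((hD.typ_eq_iff k a b).mpr (hle.antisymm hge))

lemma IsLatentPayoff.dist_lt_iff (hD : IsLatentPayoff δ D typ) (hδ : 0 < δ) {k : Fin K}
    {a b : Fin M} {ra rb : ℝ} (ha : |ra - meanPayoff D k a| < δ / 4)
    (hb : |rb - meanPayoff D k b| < δ / 4) : |ra - rb| < δ / 2 ↔ typ a = typ b := by
  rw [abs_sub_lt_iff] at ha hb
  constructor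
  · intro h
    by_contra hne
    rw [abs_sub_lt_iff] at h
    rcases le_abs.mp (hD.le_abs_sub hδ (k := k) hne) with hle | hle <;> linarith
  · intro h
    have heq := (hD.typ_eq_iff k a b).mp h
    rw [abs_sub_lt_iff]
    constructor <;> linarith

lemma sum_meanPayoff_bestMsg_sub_nonpos [NeZero M] (hD : IsLatentPayoff δ D typ) (hδ : 0 < δ)
    {A : Finset (Fin M)} (hA : ∀ a, ∃ m ∈ A, typ m = typ a) {x : Fin N → Fin K}
    {g : Fin N → Fin τ} {s : Fin τ} {r : Fin K → Fin M → ℝ} {ε : ℝ}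
    (hr : ∀ n, g n = s → ∀ m ∈ A, |r (x n) m - meanPayoff D (x n) m| < ε)
    (hcard : 2 * ε * (univ.filter fun n => g n = s).card ≤ δ) {b : Fin M} (hb : b ∈ A)
    (hmax : ∀ m ∈ A, ∑ n with g n = s, r (x n) m ≤ ∑ n with g n = s, r (x n) b) :
    ∑ n with g n = s, (meanPayoff D (x n) (bestMsg (meanPayoff D) x g s)
      - meanPayoff D (x n) b) ≤ 0 := by
  rcases (univ.filter fun n => g n = s).eq_empty_or_nonempty with hempty | hne
  · rw [hempty, Finset.sum_empty]
  obtain ⟨m, hm, htyp⟩ := hA (bestMsg (meanPayoff D) x g s)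
  have hbest (k : Fin K) : meanPayoff D k (bestMsg (meanPayoff D) x g s) = meanPayoff D k m :=
    (hD.typ_eq_iff k _ _).mp htyp.symm
  rw [Finset.sum_sub_distrib]
  simp only [hbest]
  refine hD.sum_sub_nonpos hδ _ x m b ?_
  have hlower : ∑ n with g n = s, meanPayoff D (x n) m < ∑ n with g n = s, (r (x n) m + ε) :=
    Finset.sum_lt_sum_of_nonempty hne fun n hn => by
      linarith [(abs_lt.mp (hr n (Finset.mem_filter.mp hn).2 m hm)).1]
  have hupper : ∑ n with g n = s, (r (x n) b - ε) < ∑ n with g n = s, meanPayoff D (x n) b :=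
    Finset.sum_lt_sum_of_nonempty hne fun n hn => by
      linarith [(abs_lt.mp (hr n (Finset.mem_filter.mp hn).2 b hb)).2]
  simp only [Finset.sum_add_distrib, Finset.sum_sub_distrib, Finset.sum_const, nsmul_eq_mul]
    at hlower hupper
  linarith [hmax m hm]

end Decisions

/-! ### The broadcasting algorithm -/

section BroadcastFailures

variable {N K M τ L : ℕ} [NeZero M] {Ω : Type*} {X : ℕ → Ω → Fin N → Fin K}
  {G : ℕ → Ω → Fin N → Fin τ} {R : ℕ → Ω → Fin N → Fin K → Fin M → ℝ}
  {D : Fin K → Fin M → Measure ℝ} {T : ℕ} {δ : ℝ} {c : Choices M} {k₀ : Fin K}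
  {typ : Fin M → Fin L} {t : ℕ} {ω : Ω}

section Definitions

variable (X G R T δ c k₀)

/-- The average payoffs that the broadcasting algorithm has observed before slot `t`. -/
noncomputable def broadcastAvg (t : ℕ) (ω : Ω) : Fin K → Fin M → ℝ :=
  avg (history (broadcastPolicy N K M τ T δ c k₀) X G R t ω)

/-- The representatives that the broadcasting algorithm finds after the first phase. -/
noncomputable def broadcastReps (ω : Ω) : Finset (Fin M) :=
  reps c (cluster c (δ / 2) fun a b =>
    |broadcastAvg X G R T δ c k₀ (phase₁ N K M τ T δ) ω k₀ a -
      broadcastAvg X G R T δ c k₀ (phase₁ N K M τ T δ) ω k₀ b|)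

variable (D)

/-- The first phase ends with an estimate of message `m` that is too inaccurate for clustering. -/
def clusteringFailure (m : Fin M) : Set Ω :=
  {ω | δ / 4 ≤ |broadcastAvg X G R T δ c k₀ (phase₁ N K M τ T δ) ω k₀ m - meanPayoff D k₀ m|}

/-- There are `L` representatives, `m` is one of them, and its estimate for context `k` in slot `t`
is too inaccurate for choosing the best message for a group. -/
def exploitationFailure (L t : ℕ) (k : Fin K) (m : Fin M) : Set Ω :=
  {ω | ((broadcastReps X G R T δ c k₀ ω).card = L ∧ m ∈ broadcastReps X G R T δ c k₀ ω) ∧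
    δ * τ / (2 * N) ≤ |broadcastAvg X G R T δ c k₀ t ω k m - meanPayoff D k m|}

/-- Some estimate that matters for the decisions in slot `t` is too inaccurate. -/
def broadcastFailure (L t : ℕ) : Set Ω :=
  (⋃ m, clusteringFailure X G R D T δ c k₀ m) ∪
    ⋃ q : Fin K × Fin M, exploitationFailure X G R D T δ c k₀ L t q.1 q.2

end Definitions

lemma broadcastPolicy_of_lt_phase₁ (ht : t < phase₁ N K M τ T δ) (x : Fin N → Fin K)
    (g : Fin N → Fin τ) (n : Fin N) :
    broadcastPolicy N K M τ T δ c k₀ (history (broadcastPolicy N K M τ T δ c k₀) X G R t ω) x g n =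
      Fin.ofNat M (t * τ + g n) := by
  rw [broadcastPolicy]
  simp only [history_length, if_pos ht]

lemma broadcastPolicy_of_phase₁_le (ht : phase₁ N K M τ T δ ≤ t) (x : Fin N → Fin K)
    (g : Fin N → Fin τ) (n : Fin N) :
    broadcastPolicy N K M τ T δ c k₀ (history (broadcastPolicy N K M τ T δ c k₀) X G R t ω) x g n =
      if t < phase₁ N K M τ T δ + phase₂ N K (broadcastReps X G R T δ c k₀ ω).card τ T δ then
        ((broadcastReps X G R T δ c k₀ ω).sort (· ≤ ·)).getD
          (((t - phase₁ N K M τ T δ) * τ + g n) % (broadcastReps X G R T δ c k₀ ω).card) 0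
      else argmax c (broadcastReps X G R T δ c k₀ ω) fun m => ∑ n' with g n' = g n,
        broadcastAvg X G R T δ c k₀ t ω (x n') m := by
  have hdrop := history_drop (broadcastPolicy N K M τ T δ c k₀) X G R (phase₁ N K M τ T δ)
    (t - phase₁ N K M τ T δ) ω
  rw [Nat.add_sub_cancel' ht] at hdrop
  conv_lhs => rw [broadcastPolicy]
  simp only [history_length, if_neg ht.not_gt, hdrop]
  rfl

lemma broadcastReps_eq (hD : IsLatentPayoff δ D typ) (hδ : 0 < δ)
    (hgood : ∀ m, ω ∉ clusteringFailure X G R D T δ c k₀ m) :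
    broadcastReps X G R T δ c k₀ ω = reps c (typeClasses typ) := by
  rw [broadcastReps, cluster_eq_typeClasses c fun a b _ =>
    hD.dist_lt_iff hδ (not_le.mp (hgood a)) (not_le.mp (hgood b))]

lemma sum_gap_broadcast_nonpos (hD : IsLatentPayoff δ D typ) (hδ : 0 < δ)
    (hgrp : ∀ s, (univ.filter fun n => G t ω n = s).card * τ = N)
    (ht : phase₁ N K M τ T δ + phase₂ N K L τ T δ ≤ t)
    (hgood : ω ∉ broadcastFailure X G R D T δ c k₀ L t) :
    ∑ n, gap (broadcastPolicy N K M τ T δ c k₀) X G R D t n ω ≤ 0 := by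
  simp only [broadcastFailure, Set.mem_union, Set.mem_iUnion, not_or, not_exists] at hgood
  have hreps := broadcastReps_eq hD hδ hgood.1
  set A := reps c (typeClasses typ)
  have hcard : A.card = L := card_reps_typeClasses c hD.typ_surjective
  have hA : ∀ a, ∃ m ∈ A, typ m = typ a := exists_mem_reps_typeClasses c typ
  have havg (n : Fin N) (m : Fin M) (hm : m ∈ A) : |broadcastAvg X G R T δ c k₀ t ω (X t ω n) m -
      meanPayoff D (X t ω n) m| < δ * τ / (2 * N) := by
    by_contra! h
    exact hgood.2 (X t ω n, m) ⟨⟨hreps ▸ hcard, hreps ▸ hm⟩, h⟩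
  rw [← Finset.sum_fiberwise univ (G t ω)]
  refine Finset.sum_nonpos fun s _ => ?_
  obtain ⟨hmem, hmax⟩ := argmax_mem_and_le c ((hA 0).imp fun m hm => hm.1)
    fun m => ∑ n' with G t ω n' = s, broadcastAvg X G R T δ c k₀ t ω (X t ω n') m
  have hgap : ∀ n ∈ univ.filter fun n => G t ω n = s,
      gap (broadcastPolicy N K M τ T δ c k₀) X G R D t n ω =
        meanPayoff D (X t ω n) (bestMsg (meanPayoff D) (X t ω) (G t ω) s) -
          meanPayoff D (X t ω n) (argmax c A fun m => ∑ n' with G t ω n' = s,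
            broadcastAvg X G R T δ c k₀ t ω (X t ω n') m) := by
    rintro n hn
    obtain rfl : G t ω n = s := (Finset.mem_filter.mp hn).2
    rw [gap, action, broadcastPolicy_of_phase₁_le ((Nat.le_add_right _ _).trans ht), hreps, hcard,
      if_neg ht.not_gt]
  rw [Finset.sum_congr rfl hgap]
  refine sum_meanPayoff_bestMsg_sub_nonpos hD hδ hA (fun n _ => havg n) ?_ hmem hmax
  have hsize : ((univ.filter fun n => G t ω n = s).card : ℝ) * τ = N := by exact_mod_cast hgrp s
  calc 2 * (δ * τ / (2 * N)) * ((univ.filter fun n => G t ω n = s).card : ℝ)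
      = δ * ((((univ.filter fun n => G t ω n = s).card : ℝ) * τ) / N) := by ring
    _ = δ * (N / N) := by rw [hsize]
    _ ≤ δ := mul_le_of_le_one_right hδ.le (div_self_le_one _)

lemma measurable_broadcastReps :
    Measurable[past X G R (phase₁ N K M τ T δ)] (broadcastReps X G R T δ c k₀) := by
  let _ : MeasurableSpace Ω := past X G R (phase₁ N K M τ T δ)
  have havg (m : Fin M) :
      Measurable fun ω => broadcastAvg X G R T δ c k₀ (phase₁ N K M τ T δ) ω k₀ m :=
    ((measurable_avg k₀ m).comp (measurable_history (measurable_broadcastPolicy T δ c k₀) _) :)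
  exact Measurable.of_discrete.comp
    (measurable_cluster c (δ / 2) fun a b => ((havg a).sub (havg b)).abs)

end BroadcastFailures

section BroadcastDeviations

variable {N K M τ L : ℕ} [NeZero M] {Ω : Type*} [MeasurableSpace Ω] {P : Measure Ω}
  {X : ℕ → Ω → Fin N → Fin K} {G : ℕ → Ω → Fin N → Fin τ}
  {R : ℕ → Ω → Fin N → Fin K → Fin M → ℝ} {D : Fin K → Fin M → Measure ℝ} {T : ℕ}
  {δ : ℝ} {c : Choices M} {k₀ k : Fin K} {m : Fin M} {t : ℕ}

lemma measurableSet_avg_deviation (hB : IsBroadcastModel P D X G R) (ε : ℝ) (t : ℕ) (k : Fin K)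
    (m : Fin M) :
    MeasurableSet {ω | ε ≤ |broadcastAvg X G R T δ c k₀ t ω k m - meanPayoff D k m|} :=
  measurableSet_le measurable_const ((((measurable_avg k m).comp
    ((measurable_history (measurable_broadcastPolicy T δ c k₀) t).mono
      (hB.past_le t) le_rfl) :).sub_const _).abs)

lemma measurableSet_broadcastFailure (hB : IsBroadcastModel P D X G R) (t : ℕ) :
    MeasurableSet (broadcastFailure X G R D T δ c k₀ L t) :=
  (MeasurableSet.iUnion fun m => measurableSet_avg_deviation hB _ _ k₀ m).union
    (.iUnion fun q => ((measurable_broadcastReps.mono (hB.past_le _) le_rfl)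
      (MeasurableSet.of_discrete (s := {A : Finset (Fin M) | A.card = L ∧ q.2 ∈ A}))).inter
      (measurableSet_avg_deviation hB _ t q.1 q.2))

lemma measure_clusteringFailure_le (hB : IsBroadcastModel P D X G R)
    (h01 : ∀ᵐ r ∂D k₀ m, r ∈ Set.Icc (0 : ℝ) 1) (hδ : 0 ≤ δ) {β : ℝ} (hβ0 : 0 ≤ β)
    (hβ : SampleRate P X G (2 * (δ / 4) ^ 2) β) :
    P (clusteringFailure X G R D T δ c k₀ m) ≤
      ofReal (2 * exp (-(β * (phase₁ N K M τ T δ * τ / M : ℕ)))) := by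
  have := hB.prob
  have hphase := hB.measure_phase_deviation_le (measurable_broadcastPolicy T δ c k₀) h01
    (by positivity : 0 ≤ δ / 4) hβ (s := 0) (F := Set.univ) MeasurableSet.univ
    (fun u => univ.filter fun s : Fin τ => (u * τ + s) % M = m) (phase₁ N K M τ T δ)
    (t := phase₁ N K M τ T δ) (zero_add _).le fun ω _ u hu x g n hn => by
      rw [zero_add, broadcastPolicy_of_lt_phase₁ hu]
      exact Fin.ext (by simpa using hn)
  rw [Set.univ_inter] at hphase
  refine hphase.trans ?_
  simp only [history, expStat_nil, Measure.restrict_univ, lintegral_const, measure_univ, one_mul]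
  rw [one_add_one_eq_two, mul_comm, ofReal_mul zero_le_two, ENNReal.ofReal_ofNat]
  gcongr
  exact_mod_cast div_le_sum_card_mod m.2 (phase₁ N K M τ T δ)

lemma measure_phase₂_deviation_le_of_reps (hB : IsBroadcastModel P D X G R)
    (h01 : ∀ᵐ r ∂D k m, r ∈ Set.Icc (0 : ℝ) 1) {ε β : ℝ} (hε : 0 ≤ ε) (hβ0 : 0 ≤ β)
    (hβ : SampleRate P X G (2 * ε ^ 2) β)
    (ht : phase₁ N K M τ T δ + phase₂ N K L τ T δ ≤ t) {A : Finset (Fin M)} (hA : A.card = L)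
    (hm : m ∈ A) :
    P ({ω | broadcastReps X G R T δ c k₀ ω = A} ∩
        {ω | ε ≤ |broadcastAvg X G R T δ c k₀ t ω k m - meanPayoff D k m|}) ≤
      ofReal (exp (-(β * (phase₂ N K L τ T δ * τ / L : ℕ)))) *
        ((∫⁻ ω in {ω | broadcastReps X G R T δ c k₀ ω = A},
            expStat (meanPayoff D k m) (4 * ε) (2 * ε ^ 2) k m
              (history (broadcastPolicy N K M τ T δ c k₀) X G R (phase₁ N K M τ T δ) ω) ∂P) +
          ∫⁻ ω in {ω | broadcastReps X G R T δ c k₀ ω = A},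
            expStat (meanPayoff D k m) (-(4 * ε)) (2 * ε ^ 2) k m
              (history (broadcastPolicy N K M τ T δ c k₀) X G R (phase₁ N K M τ T δ) ω) ∂P) := by
  obtain ⟨i, hi, him⟩ := List.mem_iff_getElem.mp ((Finset.mem_sort (· ≤ ·)).mpr hm)
  have hiL : i < L := by rwa [Finset.length_sort, hA] at hi
  refine (hB.measure_phase_deviation_le (measurable_broadcastPolicy T δ c k₀) h01 hε hβ
    (measurable_broadcastReps (MeasurableSet.of_discrete (s := {A})))
    (fun u => univ.filter fun s : Fin τ => (u * τ + s) % L = i) (phase₂ N K L τ T δ) ht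
    fun ω (hω : broadcastReps X G R T δ c k₀ ω = A) u hu x g n hn => ?_).trans ?_
  · simp only [Finset.mem_filter, Finset.mem_univ, true_and] at hn
    rw [broadcastPolicy_of_phase₁_le (Nat.le_add_right _ _), hω, hA,
      if_pos (Nat.add_lt_add_left hu _), Nat.add_sub_cancel_left, hn, List.getD_eq_getElem _ _ hi,
      him]
  · have hsamples := div_le_sum_card_mod (τ := τ) hiL (phase₂ N K L τ T δ)
    refine mul_le_mul_left (ofReal_le_ofReal (exp_le_exp.mpr (neg_le_neg ?_))) _
    exact mul_le_mul_of_nonneg_left (by exact_mod_cast hsamples) hβ0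

lemma measure_exploitationFailure_le (hB : IsBroadcastModel P D X G R)
    (h01 : ∀ᵐ r ∂D k m, r ∈ Set.Icc (0 : ℝ) 1) (hδ : 0 ≤ δ) {β : ℝ} (hβ0 : 0 ≤ β)
    (hβ : SampleRate P X G (2 * (δ * τ / (2 * N)) ^ 2) β)
    (ht : phase₁ N K M τ T δ + phase₂ N K L τ T δ ≤ t) :
    P (exploitationFailure X G R D T δ c k₀ L t k m) ≤
      ofReal (2 * exp (-(β * (phase₂ N K L τ T δ * τ / L : ℕ)))) := by
  have hπ : Measurable (broadcastPolicy N K M τ T δ c k₀) := measurable_broadcastPolicy T δ c k₀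
  set ε := δ * τ / (2 * N)
  let F (A : Finset (Fin M)) : Set Ω := {ω | broadcastReps X G R T δ c k₀ ω = A}
  let 𝒜 : Finset (Finset (Fin M)) := univ.filter fun A => A.card = L ∧ m ∈ A
  let U (θ : ℝ) (ω : Ω) : ℝ≥0∞ := expStat (meanPayoff D k m) θ (2 * ε ^ 2) k m
    (history (broadcastPolicy N K M τ T δ c k₀) X G R (phase₁ N K M τ T δ) ω)
  have hF (A : Finset (Fin M)) : MeasurableSet (F A) :=
    hB.past_le _ _ (measurable_broadcastReps (MeasurableSet.of_discrete (s := {A})))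
  have hsum (θ : ℝ) : ∑ A ∈ 𝒜, ∫⁻ ω in F A, U θ ω ∂P ≤ 1 := by
    rw [← lintegral_biUnion_finset (fun A _ A' _ hne => Set.disjoint_left.mpr
      fun ω h h' => hne (h.symm.trans h')) fun A _ => hF A]
    exact (setLIntegral_le_lintegral _ _).trans
      (hB.lintegral_expStat_le_one hπ h01 θ (by positivity) _)
  calc _ ≤ P (⋃ A ∈ 𝒜, F A ∩
          {ω | ε ≤ |broadcastAvg X G R T δ c k₀ t ω k m - meanPayoff D k m|}) := by
        refine measure_mono fun ω hω => Set.mem_iUnion₂.mpr ?_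
        exact ⟨_, Finset.mem_filter.mpr ⟨Finset.mem_univ _, hω.1⟩, rfl, hω.2⟩
    _ ≤ ∑ A ∈ 𝒜, ofReal (exp (-(β * (phase₂ N K L τ T δ * τ / L : ℕ)))) *
          ((∫⁻ ω in F A, U (4 * ε) ω ∂P) + ∫⁻ ω in F A, U (-(4 * ε)) ω ∂P) :=
        (measure_biUnion_finset_le _ _).trans (Finset.sum_le_sum fun A hA =>
          have hA := (Finset.mem_filter.mp hA).2;
          measure_phase₂_deviation_le_of_reps hB h01 (by positivity) hβ0 hβ ht hA.1 hA.2)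
    _ ≤ ofReal (exp (-(β * (phase₂ N K L τ T δ * τ / L : ℕ)))) * (1 + 1) := by
        rw [← Finset.mul_sum, Finset.sum_add_distrib]
        gcongr <;> exact hsum _
    _ = _ := by
        rw [one_add_one_eq_two, mul_comm, ofReal_mul zero_le_two, ENNReal.ofReal_ofNat]

end BroadcastDeviations

section PhaseLengths

variable {N K M τ L T : ℕ} {δ : ℝ}

lemma log_natCast_eq_zero_or (x : ℕ) : log x = 0 ∨ 1 / 2 ≤ log x := by
  rcases Nat.lt_or_ge x 2 with h | h
  · left
    interval_cases x <;> simp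
  · right
    have hle : log 2 ≤ log x := Real.log_le_log two_pos (by exact_mod_cast h)
    linarith [Real.log_two_gt_d9]

lemma exp_neg_mul_natDiv_le {β b : ℝ} {J r x p : ℕ} (hx : 0 < x) (hβ : 0 ≤ β)
    (hJ : b * log x ≤ J) (hb : 2 ≤ b * τ / r) (hp : β * (b * τ / r) = 2 * p) :
    exp (-(β * (J * τ / r : ℕ))) ≤ 1 / (x : ℝ) ^ p := by
  have hsamples : b * τ / r * log x / 2 ≤ ((J * τ / r : ℕ) : ℝ) := by
    refine half_le_natDiv ?_ ((log_natCast_eq_zero_or x).imp (fun h => by rw [h, mul_zero])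
      fun h => by nlinarith)
    calc b * τ / r * log x = b * log x * τ / r := by ring
      _ ≤ ((J * τ : ℕ) : ℝ) / r := by push_cast; gcongr
  have hx' : (0 : ℝ) < x := by exact_mod_cast hx
  calc exp (-(β * (J * τ / r : ℕ))) ≤ exp (-(p * log x)) := by
        refine exp_le_exp.mpr (neg_le_neg ?_)
        calc p * log x = β * (b * τ / r * log x / 2) := by linear_combination -(log x / 2) * hp
          _ ≤ _ := by gcongr
    _ = 1 / (x : ℝ) ^ p := by rw [Real.exp_neg, Real.exp_nat_mul, Real.exp_log hx', one_div]

lemma exp_phase₁_le (hK : 0 < K) (hτ : 0 < τ) (hδ : 0 < δ) (hδ1 : δ ≤ 1) (hx : 0 < N * T * M) :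
    exp (-(δ ^ 2 / (16 * K) * (phase₁ N K M τ T δ * τ / M : ℕ))) ≤ 1 / (N * T * M : ℕ) := by
  have hM : (0 : ℝ) < M := by exact_mod_cast Nat.pos_of_mul_pos_left hx
  have hK1 : (1 : ℝ) ≤ K := by exact_mod_cast hK
  have hδ2 : δ ^ 2 ≤ 1 := pow_le_one₀ hδ.le hδ1
  have hexp := exp_neg_mul_natDiv_le (τ := τ) (β := δ ^ 2 / (16 * K))
    (b := 32 * K * M / (τ * δ ^ 2)) (J := phase₁ N K M τ T δ) (r := M) (p := 1) hx
    (by positivity) (by push_cast; exact Nat.le_ceil _) ?_ (by field_simp; norm_num)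
  · simpa only [pow_one] using hexp
  · rw [show 32 * K * M / (τ * δ ^ 2) * τ / M = 32 * K / δ ^ 2 by field_simp,
      le_div_iff₀ (by positivity)]
    linarith

lemma exp_phase₂_le (hτ : 0 < τ) (hτN : τ ≤ N) (hδ : 0 < δ) (hδ1 : δ ≤ 1)
    (hx : 0 < L * N * K * T) :
    exp (-(δ ^ 2 * τ / (4 * N * K) * (phase₂ N K L τ T δ * τ / L : ℕ))) ≤
      1 / ((L * N * K * T : ℕ) : ℝ) ^ 2 := by
  obtain ⟨⟨⟨hL, hN⟩, hK⟩, -⟩ : ((0 < L ∧ 0 < N) ∧ 0 < K) ∧ 0 < T := by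
    simpa only [Nat.pos_iff_ne_zero, mul_ne_zero_iff] using hx
  have hK1 : (1 : ℝ) ≤ K := by exact_mod_cast hK
  have hτN' : (τ : ℝ) ≤ N := by exact_mod_cast hτN
  have hδ2 : δ ^ 2 ≤ 1 := pow_le_one₀ hδ.le hδ1
  refine exp_neg_mul_natDiv_le (b := 16 * N * K * L / (τ ^ 2 * δ ^ 2)) hx (by positivity)
    (by push_cast; exact Nat.le_ceil _) ?_ (by field_simp; norm_num)
  rw [show 16 * N * K * L / (τ ^ 2 * δ ^ 2) * τ / L = 16 * N * K / (τ * δ ^ 2) by field_simp,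
    le_div_iff₀ (by positivity)]
  calc 2 * (τ * δ ^ 2) ≤ 16 * (N * 1) := by gcongr; norm_num
    _ ≤ 16 * (N * K) := by gcongr
    _ = 16 * N * K := by ring

lemma le_mul_of_phase₁_lt (hN : 0 < N) (hK : 0 < K) (hτ : 0 < τ) (hτN : τ ≤ N) (hδ : 0 < δ)
    (hδ1 : δ ≤ 1) (h : phase₁ N K M τ T δ < T) : M ≤ N * T := by
  have hNT : 0 < N * T := Nat.mul_pos hN (Nat.zero_lt_of_lt h)
  rcases Nat.lt_or_ge 1 M with hM | hM
  swap
  · exact hM.trans hNT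
  have hlog : 1 / 2 ≤ log (N * T * M) := by
    have hone : 1 < N * T * M := hM.trans_le (Nat.le_mul_of_pos_left M hNT)
    exact_mod_cast (log_natCast_eq_zero_or (N * T * M)).resolve_left
      (Real.log_pos (by exact_mod_cast hone)).ne'
  have hK1 : (1 : ℝ) ≤ K := by exact_mod_cast hK
  have hτ0 : (0 : ℝ) < τ := by exact_mod_cast hτ
  have hδ2 : δ ^ 2 ≤ 1 := pow_le_one₀ hδ.le hδ1
  have hT : M / τ ≤ (T : ℝ) := calc
    (M : ℝ) / τ ≤ 16 * K / δ ^ 2 * (M / τ) := by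
      refine le_mul_of_one_le_left (by positivity) ?_
      rw [le_div_iff₀ (by positivity)]
      linarith
    _ = 32 * K * M / (τ * δ ^ 2) * (1 / 2) := by field_simp; norm_num
    _ ≤ 32 * K * M / (τ * δ ^ 2) * log (N * T * M) := by gcongr
    _ ≤ phase₁ N K M τ T δ := Nat.le_ceil _
    _ ≤ T := by exact_mod_cast h.le
  rw [div_le_iff₀ hτ0] at hT
  calc M ≤ T * τ := by exact_mod_cast hT
    _ ≤ N * T := (Nat.mul_le_mul_left T hτN).trans_eq (mul_comm _ _)

end PhaseLengths

section BroadcastRegret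

variable {N K M τ L : ℕ} {Ω : Type*} [MeasurableSpace Ω] {P : Measure Ω}
  {X : ℕ → Ω → Fin N → Fin K} {G : ℕ → Ω → Fin N → Fin τ} {R : ℕ → Ω → Fin N → Fin K → Fin M → ℝ}
  {D : Fin K → Fin M → Measure ℝ} {δ : ℝ} {typ : Fin M → Fin L} {T : ℕ} {c : Choices M}
  {k₀ : Fin K} {t : ℕ}

lemma measureReal_clusteringFailure_le [NeZero M] (hB : IsBroadcastModel P D X G R)
    (hD : IsLatentPayoff δ D typ) (hδ : 0 < δ) (hτ : 0 < τ)
    (hβ : SampleRate P X G (2 * (δ / 4) ^ 2) (δ ^ 2 / (16 * K))) (hNT : 0 < N * T) (m : Fin M) :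
    P.real (clusteringFailure X G R D T δ c k₀ m) ≤ 2 / (N * T * M : ℕ) :=
  ENNReal.toReal_le_of_le_ofReal (by positivity) <|
    (measure_clusteringFailure_le hB (hD.mem_Icc k₀ m) hδ.le (by positivity) hβ).trans <|
      ofReal_le_ofReal <|
        (mul_le_mul_of_nonneg_left (exp_phase₁_le (Fin.pos k₀) hτ hδ (hD.le_one k₀ m)
          (Nat.mul_pos hNT (NeZero.pos M))) zero_le_two).trans_eq (mul_one_div _ _)

lemma measureReal_exploitationFailure_le [NeZero M] (hB : IsBroadcastModel P D X G R)
    (hD : IsLatentPayoff δ D typ) (hδ : 0 < δ) (hτ : 0 < τ) (hτN : τ ≤ N) (hT : 0 < T)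
    (hβ : SampleRate P X G (2 * (δ * τ / (2 * N)) ^ 2) (δ ^ 2 * τ / (4 * N * K)))
    (ht : phase₁ N K M τ T δ + phase₂ N K L τ T δ ≤ t) (k : Fin K) (m : Fin M) :
    P.real (exploitationFailure X G R D T δ c k₀ L t k m) ≤ 2 / ((L * N * K * T : ℕ) : ℝ) ^ 2 := by
  have hx : 0 < L * N * K * T :=
    Nat.mul_pos (Nat.mul_pos (Nat.mul_pos (Fin.pos (typ m)) (hτ.trans_le hτN)) (Fin.pos k)) hT
  exact ENNReal.toReal_le_of_le_ofReal (by positivity) <|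
    (measure_exploitationFailure_le hB (hD.mem_Icc k m) hδ.le (by positivity) hβ ht).trans <|
      ofReal_le_ofReal <|
        (mul_le_mul_of_nonneg_left (exp_phase₂_le hτ hτN hδ (hD.le_one k m) hx)
          zero_le_two).trans_eq (mul_one_div _ _)

lemma measureReal_broadcastFailure_le [NeZero M] (hB : IsBroadcastModel P D X G R)
    (hD : IsLatentPayoff δ D typ) (hδ : 0 < δ) (hτ : 0 < τ) (hτN : τ ≤ N)
    (hβ₁ : SampleRate P X G (2 * (δ / 4) ^ 2) (δ ^ 2 / (16 * K)))
    (hβ₂ : SampleRate P X G (2 * (δ * τ / (2 * N)) ^ 2) (δ ^ 2 * τ / (4 * N * K)))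
    (ht : phase₁ N K M τ T δ + phase₂ N K L τ T δ ≤ t) (htT : t < T) :
    P.real (broadcastFailure X G R D T δ c k₀ L t) ≤ 4 / (N * T) := by
  have hN : 0 < N := hτ.trans_le hτN
  have hT : 0 < T := Nat.zero_lt_of_lt htT
  have hK : 0 < K := Fin.pos k₀
  have hL : (1 : ℝ) ≤ L := by exact_mod_cast (Fin.pos (typ 0) : 0 < L)
  have hM : (0 : ℝ) < M := by exact_mod_cast NeZero.pos M
  have hMNT : (M : ℝ) ≤ N * T := by
    exact_mod_cast le_mul_of_phase₁_lt hN hK hτ hτN hδ (hD.le_one k₀ 0)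
      (((Nat.le_add_right _ _).trans ht).trans_lt htT)
  calc _ ≤ _ := measureReal_union_le _ _
    _ ≤ ∑ m, P.real (clusteringFailure X G R D T δ c k₀ m) +
        ∑ q : Fin K × Fin M, P.real (exploitationFailure X G R D T δ c k₀ L t q.1 q.2) :=
      add_le_add (measureReal_iUnion_fintype_le _) (measureReal_iUnion_fintype_le _)
    _ ≤ ∑ _ : Fin M, (2 / (N * T * M : ℕ) : ℝ) +
        ∑ _ : Fin K × Fin M, (2 / ((L * N * K * T : ℕ) : ℝ) ^ 2 : ℝ) := by
      gcongr with m _ q _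
      · exact measureReal_clusteringFailure_le hB hD hδ hτ hβ₁ (Nat.mul_pos hN hT) m
      · exact measureReal_exploitationFailure_le hB hD hδ hτ hτN hT hβ₂ ht q.1 q.2
    _ = 2 / (N * T) + 2 * M / (L ^ 2 * K * (N * T) ^ 2) := by
      simp only [Finset.sum_const, Finset.card_univ, Fintype.card_prod, Fintype.card_fin,
        nsmul_eq_mul]
      push_cast
      field_simp
    _ ≤ 2 / (N * T) + 2 * (N * T) / (1 ^ 2 * 1 * (N * T) ^ 2) := by
      gcongr
      exact_mod_cast hK
    _ = 4 / (N * T) := by field_simp; norm_num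

lemma regret_broadcast_le [NeZero M] (hB : IsBroadcastModel P D X G R)
    (hD : IsLatentPayoff δ D typ) (hδ : 0 < δ) (hN : 0 < N) (hτN : τ ∣ N)
    (hβ₁ : SampleRate P X G (2 * (δ / 4) ^ 2) (δ ^ 2 / (16 * K)))
    (hβ₂ : SampleRate P X G (2 * (δ * τ / (2 * N)) ^ 2) (δ ^ 2 * τ / (4 * N * K))) :
    regret P (broadcastPolicy N K M τ T δ c k₀) (meanPayoff D) X G R T ≤
      N * (phase₁ N K M τ T δ + phase₂ N K L τ T δ : ℕ) + 4 := by
  have hslots := regret_le_of_slots hB hD (measurable_broadcastPolicy T δ c k₀)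
    (phase₁ N K M τ T δ + phase₂ N K L τ T δ) T (broadcastFailure X G R D T δ c k₀ L)
    (measurableSet_broadcastFailure hB) (fun _ _ => 0) (fun _ _ => le_rfl) (a := 0)
    (fun _ => by simp) (by
      filter_upwards [ae_all_iff.mpr hB.ae_group_card] with ω hgrp t _ ht hgood
      exact sum_gap_broadcast_nonpos hD hδ (hgrp t) ht hgood)
  rw [add_zero] at hslots
  refine hslots.trans (add_le_add_right ?_ _)
  rcases T.eq_zero_or_pos with rfl | hT
  · simp
  calc _ ≤ N * ∑ t ∈ Finset.Ico (phase₁ N K M τ T δ + phase₂ N K L τ T δ) T, (4 / (N * T) : ℝ) := by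
        gcongr with t ht
        exact measureReal_broadcastFailure_le hB hD hδ (Nat.pos_of_dvd_of_pos hτN hN)
          (Nat.le_of_dvd hN hτN) hβ₁ hβ₂ (Finset.mem_Ico.mp ht).1 (Finset.mem_Ico.mp ht).2
    _ ≤ N * (T * (4 / (N * T))) := by
        rw [Finset.sum_const, Nat.card_Ico, nsmul_eq_mul]
        gcongr
        exact Nat.sub_le _ _
    _ = 4 := by field_simp

end BroadcastRegret

section BroadcastBounds

variable {N K M τ L : ℕ} {Ω : Type*} [MeasurableSpace Ω] {P : Measure Ω}
  {X : ℕ → Ω → Fin N → Fin K} {G : ℕ → Ω → Fin N → Fin τ} {R : ℕ → Ω → Fin N → Fin K → Fin M → ℝ}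
  {D : Fin K → Fin M → Measure ℝ} {δ : ℝ} {typ : Fin M → Fin L} {T : ℕ} {c : Choices M}
  {k₀ : Fin K}

lemma SampleRate.mono {a β β' : ℝ} (h : SampleRate P X G a β) (hβ : β' ≤ β) :
    SampleRate P X G a β' := fun t k B => (h t k B).trans <| by gcongr

lemma sampleRate_clustering_of_uniformRates {G : ℕ → Ω → Fin N → Fin 1}
    (hB : IsBroadcastModel P D X G R) (hX : UniformRates P X) (hN : 1 ≤ N) (hδ : 0 ≤ δ)
    (hδ1 : δ ≤ 1) : SampleRate P X G (2 * (δ / 4) ^ 2) (δ ^ 2 / (16 * K)) := by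
  have hδ2 : δ ^ 2 ≤ 1 := pow_le_one₀ hδ hδ1
  have hN' : (1 : ℝ) ≤ N := by exact_mod_cast hN
  have hrate := sampleRate_of_uniformRates (c := 2 * (δ / 4) ^ 2) (u := δ ^ 2 / 8) hB hX hN
    (by positivity) (by linarith) (by nlinarith [sq_nonneg δ])
  exact hrate.mono (le_of_eq (by ring))

lemma sampleRate_exploitation_of_uniformRates {G : ℕ → Ω → Fin N → Fin 1}
    (hB : IsBroadcastModel P D X G R) (hX : UniformRates P X) (hN : 1 ≤ N) (hδ : 0 ≤ δ)
    (hδ1 : δ ≤ 1) :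
    SampleRate P X G (2 * (δ * (1 : ℕ) / (2 * N)) ^ 2) (δ ^ 2 * (1 : ℕ) / (4 * N * K)) := by
  have hδ2 : δ ^ 2 ≤ 1 := pow_le_one₀ hδ hδ1
  have hN' : (1 : ℝ) ≤ N := by exact_mod_cast hN
  have hrate := sampleRate_of_uniformRates (c := 2 * (δ * (1 : ℕ) / (2 * N)) ^ 2)
    (u := δ ^ 2 / (2 * N)) hB hX hN (by positivity) (by rw [div_le_one (by positivity)]; linarith)
    (le_of_eq (by field_simp; simp))
  exact hrate.mono (le_of_eq (by push_cast; ring))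

lemma sampleRate_clustering_of_uniformUsers (hB : IsBroadcastModel P D X G R)
    (hX : UniformUsers P X) (hτ : 0 < τ) (hτN : τ ≤ N) (hδ : 0 ≤ δ) (hδ1 : δ ≤ 1) :
    SampleRate P X G (2 * (δ / 4) ^ 2) (δ ^ 2 / (16 * K)) := by
  have hδ2 : δ ^ 2 ≤ 1 := pow_le_one₀ hδ hδ1
  have hratio : (1 : ℝ) ≤ N / τ := by
    rw [le_div_iff₀ (by positivity), one_mul]
    exact_mod_cast hτN
  refine (sampleRate_of_uniformUsers (c := 2 * (δ / 4) ^ 2) (u := δ ^ 2 / 8) hB hX hτ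
    (by positivity) (by linarith) (by linarith)).mono ?_
  calc δ ^ 2 / (16 * K) = δ ^ 2 / 8 / (2 * K) * 1 := by ring
    _ ≤ _ := by gcongr

lemma sampleRate_exploitation_of_uniformUsers (hB : IsBroadcastModel P D X G R)
    (hX : UniformUsers P X) (hτ : 0 < τ) (hτN : τ ≤ N) (hδ : 0 ≤ δ) (hδ1 : δ ≤ 1) :
    SampleRate P X G (2 * (δ * τ / (2 * N)) ^ 2) (δ ^ 2 * τ / (4 * N * K)) := by
  have hN : 0 < N := hτ.trans_le hτN
  have hhalf : δ * τ / (2 * N) ≤ 1 / 2 := by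
    rw [div_le_div_iff₀ (by positivity) two_pos]
    calc δ * τ * 2 ≤ 1 * N * 2 := by gcongr
      _ = 1 * (2 * N) := by ring
  have hc : 2 * (δ * τ / (2 * N)) ^ 2 ≤ 1 := by
    calc 2 * (δ * τ / (2 * N)) ^ 2 ≤ 2 * (1 / 2) ^ 2 := by gcongr
      _ ≤ 1 := by norm_num
  exact (sampleRate_of_uniformUsers hB hX hτ (by positivity) hc le_rfl).mono
    (le_of_eq (by field_simp; norm_num))

lemma IsLatentPayoff.card_types_le (hD : IsLatentPayoff δ D typ) : L ≤ M := by
  simpa only [Fintype.card_fin] using Fintype.card_le_of_surjective typ hD.typ_surjective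

lemma regret_nonpos_of_subsingleton [Subsingleton (Fin M)] [NeZero M] {π : Policy N K M τ}
    (hB : IsBroadcastModel P D X G R) (hD : IsLatentPayoff δ D typ) (hπ : Measurable π) :
    regret P π (meanPayoff D) X G R T ≤ 0 := by
  have hslots := regret_le_of_slots hB hD hπ 0 T (fun _ => ∅) (fun _ => .empty) (a := 0)
    (fun _ _ => 0) (fun _ _ => le_rfl) (fun _ => by simp)
    (.of_forall fun ω t _ _ _ => Finset.sum_nonpos fun n _ => by
      rw [gap, Subsingleton.elim (bestMsg _ _ _ _) (action π X G R t ω n), sub_self])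
  simpa using hslots

lemma regret_broadcast_le_log [NeZero M] (hB : IsBroadcastModel P D X G R)
    (hD : IsLatentPayoff δ D typ) (hδ : 0 < δ) (hN : 1 ≤ N) (hτN : τ ∣ N)
    (hβ₁ : SampleRate P X G (2 * (δ / 4) ^ 2) (δ ^ 2 / (16 * K)))
    (hβ₂ : SampleRate P X G (2 * (δ * τ / (2 * N)) ^ 2) (δ ^ 2 * τ / (4 * N * K))) :
    regret P (broadcastPolicy N K M τ T δ c k₀) (meanPayoff D) X G R T ≤
      32 * (N * K * M / (τ * δ ^ 2) * log (N * T * M)) +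
        16 * (L * N ^ 2 * K / (τ ^ 2 * δ ^ 2) * log (L * N * K * T)) + 6 * N := by
  have hN' : (1 : ℝ) ≤ N := by exact_mod_cast hN
  have hlog₁ : 0 ≤ log (N * T * M) := by exact_mod_cast Real.log_natCast_nonneg (N * T * M)
  have hlog₂ : 0 ≤ log (L * N * K * T) := by exact_mod_cast Real.log_natCast_nonneg (L * N * K * T)
  have hphase₁ : (phase₁ N K M τ T δ : ℝ) ≤ 32 * K * M / (τ * δ ^ 2) * log (N * T * M) + 1 :=
    (Nat.ceil_lt_add_one (by positivity)).le
  have hphase₂ : (phase₂ N K L τ T δ : ℝ) ≤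
      16 * N * K * L / (τ ^ 2 * δ ^ 2) * log (L * N * K * T) + 1 :=
    (Nat.ceil_lt_add_one (by positivity)).le
  calc _ ≤ (N : ℝ) * (phase₁ N K M τ T δ + phase₂ N K L τ T δ : ℕ) + 4 :=
        regret_broadcast_le hB hD hδ hN hτN hβ₁ hβ₂
    _ ≤ N * ((32 * K * M / (τ * δ ^ 2) * log (N * T * M) + 1) +
          (16 * N * K * L / (τ ^ 2 * δ ^ 2) * log (L * N * K * T) + 1)) + 4 * N := by
        push_cast
        gcongr
        linarith
    _ = _ := by ring

lemma regret_broadcast_single_le_of_log_le [NeZero M] {G : ℕ → Ω → Fin N → Fin 1}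
    (hB : IsBroadcastModel P D X G R) (hD : IsLatentPayoff δ D typ) (hX : UniformRates P X)
    (hδ : 0 < δ) (hN : 1 ≤ N) {ℓ : ℝ} (hhalf : 1 / 2 ≤ ℓ) (hlog₁ : log (N * T * M) ≤ ℓ)
    (hlog₂ : log (L * N * K * T) ≤ ℓ) :
    regret P (broadcastPolicy N K M 1 T δ c k₀) (meanPayoff D) X G R T ≤
      (32 / δ ^ 2 + 12) * (((N * K * M + L * N ^ 2 * K : ℕ) : ℝ) * ℓ) := by
  have hδ1 : δ ≤ 1 := hD.le_one k₀ 0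
  have hK : (1 : ℝ) ≤ K := by exact_mod_cast (Fin.pos k₀ : 0 < K)
  have hM : (1 : ℝ) ≤ M := by exact_mod_cast (NeZero.one_le : 1 ≤ M)
  have : 0 ≤ ℓ := one_half_pos.le.trans hhalf
  have hterm : 0 ≤ L * N ^ 2 * K / (1 ^ 2 * δ ^ 2) * ℓ := by positivity
  calc _ ≤ _ := regret_broadcast_le_log hB hD hδ hN (one_dvd N)
        (sampleRate_clustering_of_uniformRates hB hX hN hδ.le hδ1)
        (sampleRate_exploitation_of_uniformRates hB hX hN hδ.le hδ1)
    _ ≤ 32 * (N * K * M / ((1 : ℕ) * δ ^ 2) * ℓ) +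
          16 * (L * N ^ 2 * K / ((1 : ℕ) ^ 2 * δ ^ 2) * ℓ) + 6 * (N * 1 * 1 * (2 * ℓ)) := by
        gcongr
        linarith [mul_le_mul_of_nonneg_left hhalf (Nat.cast_nonneg (α := ℝ) N)]
    _ ≤ 32 * (N * K * M / ((1 : ℕ) * δ ^ 2) * ℓ) +
          32 * (L * N ^ 2 * K / ((1 : ℕ) ^ 2 * δ ^ 2) * ℓ) +
          (6 * (N * K * M * (2 * ℓ)) + 12 * (L * N ^ 2 * K * ℓ)) := by
        refine add_le_add (add_le_add le_rfl (by push_cast; linarith))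
          (le_add_of_le_of_nonneg ?_ ?_)
        · gcongr
        · positivity
    _ = _ := by push_cast; ring

theorem regret_broadcast_single_le [NeZero M] {G : ℕ → Ω → Fin N → Fin 1}
    (hB : IsBroadcastModel P D X G R) (hD : IsLatentPayoff δ D typ) (hX : UniformRates P X)
    (hδ : 0 < δ) (hN : 1 ≤ N) (hT : 1 ≤ T) :
    regret P (broadcastPolicy N K M 1 T δ c k₀) (meanPayoff D) X G R T ≤
      (32 / δ ^ 2 + 12) *
        (((N * K * M + L * N ^ 2 * K : ℕ) : ℝ) * log (N * M * K * T)) := by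
  have hK : 1 ≤ K := Fin.pos k₀
  have hL : 1 ≤ L := Fin.pos (typ 0)
  have hM : 1 ≤ M := NeZero.one_le
  rcases hM.eq_or_lt with rfl | hM1
  · have hlog : 0 ≤ log (N * (1 : ℕ) * K * T) := by
      exact_mod_cast Real.log_natCast_nonneg (N * 1 * K * T)
    exact (regret_nonpos_of_subsingleton hB hD (measurable_broadcastPolicy T δ c k₀)).trans
      (by positivity)
  have hprod : 1 < N * M * K * T := by
    calc 1 < 1 * M * 1 * 1 := by simpa using hM1
      _ ≤ N * M * K * T := by gcongr
  have hhalf : 1 / 2 ≤ log (N * M * K * T) := by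
    exact_mod_cast (log_natCast_eq_zero_or (N * M * K * T)).resolve_left
      (Real.log_pos (by exact_mod_cast hprod)).ne'
  refine regret_broadcast_single_le_of_log_le hB hD hX hδ hN hhalf
    (Real.log_le_log (by positivity) ?_) (Real.log_le_log (by positivity) ?_)
  · calc (N * T * M : ℝ) = N * M * (1 : ℕ) * T := by push_cast; ring
      _ ≤ N * M * K * T := by gcongr
  · calc (L * N * K * T : ℝ) ≤ M * N * K * T := by gcongr; exact hD.card_types_le
      _ = N * M * K * T := by ring

theorem regret_broadcast_uniformUsers_le [NeZero M] (hB : IsBroadcastModel P D X G R)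
    (hD : IsLatentPayoff δ D typ) (hX : UniformUsers P X) (hδ : 0 < δ) (hN : 1 ≤ N) (hτN : τ ∣ N)
    (hτ : τ ≤ K * M / δ ^ 2 * log (N * T * M)) :
    regret P (broadcastPolicy N K M τ T δ c k₀) (meanPayoff D) X G R T ≤
      38 * (N * K * M / (τ * δ ^ 2) * log (N * T * M) +
        L * N ^ 2 * K / (τ ^ 2 * δ ^ 2) * log (L * N * K * T)) := by
  have hδ1 : δ ≤ 1 := hD.le_one k₀ 0
  have hτ0 : 0 < τ := Nat.pos_of_dvd_of_pos hτN hN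
  have hτle : τ ≤ N := Nat.le_of_dvd hN hτN
  have hlog : 0 ≤ log (L * N * K * T) := by exact_mod_cast Real.log_natCast_nonneg (L * N * K * T)
  have hNle : (N : ℝ) ≤ N * K * M / (τ * δ ^ 2) * log (N * T * M) := by
    calc (N : ℝ) = N / τ * τ := by field_simp
      _ ≤ N / τ * (K * M / δ ^ 2 * log (N * T * M)) := by gcongr
      _ = _ := by field_simp
  have hnonneg : 0 ≤ L * N ^ 2 * K / (τ ^ 2 * δ ^ 2) * log (L * N * K * T) := by positivity
  have hregret := regret_broadcast_le_log (T := T) (c := c) (k₀ := k₀) hB hD hδ hN hτN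
    (sampleRate_clustering_of_uniformUsers hB hX hτ0 hτle hδ.le hδ1)
    (sampleRate_exploitation_of_uniformUsers hB hX hτ0 hτle hδ.le hδ1)
  linarith

end BroadcastBounds

/-! ### Allocations of the pairs of messages -/

section Allocation

lemma card_filter_mod_eq_le (M b i : ℕ) (hb : 0 < b) :
    (univ.filter fun m : Fin M => (m : ℕ) % b = i % b).card ≤ M / b + 1 := by
  rw [Finset.card_filter, Fin.sum_univ_eq_sum_range fun m => if m % b = i % b then 1 else 0,
    ← Finset.card_filter, ← Nat.count_eq_card_filter_range]
  exact (Nat.count_modEq_card M hb i).trans_le (by split_ifs <;> lia)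

-- The messages form `b` residue classes, and every pair of classes gets a context of its own.
lemma exists_coversPairs {K b : ℕ} (M : ℕ) (hb : 0 < b) (hbK : b * b ≤ K) :
    ∃ S : Fin K → Finset (Fin M),
      (∀ k, (S k).card = min (2 * (M / b + 1)) M) ∧ CoversPairs S := by
  let block (i : ℕ) : Finset (Fin M) := {m | (m : ℕ) % b = i % b}
  have hcard (k : Fin K) : (block (k / b) ∪ block k).card ≤ min (2 * (M / b + 1)) M := by
    refine le_min ?_ ((Finset.card_le_univ _).trans_eq (Fintype.card_fin M))
    exact (Finset.card_union_le _ _).trans ((add_le_add (card_filter_mod_eq_le M b _ hb)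
      (card_filter_mod_eq_le M b _ hb)).trans_eq (two_mul _).symm)
  choose S hsub hS using fun k => Finset.exists_superset_card_eq (hcard k) (by simp)
  refine ⟨S, hS, fun x y _ => ?_⟩
  have hx : (x : ℕ) % b < b := Nat.mod_lt _ hb
  have hy : (y : ℕ) % b < b := Nat.mod_lt _ hb
  have hlt : b * (x % b) + y % b < K := by nlinarith
  have hdiv : (b * (x % b) + y % b) / b = x % b := by
    rw [Nat.mul_add_div hb, Nat.div_eq_of_lt hy, add_zero]
  have hmod : (b * (x % b) + y % b) % b = y % b := by rw [Nat.mul_add_mod, Nat.mod_mod]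
  exact ⟨⟨_, hlt⟩, hsub _ (by simp [block, hdiv]), hsub _ (by simp [block, hmod])⟩

lemma IsAllocation.card_le {K M : ℕ} {S : Fin K → Finset (Fin M)} {pc : Sym2 (Fin M) → Fin K}
    (h : IsAllocation S pc) (hK : 1 ≤ K) :
    ∃ s : ℕ, (∀ k, (S k).card = s) ∧ (s : ℝ) ≤ 4 * (M / √K) + 2 := by
  obtain ⟨s, hs, hmin⟩ := h.minimal
  have hb : 0 < Nat.sqrt K := Nat.sqrt_pos.mpr hK
  obtain ⟨S', hS', hcov⟩ := exists_coversPairs M hb (Nat.sqrt_le K)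
  have hsqrt : √K ≤ 2 * Nat.sqrt K := by
    have hb' : (1 : ℝ) ≤ Nat.sqrt K := by exact_mod_cast hb
    linarith [Real.real_sqrt_lt_nat_sqrt_succ (a := K)]
  have hblock : ((M / Nat.sqrt K : ℕ) : ℝ) ≤ 2 * (M / √K) := by
    calc ((M / Nat.sqrt K : ℕ) : ℝ) ≤ M / Nat.sqrt K := Nat.cast_div_le
      _ = 2 * (M / (2 * Nat.sqrt K)) := by field_simp
      _ ≤ _ := by gcongr
  have hs' : (s : ℝ) ≤ (2 * (M / Nat.sqrt K + 1) : ℕ) := by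
    exact_mod_cast (hmin _ S' hS' hcov).trans (min_le_left _ _)
  push_cast at hs'
  exact ⟨s, hs, by linarith⟩

end Allocation

/-! ### Undersampled messages -/

section Sampling

variable {N K M τ : ℕ} {Ω : Type*}

/-- The number of users with context `k` who receive message `m` in slot `t`, provided that there
are fewer than `q` earlier samples. -/
noncomputable def lowPlays (π : Policy N K M τ) (X : ℕ → Ω → Fin N → Fin K)
    (G : ℕ → Ω → Fin N → Fin τ) (R : ℕ → Ω → Fin N → Fin K → Fin M → ℝ) (q : ℝ) (k : Fin K)
    (m : Fin M) (t : ℕ) (ω : Ω) : ℕ :=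
  if (count (history π X G R t ω) k m : ℝ) < q then
    (recipients (X t ω) (action π X G R t ω) k m).card else 0

variable {π : Policy N K M τ} {X : ℕ → Ω → Fin N → Fin K} {G : ℕ → Ω → Fin N → Fin τ}
  {R : ℕ → Ω → Fin N → Fin K → Fin M → ℝ}

lemma sum_lowPlays_le {q : ℝ} (hq : 0 ≤ q) (k : Fin K) (m : Fin M) (T : ℕ) (ω : Ω) :
    ∑ t ∈ Finset.range T, (lowPlays π X G R q k m t ω : ℝ) ≤ q + N := by
  suffices ∑ t ∈ Finset.range T, (lowPlays π X G R q k m t ω : ℝ) ≤ q + N ∧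
      ∑ t ∈ Finset.range T, (lowPlays π X G R q k m t ω : ℝ) ≤
        count (history π X G R T ω) k m from this.1
  induction T with
  | zero => simpa using add_nonneg hq N.cast_nonneg
  | succ T ih =>
    rw [Finset.sum_range_succ, count_history_succ, lowPlays]
    have hcard : ((recipients (X T ω) (action π X G R T ω) k m).card : ℝ) ≤ N := by
      exact_mod_cast (Finset.card_le_univ _).trans_eq (Fintype.card_fin N)
    push_cast
    split_ifs with hlow
    · constructor <;> linarith [ih.2]
    · exact ⟨by simpa using ih.1, by simpa using le_add_of_nonneg_of_le (by positivity) ih.2⟩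

lemma sum_sum_sum_lowPlays_le {q : ℝ} (hq : 0 ≤ q) (B : Fin K → Finset (Fin M)) {b : ℕ}
    (hB : ∀ k, (B k).card ≤ b) (T : ℕ) (ω : Ω) :
    ∑ t ∈ Finset.range T, ∑ k, ∑ m ∈ B k, (lowPlays π X G R q k m t ω : ℝ) ≤
      K * b * (q + N) := by
  rw [Finset.sum_comm]
  simp only [Finset.sum_comm (s := Finset.range T)]
  calc ∑ k, ∑ m ∈ B k, ∑ t ∈ Finset.range T, (lowPlays π X G R q k m t ω : ℝ)
      ≤ ∑ k, ∑ _ ∈ B k, (q + N) :=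
        Finset.sum_le_sum fun k _ => Finset.sum_le_sum fun m _ => sum_lowPlays_le hq k m T ω
    _ = ∑ k, (B k).card * (q + N) := by simp only [Finset.sum_const, nsmul_eq_mul]
    _ ≤ ∑ _ : Fin K, b * (q + N) := by
        gcongr with k
        exact hB k
    _ = K * b * (q + N) := by
        rw [Finset.sum_const, Finset.card_univ, Fintype.card_fin, nsmul_eq_mul, mul_assoc]

lemma sum_lowPlays_eq_card (B : Finset (Fin M)) (q : ℝ) (k : Fin K) (t : ℕ) (ω : Ω) :
    ∑ m ∈ B, lowPlays π X G R q k m t ω = (univ.filter fun n => X t ω n = k ∧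
      action π X G R t ω n ∈ B ∧
      (count (history π X G R t ω) k (action π X G R t ω n) : ℝ) < q).card := by
  rw [Finset.card_eq_sum_card_fiberwise (f := action π X G R t ω) (t := B)
    fun n hn => (Finset.mem_filter.mp hn).2.2.1]
  refine Finset.sum_congr rfl fun m hm => ?_
  rw [lowPlays, Finset.filter_filter]
  split_ifs with hlow
  · congr 1
    ext n
    simp only [recipients, Finset.mem_filter, Finset.mem_univ, true_and]
    constructor
    · rintro ⟨hk, rfl⟩
      exact ⟨⟨hk, hm, hlow⟩, rfl⟩
    · exact fun h => ⟨h.1.1, h.2⟩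
  · rw [eq_comm, Finset.card_eq_zero, Finset.filter_eq_empty_iff]
    rintro n - ⟨⟨-, -, hn⟩, rfl⟩
    exact hlow hn

lemma sum_sum_lowPlays_eq_card (B : Fin K → Finset (Fin M)) (q : ℝ) (t : ℕ) (ω : Ω) :
    ∑ k, ∑ m ∈ B k, lowPlays π X G R q k m t ω = (univ.filter fun n =>
      action π X G R t ω n ∈ B (X t ω n) ∧
      (count (history π X G R t ω) (X t ω n) (action π X G R t ω n) : ℝ) < q).card := by
  rw [Finset.card_eq_sum_card_fiberwise (f := X t ω) (t := univ) fun _ _ => Finset.mem_univ _]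
  refine Finset.sum_congr rfl fun k _ => ?_
  rw [sum_lowPlays_eq_card, Finset.filter_filter]
  congr 1
  ext n
  simp only [Finset.mem_filter, Finset.mem_univ, true_and]
  constructor
  · rintro ⟨rfl, h⟩
    exact ⟨h, rfl⟩
  · rintro ⟨h, rfl⟩
    exact ⟨rfl, h⟩

variable [MeasurableSpace Ω] {P : Measure Ω} {D : Fin K → Fin M → Measure ℝ}

lemma measure_arrivals_le (hB : IsBroadcastModel P D X G R) (hX : UniformUsers P X) (k : Fin K)
    (s J : ℕ) (a : ℝ) :
    P {ω | ∑ u ∈ Finset.range J, ((univ.filter fun n => X (s + u) ω n = k).card : ℝ) ≤ a} ≤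
      ofReal (exp (a - N / (2 * K) * J)) := by
  let arrivals (u : ℕ) (ω : Ω) : ℝ := -(univ.filter fun n => X (s + u) ω n = k).card
  have hmeas (u : ℕ) : Measurable (arrivals u) := (measurable_card_ctx hB univ (s + u) k).neg
  have hindep : iIndepFun arrivals P :=
    (hB.indep_slots.precomp (add_right_injective s)).comp
      (fun _ q => -((univ.filter fun n => q.1 n = k).card : ℝ))
      fun _ => (Measurable.of_discrete (f := fun x : Fin N → Fin K =>
        -((univ.filter fun n => x n = k).card : ℝ))).comp measurable_fst
  have hexp : ∫⁻ ω, ofReal (exp (∑ u ∈ Finset.range J, arrivals u ω)) ∂P ≤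
      ofReal (exp (-(N / (2 * K) * J))) := by
    have hone (u : ℕ) : ∫⁻ ω, ofReal (exp (arrivals u ω)) ∂P ≤ ofReal (exp (-(N / (2 * K)))) := by
      have hle := lintegral_exp_neg_card_ctx_le hB hX univ (s + u) k zero_le_one le_rfl le_rfl
      rw [Finset.card_univ, Fintype.card_fin, one_div_mul_eq_div] at hle
      simpa only [neg_mul, one_mul] using hle
    refine (lintegral_exp_sum_le hindep hmeas fun u _ => hone u).trans_eq ?_
    rw [Finset.sum_const, Finset.card_range, nsmul_eq_mul]
    ring_nf
  have hmarkov := meas_ge_le_lintegral_div (μ := P) (ε := ofReal (exp (-a)))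
    (f := fun ω => ofReal (exp (∑ u ∈ Finset.range J, arrivals u ω)))
    (by fun_prop) (by simp [exp_pos]) ofReal_ne_top
  refine (measure_mono fun ω hω => ?_).trans (hmarkov.trans ?_)
  · simp only [arrivals, Finset.sum_neg_distrib]
    exact ofReal_le_ofReal (exp_le_exp.mpr (neg_le_neg hω))
  · refine (ENNReal.div_le_div_right hexp _).trans_eq ?_
    rw [← ENNReal.ofReal_div_of_pos (exp_pos _), ← Real.exp_sub]
    ring_nf

end Sampling

/-! ### The algorithm without broadcasting -/

section LatentPolicy

/-- The number of samples that the algorithm without broadcasting requires in slot number `t`. -/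
noncomputable def threshold (δ : ℝ) (t : ℕ) : ℝ := 32 / δ ^ 2 * log (t + 1)

lemma threshold_nonneg (δ : ℝ) (t : ℕ) : 0 ≤ threshold δ t :=
  mul_nonneg (by positivity) (Real.log_nonneg (by simp))

lemma threshold_mono (δ : ℝ) : Monotone (threshold δ) := fun s t hst => by
  have hst' : (s : ℝ) ≤ t := by exact_mod_cast hst
  unfold threshold
  gcongr

lemma half_threshold_le_threshold_sqrt (δ : ℝ) (t : ℕ) :
    threshold δ t / 2 ≤ threshold δ (Nat.sqrt t) := by
  have hlt : (t : ℝ) + 1 ≤ (Nat.sqrt t + 1) ^ 2 := by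
    rw [sq]
    exact_mod_cast Nat.lt_succ_sqrt t
  have hlog := Real.log_le_log (by positivity) hlt
  rw [Real.log_pow] at hlog
  push_cast at hlog
  unfold threshold
  nlinarith [(by positivity : 0 ≤ 32 / δ ^ 2)]

lemma one_le_div_sq {δ : ℝ} (hδ : 0 < δ) (hδ1 : δ ≤ 1) : 1 ≤ 32 / δ ^ 2 := by
  rw [le_div_iff₀ (by positivity)]
  nlinarith

lemma log_le_threshold {δ : ℝ} (hδ : 0 < δ) (hδ1 : δ ≤ 1) (T : ℕ) : log T ≤ threshold δ T := by
  rcases T.eq_zero_or_pos with rfl | hT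
  · simp [threshold]
  have hT' : (1 : ℝ) ≤ T := by exact_mod_cast hT
  calc log T ≤ 1 * log (T + 1) := by rw [one_mul]; gcongr; linarith
    _ ≤ threshold δ T := mul_le_mul_of_nonneg_right (one_le_div_sq hδ hδ1)
      (Real.log_nonneg (by linarith))

variable {N K M τ : ℕ} (δ : ℝ) (c : Choices M) (S : Fin K → Finset (Fin M))
  (pc : Sym2 (Fin M) → Fin K)

/-- The representatives of the clusters that the algorithm without broadcasting forms after the
history `h`. -/
noncomputable def latentReps (h : List (Slot N K M)) : Finset (Fin M) :=
  reps c (cluster c (δ / 2) fun a b => |avg h (pc s(a, b)) a - avg h (pc s(a, b)) b|)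

variable {δ c S pc}

open Classical in
lemma latentPolicy_eq (h : List (Slot N K M)) (x : Fin N → Fin K) (g : Fin N → Fin τ) (n : Fin N) :
    latentPolicy N K M τ δ c S pc h x g n =
      if ((S (x n)).filter fun m => (count h (x n) m : ℝ) < threshold δ h.length).Nonempty then
        c.msg ((S (x n)).filter fun m => (count h (x n) m : ℝ) < threshold δ h.length)
      else if ((latentReps δ c pc h).filter fun m =>
          (count h (x n) m : ℝ) < threshold δ h.length).Nonempty then
        c.msg ((latentReps δ c pc h).filter fun m =>
          (count h (x n) m : ℝ) < threshold δ h.length)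
      else argmax c (latentReps δ c pc h) (avg h (x n)) := rfl

lemma latentPolicy_mem_allocation {h : List (Slot N K M)} {x : Fin N → Fin K}
    (g : Fin N → Fin τ) {n : Fin N} {m : Fin M} (hm : m ∈ S (x n))
    (hlow : (count h (x n) m : ℝ) < threshold δ h.length) :
    latentPolicy N K M τ δ c S pc h x g n ∈ S (x n) ∧
      (count h (x n) (latentPolicy N K M τ δ c S pc h x g n) : ℝ) < threshold δ h.length := by
  classical
  have hne : ((S (x n)).filter fun m => (count h (x n) m : ℝ) < threshold δ h.length).Nonempty :=
    ⟨m, Finset.mem_filter.mpr ⟨hm, hlow⟩⟩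
  rw [latentPolicy_eq, if_pos hne]
  exact Finset.mem_filter.mp (c.msg_mem _ hne)

lemma latentPolicy_mem_union_or_eq_argmax (h : List (Slot N K M)) (x : Fin N → Fin K)
    (g : Fin N → Fin τ) (n : Fin N) :
    (latentPolicy N K M τ δ c S pc h x g n ∈ S (x n) ∪ latentReps δ c pc h ∧
      (count h (x n) (latentPolicy N K M τ δ c S pc h x g n) : ℝ) < threshold δ h.length) ∨
    (latentPolicy N K M τ δ c S pc h x g n = argmax c (latentReps δ c pc h) (avg h (x n)) ∧
      ∀ m ∈ latentReps δ c pc h, threshold δ h.length ≤ count h (x n) m) := by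
  classical
  rw [latentPolicy_eq]
  split_ifs with h₁ h₂
  · have hmem := Finset.mem_filter.mp (c.msg_mem _ h₁)
    exact .inl ⟨Finset.mem_union_left _ hmem.1, hmem.2⟩
  · have hmem := Finset.mem_filter.mp (c.msg_mem _ h₂)
    exact .inl ⟨Finset.mem_union_right _ hmem.1, hmem.2⟩
  · exact .inr ⟨rfl, fun m hm => not_lt.mp fun hlt => h₂ ⟨m, Finset.mem_filter.mpr ⟨hm, hlt⟩⟩⟩

end LatentPolicy

/-! ### Failure events of the algorithm without broadcasting -/

section LatentEvents

variable {N K M τ L : ℕ} {Ω : Type*} {π : Policy N K M τ} {X : ℕ → Ω → Fin N → Fin K}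
  {G : ℕ → Ω → Fin N → Fin τ} {R : ℕ → Ω → Fin N → Fin K → Fin M → ℝ}
  {D : Fin K → Fin M → Measure ℝ} {δ : ℝ} {S : Fin K → Finset (Fin M)}

section

variable (π X G R)

/-- Some message of `S k` has fewer than half of the required samples in context `k`, in slot
number `t`. -/
def undersampled (δ : ℝ) (S : Fin K → Finset (Fin M)) (t : ℕ) (k : Fin K) : Set Ω :=
  {ω | ∃ m ∈ S k, (count (history π X G R t ω) k m : ℝ) < threshold δ t / 2}

/-- Message `m` has half of the required samples in context `k`, but its average is off by at least
`δ / 4`, in slot number `t`. -/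
def deviates (D : Fin K → Fin M → Measure ℝ) (δ : ℝ) (t : ℕ) (k : Fin K) (m : Fin M) : Set Ω :=
  {ω | threshold δ t / 2 ≤ count (history π X G R t ω) k m ∧
    δ / 4 ≤ |avg (history π X G R t ω) k m - meanPayoff D k m|}

end

lemma card_ctx_le_sum_lowPlays {c : Choices M} {pc : Sym2 (Fin M) → Fin K} {t : ℕ} {ω : Ω}
    {k : Fin K} {m : Fin M} (hm : m ∈ S k) {q : ℝ} (hq : threshold δ t ≤ q)
    (hlow : (count (history (latentPolicy N K M τ δ c S pc) X G R t ω) k m : ℝ) <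
      threshold δ t) :
    (univ.filter fun n => X t ω n = k).card ≤
      ∑ m' ∈ S k, lowPlays (latentPolicy N K M τ δ c S pc) X G R q k m' t ω := by
  rw [sum_lowPlays_eq_card]
  refine Finset.card_le_card fun n hn => ?_
  obtain rfl : X t ω n = k := (Finset.mem_filter.mp hn).2
  have hmem := latentPolicy_mem_allocation (c := c) (pc := pc) (G t ω) hm
    (by rwa [history_length])
  rw [history_length] at hmem
  exact Finset.mem_filter.mpr ⟨Finset.mem_univ n, rfl, hmem.1, hmem.2.trans_le hq⟩

-- While some message of `S k` lacks samples, every arrival in context `k` samples such a message.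
lemma arrivals_le_of_undersampled {c : Choices M} {pc : Sym2 (Fin M) → Fin K} {t T : ℕ}
    (htT : t ≤ T) {ω : Ω} {k : Fin K}
    (h : ω ∈ undersampled (latentPolicy N K M τ δ c S pc) X G R δ S t k) :
    ∑ u ∈ Finset.range (t - Nat.sqrt t),
      ((univ.filter fun n => X (Nat.sqrt t + u) ω n = k).card : ℝ) ≤
        (S k).card * (threshold δ T + N) := by
  obtain ⟨m, hm, hlow⟩ := h
  let π := latentPolicy N K M τ δ c S pc
  have hslot (u : ℕ) (hu : u ∈ Finset.range (t - Nat.sqrt t)) :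
      ((univ.filter fun n => X (Nat.sqrt t + u) ω n = k).card : ℝ) ≤
        ∑ m' ∈ S k, (lowPlays π X G R (threshold δ T) k m' (Nat.sqrt t + u) ω : ℝ) := by
    rw [Finset.mem_range] at hu
    have hle : Nat.sqrt t + u ≤ t := by lia
    have hcount : (count (history π X G R (Nat.sqrt t + u) ω) k m : ℝ) ≤
        count (history π X G R t ω) k m := by
      exact_mod_cast count_history_mono π X G R hle ω k m
    exact_mod_cast card_ctx_le_sum_lowPlays hm (threshold_mono δ (hle.trans htT))
      (hcount.trans_lt (hlow.trans_le ((half_threshold_le_threshold_sqrt δ t).trans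
        (threshold_mono δ (Nat.le_add_right _ _)))))
  refine (Finset.sum_le_sum hslot).trans ?_
  rw [Finset.sum_comm, ← nsmul_eq_mul]
  refine Finset.sum_le_card_nsmul _ _ _ fun m' _ => ?_
  refine le_trans ?_
    (sum_lowPlays_le (π := π) (X := X) (G := G) (R := R) (threshold_nonneg δ T) k m' t ω)
  have hsplit := Finset.sum_range_add
    (fun u => (lowPlays π X G R (threshold δ T) k m' u ω : ℝ)) (Nat.sqrt t) (t - Nat.sqrt t)
  rw [Nat.add_sub_cancel' (Nat.sqrt_le_self t)] at hsplit
  rw [hsplit]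
  exact le_add_of_nonneg_left (Finset.sum_nonneg fun _ _ => Nat.cast_nonneg _)

lemma quarter_le_sub_sqrt {t : ℕ} (ht : 16 ≤ t) : (t : ℝ) / 4 ≤ (t - Nat.sqrt t : ℕ) := by
  have hsq : Nat.sqrt t * Nat.sqrt t ≤ t := Nat.sqrt_le t
  have hfour : 4 ≤ Nat.sqrt t := Nat.le_sqrt.mpr ht
  have hle : t ≤ 4 * (t - Nat.sqrt t) := by
    have : 4 * Nat.sqrt t ≤ t := by nlinarith
    lia
  have hle' : (t : ℝ) ≤ 4 * (t - Nat.sqrt t : ℕ) := by exact_mod_cast hle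
  linarith

lemma sum_two_div_succ_sq_le (T : ℕ) : ∑ t ∈ Finset.range T, 2 / ((t : ℝ) + 1) ^ 2 ≤ 4 := by
  suffices ∑ t ∈ Finset.range (T + 1), 2 / ((t : ℝ) + 1) ^ 2 ≤ 4 - 2 / ((T : ℝ) + 1) by
    rw [Finset.sum_range_succ] at this
    have hlast : 0 ≤ 2 / ((T : ℝ) + 1) ^ 2 := by positivity
    have hrest : 0 ≤ 2 / ((T : ℝ) + 1) := by positivity
    linarith
  induction T with
  | zero => norm_num
  | succ T ih =>
    have hstep : 2 / (((T + 1 : ℕ) : ℝ) + 1) ^ 2 ≤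
        2 / ((T : ℝ) + 1) - 2 / (((T + 1 : ℕ) : ℝ) + 1) := by
      push_cast
      rw [div_sub_div _ _ (by positivity) (by positivity), div_le_div_iff₀ (by positivity)
        (by positivity)]
      nlinarith
    rw [Finset.sum_range_succ]
    linarith

variable [MeasurableSpace Ω] {P : Measure Ω}

lemma measurableSet_undersampled (hB : IsBroadcastModel P D X G R) (hπ : Measurable π) (t : ℕ)
    (k : Fin K) : MeasurableSet (undersampled π X G R δ S t k) := by
  have hcount (m : Fin M) : Measurable fun ω => (count (history π X G R t ω) k m : ℝ) :=
    measurable_from_top.comp ((measurable_count k m).comp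
      ((measurable_history hπ t).mono (hB.past_le t) le_rfl))
  have heq : undersampled π X G R δ S t k =
      ⋃ m ∈ S k, {ω | (count (history π X G R t ω) k m : ℝ) < threshold δ t / 2} := by
    ext ω
    simp [undersampled]
  rw [heq]
  exact Finset.measurableSet_biUnion _ fun m _ => measurableSet_lt (hcount m) measurable_const

lemma measurableSet_deviates (hB : IsBroadcastModel P D X G R) (hπ : Measurable π) (t : ℕ)
    (k : Fin K) (m : Fin M) : MeasurableSet (deviates π X G R D δ t k m) := by
  have hhist : Measurable (history π X G R t) :=
    (measurable_history hπ t).mono (hB.past_le t) le_rfl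
  have hcount : Measurable fun ω => (count (history π X G R t ω) k m : ℝ) :=
    measurable_from_top.comp ((measurable_count k m).comp hhist)
  exact (measurableSet_le measurable_const hcount).inter
    (measurableSet_le measurable_const (((measurable_avg k m).comp hhist).sub_const _).norm)

lemma measureReal_deviates_le {typ : Fin M → Fin L} (hB : IsBroadcastModel P D X G R)
    (hD : IsLatentPayoff δ D typ) (hδ : 0 < δ) (hπ : Measurable π) (t : ℕ) (k : Fin K)
    (m : Fin M) : P.real (deviates π X G R D δ t k m) ≤ 2 / ((t : ℝ) + 1) ^ 2 := by
  refine (ENNReal.toReal_le_of_le_ofReal (by positivity) (hB.measure_deviation_le hπ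
    (hD.mem_Icc k m) t (by positivity : 0 ≤ δ / 4) (threshold δ t / 2))).trans_eq ?_
  have hexponent : 2 * (δ / 4) ^ 2 * (threshold δ t / 2) = (2 : ℕ) * log (t + 1) := by
    unfold threshold
    push_cast
    field_simp
    ring
  rw [hexponent, Real.exp_neg, Real.exp_nat_mul, Real.exp_log (by positivity), div_eq_mul_inv]

lemma measureReal_undersampled_le {c : Choices M} {pc : Sym2 (Fin M) → Fin K}
    (hB : IsBroadcastModel P D X G R) (hX : UniformUsers P X) (hδ : 0 < δ) (hδ1 : δ ≤ 1)
    (hN : 0 < N) {k : Fin K} (hS : (S k).Nonempty) {t T : ℕ} (htT : t < T)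
    (ht : 16 * K * ((S k).card * (threshold δ T + N)) / N ≤ t) :
    P.real (undersampled (latentPolicy N K M τ δ c S pc) X G R δ S t k) ≤ 1 / T := by
  set a : ℝ := (S k).card * (threshold δ T + N)
  have hT : (0 : ℝ) < T := by exact_mod_cast t.zero_le.trans_lt htT
  have hN' : (0 : ℝ) < N := by exact_mod_cast hN
  have hK : (1 : ℝ) ≤ K := by exact_mod_cast k.pos
  have hqa : threshold δ T + N ≤ a :=
    le_mul_of_one_le_left (add_nonneg (threshold_nonneg δ T) hN'.le)
      (by exact_mod_cast hS.card_pos)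
  have ht16 : 16 ≤ t := by
    have hle : (16 : ℝ) ≤ t := by
      refine le_trans ?_ ht
      rw [le_div_iff₀ hN']
      nlinarith [threshold_nonneg δ T]
    exact_mod_cast hle
  have hmean : 2 * a ≤ N / (2 * K) * (t - Nat.sqrt t : ℕ) := by
    calc 2 * a = N / (2 * K) * (16 * K * a / N / 4) := by field_simp; ring
      _ ≤ N / (2 * K) * ((t : ℝ) / 4) := by gcongr
      _ ≤ _ := by gcongr; exact quarter_le_sub_sqrt ht16
  calc P.real (undersampled (latentPolicy N K M τ δ c S pc) X G R δ S t k)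
      ≤ exp (a - N / (2 * K) * (t - Nat.sqrt t : ℕ)) :=
        ENNReal.toReal_le_of_le_ofReal (exp_pos _).le ((measure_mono fun _ =>
          arrivals_le_of_undersampled htT.le).trans (measure_arrivals_le hB hX k _ _ a))
    _ ≤ exp (-log T) := exp_le_exp.mpr (by linarith [log_le_threshold hδ hδ1 T])
    _ = 1 / T := by rw [Real.exp_neg, Real.exp_log hT, one_div]

end LatentEvents

section LatentRegret

variable {N K M τ L : ℕ} {D : Fin K → Fin M → Measure ℝ} {δ : ℝ} {typ : Fin M → Fin L}
  {c : Choices M} {S : Fin K → Finset (Fin M)} {pc : Sym2 (Fin M) → Fin K}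

lemma latentReps_eq_reps_typeClasses (hD : IsLatentPayoff δ D typ) (hδ : 0 < δ)
    (hS : IsAllocation S pc) {h : List (Slot N K M)}
    (hacc : ∀ k, ∀ m ∈ S k, |avg h k m - meanPayoff D k m| < δ / 4) :
    latentReps δ c pc h = reps c (typeClasses typ) := by
  rw [latentReps, cluster_eq_typeClasses (typ := typ) c]
  intro a b hab
  obtain ⟨ha, hb⟩ := hS.pc_mem a b hab
  exact hD.dist_lt_iff hδ (hacc _ a ha) (hacc _ b hb)

variable {Ω : Type*} {π : Policy N K M τ} {X : ℕ → Ω → Fin N → Fin K}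
  {G : ℕ → Ω → Fin N → Fin τ} {R : ℕ → Ω → Fin N → Fin K → Fin M → ℝ}

variable (π X G R) in
/-- In slot number `t` some message of some `S k` is undersampled, or the average of some message
of some `S k ∪ A` deviates. -/
def latentFailure (D : Fin K → Fin M → Measure ℝ) (δ : ℝ) (S : Fin K → Finset (Fin M))
    (A : Finset (Fin M)) (t : ℕ) : Set Ω :=
  (⋃ k, undersampled π X G R δ S t k) ∪ ⋃ k, ⋃ m ∈ S k ∪ A, deviates π X G R D δ t k m

lemma abs_avg_sub_lt_of_notMem_latentFailure {A : Finset (Fin M)} {t : ℕ} {ω : Ω}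
    (hgood : ω ∉ latentFailure π X G R D δ S A t) {k : Fin K} {m : Fin M} (hm : m ∈ S k ∪ A)
    (hcount : threshold δ t / 2 ≤ count (history π X G R t ω) k m) :
    |avg (history π X G R t ω) k m - meanPayoff D k m| < δ / 4 := by
  simp only [latentFailure, Set.mem_union, Set.mem_iUnion, not_or, not_exists] at hgood
  exact not_le.mp fun hdev => hgood.2 k m hm ⟨hcount, hdev⟩

lemma half_threshold_le_count_of_notMem_latentFailure {A : Finset (Fin M)} {t : ℕ} {ω : Ω}
    (hgood : ω ∉ latentFailure π X G R D δ S A t) {k : Fin K} {m : Fin M} (hm : m ∈ S k) :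
    threshold δ t / 2 ≤ count (history π X G R t ω) k m := by
  simp only [latentFailure, Set.mem_union, Set.mem_iUnion, not_or, not_exists] at hgood
  exact not_lt.mp fun hlow => hgood.1 k ⟨m, hm, hlow⟩

lemma undersampled_action_or_gap_nonpos [NeZero M] (hD : IsLatentPayoff δ D typ) (hδ : 0 < δ)
    (hS : IsAllocation S pc) {t : ℕ} {ω : Ω} (hG : Function.Injective (G t ω))
    (hgood : ω ∉ latentFailure (latentPolicy N K M τ δ c S pc) X G R D δ S
      (reps c (typeClasses typ)) t) (n : Fin N) :
    (action (latentPolicy N K M τ δ c S pc) X G R t ω n ∈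
        S (X t ω n) ∪ reps c (typeClasses typ) ∧
      (count (history (latentPolicy N K M τ δ c S pc) X G R t ω) (X t ω n)
        (action (latentPolicy N K M τ δ c S pc) X G R t ω n) : ℝ) < threshold δ t) ∨
    gap (latentPolicy N K M τ δ c S pc) X G R D t n ω ≤ 0 := by
  set π := latentPolicy N K M τ δ c S pc
  have hreps : latentReps δ c pc (history π X G R t ω) = reps c (typeClasses typ) :=
    latentReps_eq_reps_typeClasses hD hδ hS fun k m hm =>
      abs_avg_sub_lt_of_notMem_latentFailure hgood (Finset.mem_union_left _ hm)
        (half_threshold_le_count_of_notMem_latentFailure hgood hm)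
  have hcases := latentPolicy_mem_union_or_eq_argmax (δ := δ) (c := c) (S := S) (pc := pc)
    (history π X G R t ω) (X t ω) (G t ω) n
  rw [hreps, history_length] at hcases
  refine hcases.imp_right fun ⟨haction, hcount⟩ => ?_
  have hrep := exists_mem_reps_typeClasses c typ
  have hgroup : (univ.filter fun n' => G t ω n' = G t ω n) = {n} := by
    ext n'
    simp [hG.eq_iff]
  have hacc (m : Fin M) (hm : m ∈ reps c (typeClasses typ)) :
      |avg (history π X G R t ω) (X t ω n) m - meanPayoff D (X t ω n) m| < δ / 4 :=
    abs_avg_sub_lt_of_notMem_latentFailure hgood (Finset.mem_union_right _ hm)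
      ((half_le_self (threshold_nonneg δ t)).trans (hcount m hm))
  obtain ⟨hmem, hmax⟩ := argmax_mem_and_le c ((hrep 0).imp fun _ h => h.1)
    (avg (history π X G R t ω) (X t ω n))
  have hsum := sum_meanPayoff_bestMsg_sub_nonpos (x := X t ω) (g := G t ω) (s := G t ω n)
    (r := avg (history π X G R t ω)) (ε := δ / 4) hD hδ hrep
    (fun n' hn' => hG hn' ▸ hacc) (by rw [hgroup, Finset.card_singleton]; push_cast; linarith) hmem
    (by simpa only [hgroup, Finset.sum_singleton] using hmax)
  rw [hgroup, Finset.sum_singleton, ← haction] at hsum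
  exact hsum

lemma sum_gap_latent_le [NeZero M] (hD : IsLatentPayoff δ D typ) (hδ : 0 < δ)
    (hS : IsAllocation S pc) {t : ℕ} {ω : Ω} (hG : Function.Injective (G t ω))
    (hgood : ω ∉ latentFailure (latentPolicy N K M τ δ c S pc) X G R D δ S
      (reps c (typeClasses typ)) t) {q : ℝ} (hq : threshold δ t ≤ q) :
    ∑ n, gap (latentPolicy N K M τ δ c S pc) X G R D t n ω ≤
      ∑ k, ∑ m ∈ S k ∪ reps c (typeClasses typ),
        (lowPlays (latentPolicy N K M τ δ c S pc) X G R q k m t ω : ℝ) := by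
  have hcard := sum_sum_lowPlays_eq_card (π := latentPolicy N K M τ δ c S pc) (X := X) (G := G)
    (R := R) (fun k => S k ∪ reps c (typeClasses typ)) q t ω
  have hcard' := congrArg (Nat.cast : ℕ → ℝ) hcard
  push_cast [Finset.card_filter] at hcard'
  rw [hcard']
  refine Finset.sum_le_sum fun n _ => ?_
  split_ifs with hlow
  · exact gap_le_one hD t n ω
  · exact (undersampled_action_or_gap_nonpos hD hδ hS hG hgood n).resolve_left
      fun h => hlow ⟨h.1, h.2.trans_le hq⟩

variable [MeasurableSpace Ω] {P : Measure Ω}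

lemma measurableSet_latentFailure (hB : IsBroadcastModel P D X G R) (hπ : Measurable π)
    (A : Finset (Fin M)) (t : ℕ) : MeasurableSet (latentFailure π X G R D δ S A t) :=
  (MeasurableSet.iUnion fun k => measurableSet_undersampled hB hπ t k).union
    (MeasurableSet.iUnion fun k => Finset.measurableSet_biUnion _ fun m _ =>
      measurableSet_deviates hB hπ t k m)

lemma measureReal_latentFailure_le (hB : IsBroadcastModel P D X G R)
    (hD : IsLatentPayoff δ D typ) (hδ : 0 < δ) (hπ : Measurable π) {s : ℕ}
    (hS : ∀ k, (S k).card = s) (A : Finset (Fin M)) {t : ℕ} {p : ℝ}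
    (hp : ∀ k, P.real (undersampled π X G R δ S t k) ≤ p) :
    P.real (latentFailure π X G R D δ S A t) ≤
      K * p + K * (s + A.card) * (2 / ((t : ℝ) + 1) ^ 2) := by
  refine (measureReal_union_le _ _).trans (add_le_add ?_ ?_)
  · refine (measureReal_iUnion_fintype_le _).trans ((Finset.sum_le_sum fun k _ => hp k).trans_eq ?_)
    simp
  · refine (measureReal_iUnion_fintype_le _).trans ((Finset.sum_le_card_nsmul _ _
      ((s + A.card : ℕ) * (2 / ((t : ℝ) + 1) ^ 2)) fun k _ => ?_).trans_eq ?_)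
    · refine (measureReal_biUnion_finset_le _ _).trans ((Finset.sum_le_card_nsmul _ _ _ fun m _ =>
        measureReal_deviates_le hB hD hδ hπ t k m).trans ?_)
      rw [nsmul_eq_mul]
      gcongr
      exact (Finset.card_union_le _ _).trans_eq (by rw [hS])
    · simp [mul_assoc]

lemma IsBroadcastModel.ae_injective_grp {G : ℕ → Ω → Fin N → Fin N}
    (hB : IsBroadcastModel P D X G R) (t : ℕ) : ∀ᵐ ω ∂P, Function.Injective (G t ω) := by
  filter_upwards [hB.ae_group_card t] with ω hcard n n' h
  have hone : (univ.filter fun i => G t ω i = G t ω n).card = 1 :=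
    Nat.eq_of_mul_eq_mul_right n.pos ((hcard _).trans (one_mul N).symm)
  exact Finset.card_le_one.mp hone.le n (by simp) n' (by simp [h])

lemma sum_measureReal_latentFailure_le (hB : IsBroadcastModel P D X G R)
    (hD : IsLatentPayoff δ D typ) (hδ : 0 < δ) (hπ : Measurable π) {s : ℕ}
    (hS : ∀ k, (S k).card = s) (A : Finset (Fin M)) {J T : ℕ}
    (hJ : ∀ t < T, J ≤ t → ∀ k, P.real (undersampled π X G R δ S t k) ≤ 1 / T) :
    ∑ t ∈ Finset.Ico J T, P.real (latentFailure π X G R D δ S A t) ≤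
      K + 4 * (K * (s + A.card)) := by
  calc ∑ t ∈ Finset.Ico J T, P.real (latentFailure π X G R D δ S A t)
      ≤ ∑ t ∈ Finset.Ico J T, (K * (1 / T) + K * (s + A.card) * (2 / ((t : ℝ) + 1) ^ 2)) :=
        Finset.sum_le_sum fun t ht => measureReal_latentFailure_le hB hD hδ hπ hS A
          (hJ t (Finset.mem_Ico.mp ht).2 (Finset.mem_Ico.mp ht).1)
    _ ≤ ∑ t ∈ Finset.range T, (K * (1 / T) + K * (s + A.card) * (2 / ((t : ℝ) + 1) ^ 2)) :=
        Finset.sum_le_sum_of_subset_of_nonneg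
          (fun t ht => Finset.mem_range.mpr (Finset.mem_Ico.mp ht).2) fun t _ _ => by positivity
    _ = K * (T * (T : ℝ)⁻¹) + K * (s + A.card) * ∑ t ∈ Finset.range T, 2 / ((t : ℝ) + 1) ^ 2 := by
        rw [Finset.sum_add_distrib, Finset.sum_const, Finset.card_range, nsmul_eq_mul,
          Finset.mul_sum]
        ring
    _ ≤ K * 1 + K * (s + A.card) * 4 := by
        gcongr
        · exact mul_inv_le_one
        · exact sum_two_div_succ_sq_le T
    _ = K + 4 * (K * (s + A.card)) := by ring

lemma regret_latent_le_threshold [NeZero M] {G : ℕ → Ω → Fin N → Fin N}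
    (hB : IsBroadcastModel P D X G R) (hD : IsLatentPayoff δ D typ) (hX : UniformUsers P X)
    (hS : IsAllocation S pc) (hδ : 0 < δ) (hδ1 : δ ≤ 1) (hN : 0 < N) {s : ℕ} (hs : 0 < s)
    (hcard : ∀ k, (S k).card = s) (T : ℕ) :
    regret P (latentPolicy N K M N δ c S pc) (meanPayoff D) X G R T ≤
      N * ⌈16 * K * (s * (threshold δ T + N)) / N⌉₊ + K * (s + L) * (threshold δ T + N) +
        N * (K + 4 * (K * (s + L))) := by
  have hπ : Measurable (latentPolicy N K M N δ c S pc) := measurable_latentPolicy δ c S pc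
  set A := reps c (typeClasses typ)
  have hA : A.card = L := card_reps_typeClasses c hD.typ_surjective
  have hunion (k : Fin K) : (S k ∪ A).card ≤ s + L :=
    (Finset.card_union_le _ _).trans_eq (by rw [hcard, hA])
  have hslots := regret_le_of_slots hB hD hπ ⌈16 * K * (s * (threshold δ T + N)) / N⌉₊ T _
    (measurableSet_latentFailure hB hπ A)
    (fun t ω => ∑ k, ∑ m ∈ S k ∪ A,
      (lowPlays (latentPolicy N K M N δ c S pc) X G R (threshold δ T) k m t ω : ℝ))
    (fun t ω => by positivity)
    (fun ω => sum_sum_sum_lowPlays_le (threshold_nonneg δ T) (fun k => S k ∪ A) hunion T ω) (by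
      filter_upwards [ae_all_iff.mpr hB.ae_injective_grp] with ω hG t ht _ hgood
      exact sum_gap_latent_le hD hδ hS (hG t) hgood (threshold_mono δ ht.le))
  have hfail := sum_measureReal_latentFailure_le hB hD hδ hπ hcard A (T := T)
    (J := ⌈16 * K * (s * (threshold δ T + N)) / N⌉₊) fun t htT hJt k =>
      measureReal_undersampled_le hB hX hδ hδ1 hN
        (Finset.card_pos.mp (hs.trans_eq (hcard k).symm)) htT (by
          rw [hcard]
          exact (Nat.le_ceil _).trans (by exact_mod_cast hJt))
  rw [hA] at hfail
  refine hslots.trans ?_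
  push_cast
  gcongr

end LatentRegret

section LatentBounds

lemma natCast_le_two_mul_log {N T : ℕ} (h : 2 ^ N ≤ T) : (N : ℝ) ≤ 2 * log T := by
  have hlog : log ((2 : ℝ) ^ N) ≤ log T :=
    Real.log_le_log (by positivity) (by exact_mod_cast h)
  rw [Real.log_pow] at hlog
  nlinarith [Real.log_two_gt_d9, (Nat.cast_nonneg N : (0 : ℝ) ≤ N)]

lemma threshold_le_log (δ : ℝ) {T : ℕ} (hT : 2 ≤ T) : threshold δ T ≤ 64 / δ ^ 2 * log T := by
  have hT' : (2 : ℝ) ≤ T := by exact_mod_cast hT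
  calc threshold δ T ≤ 32 / δ ^ 2 * log ((T : ℝ) ^ 2) := by
        unfold threshold
        gcongr
        nlinarith
    _ = 64 / δ ^ 2 * log T := by rw [Real.log_pow]; push_cast; ring

lemma inv_sqrt_le_two_mul_sqrt_log_div {K M : ℕ} (hK : 1 ≤ K) (hM : 2 ≤ M) :
    (√K)⁻¹ ≤ 2 * √(log (M * K) / K) := by
  have hMK : (2 : ℝ) ≤ M * K := by exact_mod_cast hM.trans (Nat.le_mul_of_pos_right M hK)
  have hlog : (1 / 2) ^ 2 ≤ log (M * K) := by
    linarith [Real.log_two_gt_d9, Real.log_le_log two_pos hMK]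
  have hsqrt : 1 / 2 ≤ √(log (M * K)) := Real.le_sqrt_of_sq_le hlog
  rw [Real.sqrt_div' _ (Nat.cast_nonneg K), ← mul_div_assoc, inv_eq_one_div]
  gcongr
  linarith

variable {N K M L : ℕ} {D : Fin K → Fin M → Measure ℝ} {δ : ℝ} {typ : Fin M → Fin L}
  {c : Choices M} {S : Fin K → Finset (Fin M)} {pc : Sym2 (Fin M) → Fin K}

lemma IsAllocation.mul_card_le (hS : IsAllocation S pc) (hK : 1 ≤ K) (hM : 2 ≤ M) :
    ∃ s : ℕ, 0 < s ∧ (∀ k, (S k).card = s) ∧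
      (K * s : ℝ) ≤ 8 * (K * M * √(log (M * K) / K)) + 2 * K := by
  obtain ⟨s, hcard, hs⟩ := hS.card_le hK
  have hne : (⟨0, by lia⟩ : Fin M) ≠ ⟨1, by lia⟩ := by simp
  have hpos := Finset.card_pos.mpr ⟨_, (hS.pc_mem _ _ hne).1⟩
  refine ⟨s, hpos.trans_eq (hcard _), hcard, ?_⟩
  calc (K * s : ℝ) ≤ K * (4 * (M * (2 * √(log (M * K) / K))) + 2) := by
        rw [div_eq_mul_inv] at hs
        grw [hs, inv_sqrt_le_two_mul_sqrt_log_div hK hM]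
    _ = _ := by ring

variable {Ω : Type*} [MeasurableSpace Ω] {P : Measure Ω} {X : ℕ → Ω → Fin N → Fin K}
  {G : ℕ → Ω → Fin N → Fin N} {R : ℕ → Ω → Fin N → Fin K → Fin M → ℝ} {T : ℕ}

lemma regret_latent_le_of_log_le [NeZero M] (hB : IsBroadcastModel P D X G R)
    (hD : IsLatentPayoff δ D typ) (hX : UniformUsers P X) (hS : IsAllocation S pc) (hδ : 0 < δ)
    (hN : 0 < N) (hK : 1 ≤ K) {s : ℕ} (hs : 0 < s) (hcard : ∀ k, (S k).card = s) {κ ℓ : ℝ}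
    (hNℓ : N ≤ 2 * ℓ) (hthr : threshold δ T + N ≤ κ * ℓ) :
    regret P (latentPolicy N K M N δ c S pc) (meanPayoff D) X G R T ≤
      (K * s * (17 * κ + 10) + K * L * (κ + 10)) * ℓ := by
  have hL : 0 < L := Fin.pos (typ 0)
  have hceil : (⌈16 * K * (s * (threshold δ T + N)) / N⌉₊ : ℝ) ≤
      16 * K * (s * (threshold δ T + N)) / N + 1 :=
    (Nat.ceil_lt_add_one (div_nonneg (mul_nonneg (by positivity) (mul_nonneg (by positivity)
      (add_nonneg (threshold_nonneg δ T) (by positivity)))) (by positivity))).le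
  have hNK : (N + N * K : ℝ) ≤ N * (K * (s + L)) := by
    norm_cast
    calc N + N * K = N * (1 + K) := by ring
      _ ≤ N * (K + K) := by gcongr
      _ = N * (K * (1 + 1)) := by ring
      _ ≤ N * (K * (s + L)) := by gcongr <;> assumption
  calc _ ≤ _ := regret_latent_le_threshold hB hD hX hS hδ (hD.le_one ⟨0, hK⟩ 0) hN hs hcard T
    _ ≤ N * (16 * K * (s * (threshold δ T + N)) / N + 1) + K * (s + L) * (threshold δ T + N) +
          N * (K + 4 * (K * (s + L))) := by gcongr
    _ = (17 * (K * s) + K * L) * (threshold δ T + N) + (N + N * K) + 4 * (K * (s + L) * N) := by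
        field_simp
        ring
    _ ≤ (17 * (K * s) + K * L) * (κ * ℓ) + N * (K * (s + L)) + 4 * (K * (s + L) * N) := by
        gcongr
    _ = (17 * (K * s) + K * L) * (κ * ℓ) + 5 * (K * (s + L)) * N := by ring
    _ ≤ (17 * (K * s) + K * L) * (κ * ℓ) + 5 * (K * (s + L)) * (2 * ℓ) := by gcongr
    _ = _ := by ring

theorem regret_latent_le [NeZero M] (hB : IsBroadcastModel P D X G R)
    (hD : IsLatentPayoff δ D typ) (hX : UniformUsers P X) (hS : IsAllocation S pc) (hδ : 0 < δ)
    (hN : 1 ≤ N) (hK : 1 ≤ K) (hT : 2 ^ N ≤ T) :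
    regret P (latentPolicy N K M N δ c S pc) (meanPayoff D) X G R T ≤
      (8704 / δ ^ 2 + 352) * ((K * M * √(log (M * K) / K) + K * L) * log T) := by
  rcases (NeZero.one_le : 1 ≤ M).eq_or_lt with rfl | hM
  · exact (regret_nonpos_of_subsingleton hB hD (measurable_latentPolicy δ c S pc)).trans
      (by positivity)
  have hKL : (K : ℝ) ≤ K * L := by exact_mod_cast Nat.le_mul_of_pos_right K (Fin.pos (typ 0))
  have hNlog := natCast_le_two_mul_log hT
  have hthr := threshold_le_log δ ((Nat.le_self_pow (Nat.one_le_iff_ne_zero.mp hN) 2).trans hT)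
  obtain ⟨s, hs, hcard, hKs⟩ := hS.mul_card_le hK hM
  set Q : ℝ := K * M * √(log (M * K) / K)
  set κ : ℝ := 64 / δ ^ 2 + 2 with hκ
  have : 0 ≤ κ := by positivity
  calc _ ≤ (K * s * (17 * κ + 10) + K * L * (κ + 10)) * log T :=
        regret_latent_le_of_log_le hB hD hX hS hδ hN hK hs hcard hNlog (by rw [hκ]; linarith)
    _ ≤ ((8 * Q + 2 * (K * L)) * (17 * κ + 10) + K * L * (κ + 10)) * log T := by
        gcongr
        linarith
    _ = (136 * κ + 80) * (Q * log T) + (35 * κ + 30) * (K * L * log T) := by ring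
    _ ≤ (136 * κ + 80) * (Q * log T) + (136 * κ + 80) * (K * L * log T) := by
        gcongr <;> norm_num
    _ = (8704 / δ ^ 2 + 352) * ((Q + K * L) * log T) := by rw [hκ]; ring

end LatentBounds

end LatentBandit

theorem mainTheorem5 :
    -- one transmission per timeslot
    (∀ δ : ℝ, 0 < δ → ∃ C : ℝ, 0 < C ∧
      ∀ (N K M L T : ℕ) [NeZero M] (c : LatentBandit.Choices M) (k₀ : Fin K)
        (D : Fin K → Fin M → Measure ℝ) (typ : Fin M → Fin L)
        (Ω : Type*) [MeasurableSpace Ω] (P : Measure Ω) (X : ℕ → Ω → Fin N → Fin K)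
        (G : ℕ → Ω → Fin N → Fin 1) (R : ℕ → Ω → Fin N → Fin K → Fin M → ℝ),
        1 ≤ N → 1 ≤ T →
        LatentBandit.IsLatentPayoff δ D typ → LatentBandit.IsBroadcastModel P D X G R →
        LatentBandit.UniformRates P X →
        Integrable (LatentBandit.regretSum (LatentBandit.broadcastPolicy N K M 1 T δ c k₀)
          (LatentBandit.meanPayoff D) X G R T) P ∧
        LatentBandit.regret P (LatentBandit.broadcastPolicy N K M 1 T δ c k₀)
            (LatentBandit.meanPayoff D) X G R T
          ≤ C * (((N * K * M + L * N ^ 2 * K : ℕ) : ℝ) * Real.log (N * M * K * T))) ∧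
    -- one transmission for every user
    (∀ δ : ℝ, 0 < δ → ∃ C : ℝ, 0 < C ∧
      ∀ (N K M L T : ℕ) [NeZero M] (c : LatentBandit.Choices M) (S : Fin K → Finset (Fin M))
        (pc : Sym2 (Fin M) → Fin K) (D : Fin K → Fin M → Measure ℝ) (typ : Fin M → Fin L)
        (Ω : Type*) [MeasurableSpace Ω] (P : Measure Ω) (X : ℕ → Ω → Fin N → Fin K)
        (G : ℕ → Ω → Fin N → Fin N) (R : ℕ → Ω → Fin N → Fin K → Fin M → ℝ),
        1 ≤ N → 1 ≤ K → 2 ^ N ≤ T → LatentBandit.IsAllocation S pc →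
        LatentBandit.IsLatentPayoff δ D typ → LatentBandit.IsBroadcastModel P D X G R →
        LatentBandit.UniformUsers P X →
        Integrable (LatentBandit.regretSum (LatentBandit.latentPolicy N K M N δ c S pc)
          (LatentBandit.meanPayoff D) X G R T) P ∧
        LatentBandit.regret P (LatentBandit.latentPolicy N K M N δ c S pc)
            (LatentBandit.meanPayoff D) X G R T
          ≤ C * ((K * M * Real.sqrt (Real.log (M * K) / K) + K * L) * Real.log T)) ∧
    -- an arbitrary number of transmissions
    (∃ C : ℝ, 0 < C ∧
      ∀ (N K M L τ T : ℕ) [NeZero M] (δ : ℝ) (c : LatentBandit.Choices M) (k₀ : Fin K)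
        (D : Fin K → Fin M → Measure ℝ) (typ : Fin M → Fin L)
        (Ω : Type*) [MeasurableSpace Ω] (P : Measure Ω) (X : ℕ → Ω → Fin N → Fin K)
        (G : ℕ → Ω → Fin N → Fin τ) (R : ℕ → Ω → Fin N → Fin K → Fin M → ℝ),
        1 ≤ N → 1 ≤ T → τ ∣ N → 0 < δ →
        (τ : ℝ) ≤ K * M / δ ^ 2 * Real.log (N * T * M) →
        LatentBandit.IsLatentPayoff δ D typ → LatentBandit.IsBroadcastModel P D X G R →
        LatentBandit.UniformUsers P X →
        Integrable (LatentBandit.regretSum (LatentBandit.broadcastPolicy N K M τ T δ c k₀)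
          (LatentBandit.meanPayoff D) X G R T) P ∧
        LatentBandit.regret P (LatentBandit.broadcastPolicy N K M τ T δ c k₀)
            (LatentBandit.meanPayoff D) X G R T
          ≤ C * (N * K * M / (τ * δ ^ 2) * Real.log (N * T * M)
              + L * N ^ 2 * K / (τ ^ 2 * δ ^ 2) * Real.log (L * N * K * T))) := by
  refine ⟨fun δ hδ => ⟨32 / δ ^ 2 + 12, by positivity, ?_⟩,
    fun δ hδ => ⟨8704 / δ ^ 2 + 352, by positivity, ?_⟩, ⟨38, by norm_num, ?_⟩⟩
  · intro N K M L T _ c k₀ D typ Ω _ P X G R hN hT hD hB hX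
    exact ⟨LatentBandit.integrable_regretSum hB hD
      (LatentBandit.measurable_broadcastPolicy T δ c k₀) T,
      LatentBandit.regret_broadcast_single_le hB hD hX hδ hN hT⟩
  · intro N K M L T _ c S pc D typ Ω _ P X G R hN hK hT hS hD hB hX
    exact ⟨LatentBandit.integrable_regretSum hB hD
      (LatentBandit.measurable_latentPolicy δ c S pc) T,
      LatentBandit.regret_latent_le hB hD hX hS hδ hN hK hT⟩
  · intro N K M L τ T _ δ c k₀ D typ Ω _ P X G R hN _ hτN hδ hτ hD hB hX
    exact ⟨LatentBandit.integrable_regretSum hB hD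
      (LatentBandit.measurable_broadcastPolicy T δ c k₀) T,
      LatentBandit.regret_broadcast_uniformUsers_le hB hD hX hδ hN hτN hτ⟩
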